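/- Let $R$ be a commutative ring with unit and let $\Sigma$ be a smooth oriented surface, possibly with boundary. **Loops.** A loop is a (piecewise) smooth immersion $\alpha:S^1\to\Sigma\setminus\partial\Sigma$ of the counterclockwise oriented circle whose only self-crossings are finitely many double transversal crossings (distinct from the finitely many non-smooth points); $\#\alpha$ is the set of its crossings. Loops are considered up to isotopy: $\beta\sim\alpha$ if $\beta=h_1\circ\alpha\circ f$, where $f:S^1\to S^1$ is an orientation preserving homeomorphism and $\{h_t\}_{t\in[0,1]}$ is a continuous family of homeomorphisms of $\Sigma$ with $h_0=\mathrm{id}$. Let $\mathcal L_0$ be the free $R$-module on the isotopy classes of loops. For $p\in\#\alpha$ write $\alpha^{-1}(p)=\{p^1,p^2\}$, ordered so that (the tangent direction of $\alpha$ at $p^1$, the tangent direction at $p^2$) is positive for the orientation of $\Sigma$, and let $\alpha_{p^i,p^j}$ be the loop obtained by restricting $\alpha$ to the arc of $S^1$ going counterclockwise from $p^i$ to $p^j$. Set $$\nu_0(\alpha)=\sum_{p\in\#\alpha}\alpha_{p^1,p^2}\otimes\alpha_{p^2,p^1}-\alpha_{p^2,p^1}\otimes\alpha_{p^1,p^2}.$$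 **Trees.** Let $\mathcal T_0(\Psi)$ be the free $R$-module on the homeomorphism classes of finite trees $T$ with oriented edges, with vertices labeled by isotopy classes of loops on $\Sigma$, and with a planar structure (an embedding in the oriented plane up to orientation preserving homeomorphism of the plane, that is, a cyclic order of the edges at each vertex); homeomorphisms of trees preserve orientations, labels and planar structures. For an edge $e$ of $T$ let $T^1_e$, $T^2_e$ be the components of $T$ with $e$ removed that contain the head and the tail of $e$ respectively, with the induced structures, and set $$\nu_0(T)=\sum_{e}T^1_e\otimes T^2_e-T^2_e\otimes T^1_e .$$ **The map $\eta_0$.** For $p\in\#\alpha$ let $e_p$ be the chord of the unit disk $D^2$ with end points $p^1,p^2$. A cut $H\prec\alpha$ is a set $H\subset\#\alpha$ such that the chords $e_p$, $p\in H$, are pairwise disjoint. They split $D^2$ into regions, the $H$-faces. Let $T_H$ be the planar tree in $D^2$ dual to this splitting: its vertices are the $H$-faces, and each $p\in H$ gives an edge $[p]$ that joins the two faces adjacent to $e_p$. A face $V$ is labeled by the class of the loop obtained by moving along $\partial V$ and applying $\alpha$ while on $\partial V\cap S^1$; the edge $[p]$ is oriented so that ($[p]$, $e_p$) is a positive basis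 in $D^2$, where $e_p$ is directed from $p^1$ to $p^2$. Set $$\eta_0(\alpha)=\sum_{H\prec\alpha}T_H\in\mathcal T_0(\Psi).$$ **Theorem.** These formulas give well-defined $R$-linear maps $\nu_0:\mathcal L_0\to\mathcal L_0\otimes\mathcal L_0$, $\nu_0:\mathcal T_0(\Psi)\to\mathcal T_0(\Psi)\otimes\mathcal T_0(\Psi)$ and $\eta_0:\mathcal L_0\to\mathcal T_0(\Psi)$. Both maps $\nu_0$ are Lie cobrackets, that is, $\mathrm{Perm}\circ\nu_0=-\nu_0$ and $(\mathrm{id}+\tau+\tau^2)\circ(\mathrm{id}\otimes\nu_0)\circ\nu_0=0$, where $\mathrm{Perm}(x\otimes y)=y\otimes x$ and $\tau(x\otimes y\otimes z)=z\otimes x\otimes y$. The map $\eta_0$ is a Lie coalgebra homomorphism: $$\nu_0\circ\eta_0=(\eta_0\otimes\eta_0)\circ\nu_0 .$$ -/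

import Mathlib

open Set
open scoped Manifold ContDiff TensorProduct
namespace LoopTree

/-- The atlas of `S` is oriented: all coordinate changes have positive Jacobian. -/
class OrientedAtlas (S : Type*) [TopologicalSpace S] [ChartedSpace (EuclideanHalfSpace 2) S] :
    Prop where
  det_pos : ∀ e ∈ atlas (EuclideanHalfSpace 2) S, ∀ e' ∈ atlas (EuclideanHalfSpace 2) S,
    ∀ x ∈ e.source ∩ e'.source,
      0 < (fderivWithin ℝ (e'.extend (𝓡∂ 2) ∘ (e.extend (𝓡∂ 2)).symm) (range (𝓡∂ 2))
        (e.extend (𝓡∂ 2) x)).det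

/-- The oriented circle `S¹ = ℝ/ℤ` with its cyclic order: `sbtw x y z` says that, going
counterclockwise from `x`, one meets `y` before `z` (all three distinct). -/
abbrev Circ : Type := AddCircle (1 : ℝ)

/-- The length in `[0, 1)` of the counterclockwise arc from `a` to `x`. -/
noncomputable def cpos (a x : Circ) : ℝ := (AddCircle.equivIco 1 0 (x - a) : ℝ)

theorem cpos_nonneg (a x : Circ) : 0 ≤ cpos a x := (AddCircle.equivIco 1 0 (x - a)).2.1

theorem cpos_lt_one (a x : Circ) : cpos a x < 1 := by
  have h := (AddCircle.equivIco 1 0 (x - a)).2.2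
  exact h.trans_eq (zero_add 1)

theorem add_cpos (a x : Circ) : a + (cpos a x : Circ) = x := by
  have : ((cpos a x : ℝ) : Circ) = x - a := (AddCircle.equivIco 1 0).symm_apply_apply (x - a)
  rw [this]; abel

theorem cpos_eq {a x : Circ} {t : ℝ} (h0 : 0 ≤ t) (h1 : t < 1) (h : a + (t : Circ) = x) :
    cpos a x = t := by
  have h2 : x - a = (t : Circ) := by rw [← h]; abel
  have h3 : t ∈ Ico (0 : ℝ) (0 + 1) := ⟨h0, by simpa using h1⟩
  unfold cpos
  rw [h2, AddCircle.equivIco_coe_eq h3]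

@[simp] theorem cpos_self (a : Circ) : cpos a a = 0 := cpos_eq le_rfl one_pos (by simp)

theorem cpos_inj {a x y : Circ} : cpos a x = cpos a y ↔ x = y :=
  ⟨fun h => by rw [← add_cpos a x, h, add_cpos], fun h => by rw [h]⟩

theorem sbtw_iff_cpos (a x y z : Circ) : sbtw x y z ↔
    (cpos a x < cpos a y ∧ cpos a y < cpos a z) ∨ (cpos a y < cpos a z ∧ cpos a z < cpos a x) ∨
      (cpos a z < cpos a x ∧ cpos a x < cpos a y) := by
  obtain ⟨r, rfl⟩ := QuotientAddGroup.mk_surjective a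
  have key : ∀ w : Circ, w = ((r + cpos (r : Circ) w : ℝ) : Circ) := fun w => by
    rw [AddCircle.coe_add]; exact (add_cpos _ _).symm
  have hb : ∀ w, 0 ≤ cpos (r : Circ) w ∧ cpos (r : Circ) w < 1 :=
    fun w => ⟨cpos_nonneg _ _, cpos_lt_one _ _⟩
  rw [sbtw_iff_not_btw]
  change ¬ btw z y x ↔ (cpos (r : Circ) x < cpos (r : Circ) y ∧ cpos (r : Circ) y < cpos (r : Circ) z) ∨
    (cpos (r : Circ) y < cpos (r : Circ) z ∧ cpos (r : Circ) z < cpos (r : Circ) x) ∨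
      (cpos (r : Circ) z < cpos (r : Circ) x ∧ cpos (r : Circ) x < cpos (r : Circ) y)
  generalize hX : cpos (r : Circ) x = X
  generalize hY : cpos (r : Circ) y = Y
  generalize hZ : cpos (r : Circ) z = Z
  have hx := hb x; have hy := hb y; have hz := hb z
  rw [key x, key y, key z, hX, hY, hZ]
  rw [hX] at hx; rw [hY] at hy; rw [hZ] at hz
  have e := @QuotientAddGroup.btw_coe_iff ℝ _ _ _ _ 1 _ (r + Z) (r + Y) (r + X)
  rw [show btw ((r + Z : ℝ) : Circ) ((r + Y : ℝ) : Circ) ((r + X : ℝ) : Circ) ↔ _ from e]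
  have c1 : toIcoMod (zero_lt_one' ℝ) (r + Z) (r + Y) = if Z ≤ Y then r + Y else r + Y + 1 := by
    rw [toIcoMod_eq_iff]
    split_ifs with h
    · exact ⟨⟨by linarith, by linarith⟩, 0, by simp⟩
    · exact ⟨⟨by linarith, by linarith⟩, -1, by simp⟩
  have c2 : toIocMod (zero_lt_one' ℝ) (r + Z) (r + X) = if Z < X then r + X else r + X + 1 := by
    rw [toIocMod_eq_iff]
    split_ifs with h
    · exact ⟨⟨by linarith, by linarith⟩, 0, by simp⟩
    · exact ⟨⟨by linarith, by linarith⟩, -1, by simp⟩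
  have e1 : toIcoMod (Fact.out : (0:ℝ) < 1) (r + Z) (r + Y) = _ := c1
  have e2 : toIocMod (Fact.out : (0:ℝ) < 1) (r + Z) (r + X) = _ := c2
  rw [e1, e2]
  obtain ⟨hx0, hx1⟩ := hx
  obtain ⟨hy0, hy1⟩ := hy
  obtain ⟨hz0, hz1⟩ := hz
  split_ifs <;> constructor <;> intro h <;> grind


section Loops

variable {S : Type*} [TopologicalSpace S] [ChartedSpace (EuclideanHalfSpace 2) S]

/-- `γ` restricted to the interval `J` is a smooth immersion (one-sided at end points of `J`). -/
def SmoothImmersionOn (γ : ℝ → S) (J : Set ℝ) : Prop :=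
  ContMDiffOn 𝓘(ℝ, ℝ) (𝓡∂ 2) ∞ γ J ∧ ∀ t ∈ J, mfderivWithin 𝓘(ℝ, ℝ) (𝓡∂ 2) γ J t ≠ 0

/-- The tangent vector of `γ` at time `0`, in the coordinates of the preferred chart at `γ 0`. -/
noncomputable def velocity (γ : ℝ → S) : EuclideanSpace ℝ (Fin 2) :=
  mfderiv 𝓘(ℝ, ℝ) (𝓡∂ 2) γ 0 (1 : ℝ)

/-- `v, w` is a positive basis iff `0 < det₂ v w`, and a basis iff `det₂ v w ≠ 0`. -/
def det₂ (v w : EuclideanSpace ℝ (Fin 2)) : ℝ := v 0 * w 1 - v 1 * w 0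

variable (S) in
/-- A generic loop: a piecewise smooth immersion of the circle in the interior of `S` having only
double transversal self-crossings, finite in number and distinct from the (finitely many, by
compactness) non-smooth points. -/
structure GenericLoop where
  toFun : Circ → S
  continuous : Continuous toFun
  interior : ∀ x, (𝓡∂ 2).IsInteriorPoint (toFun x)
  piecewise_smooth : ∀ x : Circ, ∃ ε : ℝ, 0 < ε ∧
    SmoothImmersionOn (fun u : ℝ => toFun (x + u)) (Icc 0 ε) ∧
    SmoothImmersionOn (fun u : ℝ => toFun (x + u)) (Icc (-ε) 0)
  double_points : ∀ x y z, toFun x = toFun y → toFun y = toFun z → x = y ∨ y = z ∨ x = z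
  finite_crossings : {p : Circ × Circ | p.1 ≠ p.2 ∧ toFun p.1 = toFun p.2}.Finite
  smooth_at_crossing : ∀ x y, x ≠ y → toFun x = toFun y →
    ContMDiffAt 𝓘(ℝ, ℝ) (𝓡∂ 2) ∞ (fun u : ℝ => toFun (x + u)) 0
  transverse : ∀ x y, x ≠ y → toFun x = toFun y →
    det₂ (velocity fun u : ℝ => toFun (x + u)) (velocity fun u : ℝ => toFun (y + u)) ≠ 0

theorem SmoothImmersionOn.rescale {γ γ' : ℝ → S} {a b a' b' L : ℝ}
    (h : SmoothImmersionOn γ (Icc a b)) (hL : 0 < L) (hab : a' < b')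
    (hm : ∀ t ∈ Icc a' b', L * t ∈ Icc a b) (he : ∀ t ∈ Icc a' b', γ' t = γ (L * t)) :
    SmoothImmersionOn γ' (Icc a' b') := by
  have hmul : ContMDiff 𝓘(ℝ, ℝ) 𝓘(ℝ, ℝ) ∞ (fun t : ℝ => L * t) :=
    (contDiff_const.mul contDiff_id).contMDiff
  refine ⟨(h.1.comp hmul.contMDiffOn hm).congr he, fun t ht h0 => ?_⟩
  have hu : UniqueMDiffWithinAt 𝓘(ℝ, ℝ) (Icc a' b') t :=
    ((uniqueDiffOn_Icc hab) t ht).uniqueMDiffWithinAt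
  have hγ : HasMFDerivWithinAt 𝓘(ℝ, ℝ) (𝓡∂ 2) γ (Icc a b) (L * t)
      (mfderivWithin 𝓘(ℝ, ℝ) (𝓡∂ 2) γ (Icc a b) (L * t)) :=
    ((h.1 (L * t) (hm t ht)).mdifferentiableWithinAt (by simp)).hasMFDerivWithinAt
  have hd : HasMFDerivWithinAt 𝓘(ℝ, ℝ) 𝓘(ℝ, ℝ) (fun t : ℝ => L * t) (Icc a' b') t
      (L • ContinuousLinearMap.id ℝ ℝ) := by
    apply HasFDerivWithinAt.hasMFDerivWithinAt
    exact ((hasFDerivAt_id t).const_mul L).hasFDerivWithinAt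
  have hc := (hγ.comp t hd hm).congr_of_eventuallyEq
    (Filter.eventually_of_mem self_mem_nhdsWithin he) (he t ht)
  have h1 := hc.mfderivWithin hu
  rw [h0] at h1
  have h2 : ∀ A : ℝ →L[ℝ] EuclideanSpace ℝ (Fin 2),
      A.comp (L • ContinuousLinearMap.id ℝ ℝ) = 0 → A = 0 := by
    intro A hA
    refine ContinuousLinearMap.ext fun r => ?_
    have h3 := congrArg (fun B : ℝ →L[ℝ] EuclideanSpace ℝ (Fin 2) => B (L⁻¹ * r)) hA
    have h4 : A (L * (L⁻¹ * r)) = 0 := h3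
    rwa [mul_inv_cancel_left₀ hL.ne'] at h4
  exact h.2 (L * t) (hm t ht) (h2 _ h1.symm)

theorem velocity_rescale {γ γ' : ℝ → S} {L : ℝ}
    (h : ContMDiffAt 𝓘(ℝ, ℝ) (𝓡∂ 2) ∞ γ 0) (he : γ' =ᶠ[nhds 0] fun t => γ (L * t)) :
    ContMDiffAt 𝓘(ℝ, ℝ) (𝓡∂ 2) ∞ γ' 0 ∧ velocity γ' = L • velocity γ := by
  have hmul : ContMDiff 𝓘(ℝ, ℝ) 𝓘(ℝ, ℝ) ∞ (fun t : ℝ => L * t) :=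
    (contDiff_const.mul contDiff_id).contMDiff
  have h' : ContMDiffAt 𝓘(ℝ, ℝ) (𝓡∂ 2) ∞ γ (L * 0) := by rwa [mul_zero]
  refine ⟨(h'.comp (0 : ℝ) hmul.contMDiffAt).congr_of_eventuallyEq he, ?_⟩
  have hγ : HasMFDerivAt 𝓘(ℝ, ℝ) (𝓡∂ 2) γ (L * 0) (mfderiv 𝓘(ℝ, ℝ) (𝓡∂ 2) γ (L * 0)) :=
    (h'.mdifferentiableAt (by simp)).hasMFDerivAt
  have hd : HasMFDerivAt 𝓘(ℝ, ℝ) 𝓘(ℝ, ℝ) (fun t : ℝ => L * t) 0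
      (L • ContinuousLinearMap.id ℝ ℝ) := by
    apply HasFDerivAt.hasMFDerivAt
    exact ((hasFDerivAt_id (0 : ℝ)).const_mul L)
  have hc := ((hγ.comp (0 : ℝ) hd).congr_of_eventuallyEq he).mfderiv
  have h2 := congrArg (fun A : ℝ →L[ℝ] EuclideanSpace ℝ (Fin 2) => A 1) hc
  have h3 : ∀ A : ℝ →L[ℝ] EuclideanSpace ℝ (Fin 2), A (L • (1 : ℝ)) = L • A 1 :=
    fun A => map_smul A L 1
  have h4 := h2.trans (h3 (mfderiv 𝓘(ℝ, ℝ) (𝓡∂ 2) γ (L * 0)))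
  rw [mul_zero] at h4
  exact h4

/-- The affine parametrization of the counterclockwise arc from `a` to `b`. -/
noncomputable def arcParam (a b s : Circ) : Circ := a + ((cpos a b * cpos 0 s : ℝ) : Circ)

theorem cpos_arcParam (a b s : Circ) : cpos a (arcParam a b s) = cpos a b * cpos 0 s :=
  cpos_eq (mul_nonneg (cpos_nonneg _ _) (cpos_nonneg _ _))
    (mul_lt_one_of_nonneg_of_lt_one_left (cpos_nonneg _ _) (cpos_lt_one _ _) (cpos_lt_one _ _).le) rfl

theorem cpos_pos {a b : Circ} (h : a ≠ b) : 0 < cpos a b := by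
  refine lt_of_le_of_ne (cpos_nonneg _ _) fun h0 => h ?_
  rw [← cpos_inj (a := a), cpos_self, h0]

theorem arcParam_injective {a b : Circ} (h : a ≠ b) : Function.Injective (arcParam a b) := by
  intro s t hst
  have := congrArg (cpos a) hst
  rw [cpos_arcParam, cpos_arcParam] at this
  exact cpos_inj.1 (mul_left_cancel₀ (cpos_pos h).ne' this)

theorem arcParam_add {a b s : Circ} {u : ℝ} (h0 : 0 ≤ cpos 0 s + u) (h1 : cpos 0 s + u < 1) :
    arcParam a b (s + u) = arcParam a b s + ((cpos a b * u : ℝ) : Circ) := by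
  have : cpos 0 (s + u) = cpos 0 s + u := cpos_eq h0 h1 (by
    rw [AddCircle.coe_add, ← add_assoc, add_cpos])
  rw [arcParam, arcParam, this, mul_add, AddCircle.coe_add, add_assoc]

theorem arcParam_ne {a b s : Circ} (h : a ≠ b) : arcParam a b s ≠ b := by
  intro h1
  have h2 := congrArg (cpos a) h1
  rw [cpos_arcParam] at h2
  nlinarith [cpos_pos h, cpos_lt_one 0 s]

theorem GenericLoop.arc_crossing (α : GenericLoop S) (a b : Circ) (hne : a ≠ b)
    (hab : α.toFun a = α.toFun b) (x y : Circ) (hxy : x ≠ y)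
    (h : α.toFun (arcParam a b x) = α.toFun (arcParam a b y)) :
    ContMDiffAt 𝓘(ℝ, ℝ) (𝓡∂ 2) ∞ (fun u : ℝ => α.toFun (arcParam a b (x + u))) 0 ∧
    (velocity fun u : ℝ => α.toFun (arcParam a b (x + u))) =
      cpos a b • velocity fun u : ℝ => α.toFun (arcParam a b x + u) := by
  have hxy' : arcParam a b x ≠ arcParam a b y := fun h' => hxy (arcParam_injective hne h')
  have hx : 0 < cpos 0 x := by
    refine lt_of_le_of_ne (cpos_nonneg _ _) fun h0 => ?_
    have ha : arcParam a b x = a := by simp [arcParam, ← h0]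
    rw [ha] at h hxy'
    rcases α.double_points b a (arcParam a b y) hab.symm h with h1 | h1 | h1
    · exact hne h1.symm
    · exact hxy' h1
    · exact arcParam_ne hne h1.symm
  refine velocity_rescale (α.smooth_at_crossing _ _ hxy' h) ?_
  filter_upwards [Ioo_mem_nhds (neg_lt_zero.2 hx) (sub_pos.2 (cpos_lt_one 0 x))] with u hu
  rw [arcParam_add (by linarith [hu.1]) (by linarith [hu.2])]

/-- The loop `α_{a,b}`: the restriction of `α` to the arc from `a` to `b`, where `a`, `b` are the
two preimages of a crossing. -/
noncomputable def GenericLoop.arc (α : GenericLoop S) (a b : Circ) (hne : a ≠ b)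
    (hab : α.toFun a = α.toFun b) : GenericLoop S where
  toFun s := α.toFun (arcParam a b s)
  continuous := by
    have h : (fun s => α.toFun (arcParam a b s)) =
        AddCircle.liftIco 1 0 (fun t : ℝ => α.toFun (a + ((cpos a b * t : ℝ) : Circ))) := by
      funext s
      simp only [AddCircle.liftIco, Function.comp, arcParam, cpos, sub_zero]
      rfl
    rw [h]
    refine AddCircle.liftIco_zero_continuous ?_ ?_
    · simp only [mul_zero, mul_one, add_cpos]
      simpa using hab
    · refine (α.continuous.comp (continuous_const.add
        ((AddCircle.continuous_mk' 1).comp (continuous_const.mul continuous_id)))).continuousOn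
  interior s := α.interior _
  piecewise_smooth s := by
    have hL := cpos_pos hne
    obtain ⟨ε₁, hε₁, hr, -⟩ := α.piecewise_smooth (arcParam a b s)
    have h1 : 0 < 1 - cpos 0 s := sub_pos.2 (cpos_lt_one _ _)
    obtain ⟨y, δ, hδ, ε₂, hε₂, hl, hy⟩ : ∃ (y : Circ) (δ : ℝ), 0 < δ ∧ ∃ ε₂ : ℝ, 0 < ε₂ ∧
        SmoothImmersionOn (fun u : ℝ => α.toFun (y + u)) (Icc (-ε₂) 0) ∧
        ∀ u ∈ Icc (-δ) 0, α.toFun (arcParam a b (s + (u : ℝ))) =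
          α.toFun (y + ((cpos a b * u : ℝ) : Circ)) := by
      rcases (cpos_nonneg 0 s).eq_or_lt with h0 | h0
      · obtain ⟨ε₂, hε₂, -, hl⟩ := α.piecewise_smooth b
        refine ⟨b, 1 / 2, by norm_num, ε₂, hε₂, hl, fun u hu => ?_⟩
        have hs : s = 0 := by rw [← cpos_inj (a := 0), cpos_self, h0]
        subst hs
        rcases hu.2.eq_or_lt with h | h
        · subst h
          simpa [arcParam] using hab
        · have : cpos 0 ((0 : Circ) + (u : Circ)) = u + 1 := cpos_eq (by linarith [hu.1]) (by linarith)
            (by rw [AddCircle.coe_add_period])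
          rw [arcParam, this, mul_add, mul_one, add_comm (cpos a b * u), AddCircle.coe_add,
            ← add_assoc, add_cpos]
      · obtain ⟨ε₂, hε₂, -, hl⟩ := α.piecewise_smooth (arcParam a b s)
        refine ⟨_, cpos 0 s, h0, ε₂, hε₂, hl, fun u hu => ?_⟩
        rw [arcParam_add (by linarith [hu.1]) (by linarith [hu.2])]
    refine ⟨min (min (ε₁ / cpos a b) (ε₂ / cpos a b)) (min ((1 - cpos 0 s) / 2) δ), by positivity,
      hr.rescale hL (by positivity) (fun t ht => ?_) (fun t ht => ?_),
      hl.rescale hL (neg_lt_zero.2 (by positivity)) (fun t ht => ?_) (fun t ht => ?_)⟩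
    · have := (le_min_iff.1 (le_min_iff.1 ht.2).1).1
      rw [le_div_iff₀ hL] at this
      exact ⟨mul_nonneg hL.le ht.1, by linarith⟩
    · have := (le_min_iff.1 (le_min_iff.1 ht.2).2).1
      rw [arcParam_add (by linarith [ht.1, cpos_nonneg 0 s]) (by linarith)]
    · have := (le_min_iff.1 (le_min_iff.1 (neg_le.1 ht.1)).1).2
      rw [le_div_iff₀ hL] at this
      exact ⟨by linarith, mul_nonpos_of_nonneg_of_nonpos hL.le ht.2⟩
    · have := (le_min_iff.1 (le_min_iff.1 (neg_le.1 ht.1)).2).2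
      exact hy t ⟨by linarith, ht.2⟩
  double_points x y z h1 h2 := by
    have hi := arcParam_injective hne
    rcases α.double_points _ _ _ h1 h2 with h | h | h
    · exact Or.inl (hi h)
    · exact Or.inr (Or.inl (hi h))
    · exact Or.inr (Or.inr (hi h))
  finite_crossings := by
    have hi := arcParam_injective hne
    refine (α.finite_crossings.preimage
      ((hi.prodMap hi).injOn (s := Prod.map (arcParam a b) (arcParam a b) ⁻¹' _))).subset ?_
    rintro ⟨x, y⟩ ⟨h1, h2⟩
    exact ⟨fun h => h1 (hi h), h2⟩
  smooth_at_crossing x y hxy h := (α.arc_crossing a b hne hab x y hxy h).1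
  transverse x y hxy h := by
    have hL := cpos_pos hne
    have h1 := (α.arc_crossing a b hne hab x y hxy h).2
    have h2 := (α.arc_crossing a b hne hab y x hxy.symm h.symm).2
    have h3 := α.transverse _ _ (fun h' => hxy (arcParam_injective hne h')) h
    rw [h1, h2]
    intro h0
    apply h3
    have h4 : cpos a b * cpos a b * det₂
        (velocity fun u : ℝ => α.toFun (arcParam a b x + u))
        (velocity fun u : ℝ => α.toFun (arcParam a b y + u)) = 0 := by
      rw [← h0]; simp only [det₂, PiLp.smul_apply, smul_eq_mul]; ring
    rcases mul_eq_zero.1 h4 with h5 | h5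
    · exact absurd h5 (mul_pos hL hL).ne'
    · exact h5
end Loops

section Chords

/-- The chords `p` and `q` of the circle (with four distinct end points) are linked, i.e. meet: the
end points of `q` lie on different sides of `p`. -/
def Linked (p q : Circ × Circ) : Prop :=
  (sbtw p.1 q.1 p.2 ∧ sbtw p.2 q.2 p.1) ∨ (sbtw p.1 q.2 p.2 ∧ sbtw p.2 q.1 p.1)

/-- A finite set of pairwise disjoint (oriented) chords of the circle. -/
structure IsChordSystem (H : Set (Circ × Circ)) : Prop where
  finite : H.Finite
  ne : ∀ p ∈ H, p.1 ≠ p.2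
  disjoint : ∀ p ∈ H, ∀ q ∈ H, p ≠ q → p.1 ≠ q.1 ∧ p.1 ≠ q.2 ∧ p.2 ≠ q.1 ∧ p.2 ≠ q.2
  unlinked : ∀ p ∈ H, ∀ q ∈ H, p ≠ q → ¬ Linked p q

/-- `x` is not an end point of a chord in `H`. -/
def OffChords (H : Set (Circ × Circ)) (x : Circ) : Prop := ∀ p ∈ H, x ≠ p.1 ∧ x ≠ p.2

/-- The points of the circle that no chord of `H` separates from `x`. -/
def faceOf (H : Set (Circ × Circ)) (x : Circ) : Set Circ :=
  {y | OffChords H y ∧ ∀ p ∈ H, (sbtw p.1 x p.2 ↔ sbtw p.1 y p.2)}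

/-- The `H`-faces, i.e. the regions into which the chords of `H` split the disk. A region is
represented by its intersection with the circle (without end points of chords): this is nonempty
and consists of all points of the circle not separated by a chord from a given one. -/
def Face (H : Set (Circ × Circ)) : Type :=
  {V : Set Circ // ∃ x, OffChords H x ∧ V = faceOf H x}

/-- The part on the circle of the closed region `V` (cut out by closed arcs of the chords). -/
def closedFace (H : Set (Circ × Circ)) (V : Set Circ) : Set Circ :=
  {y | ∀ p ∈ H, (V ⊆ Set.cIoo p.1 p.2 → y ∈ Set.cIcc p.1 p.2) ∧
    (V ⊆ Set.cIoo p.2 p.1 → y ∈ Set.cIcc p.2 p.1)}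

variable {S : Type*} [TopologicalSpace S] [ChartedSpace (EuclideanHalfSpace 2) S]

/-- The loop `β` is obtained by moving along the boundary of the region `V` and applying `α` while
being on the circle: `β = α ∘ g`, where `g` preserves the cyclic order and runs through the arcs of
the region that lie on the circle, jumping over the chords (whose end points `α` identifies). -/
def RunsAlong (α : GenericLoop S) (H : Set (Circ × Circ)) (V : Set Circ) (β : GenericLoop S) :
    Prop :=
  ∃ g : Circ → Circ, (∀ x y z, sbtw x y z → sbtw (g x) (g y) (g z)) ∧
    V ⊆ range g ∧ range g ⊆ closedFace H V ∧ ∀ s, β.toFun s = α.toFun (g s)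

theorem sbtw_arcParam {a b : Circ} (hne : a ≠ b) (x y z : Circ) :
    sbtw (arcParam a b x) (arcParam a b y) (arcParam a b z) ↔ sbtw x y z := by
  rw [sbtw_iff_cpos a, sbtw_iff_cpos 0 x]
  simp only [cpos_arcParam, mul_lt_mul_iff_right₀ (cpos_pos hne)]

theorem exists_arcParam {a b x : Circ} (h : sbtw a x b) : ∃ s, arcParam a b s = x := by
  have h1 := (sbtw_iff_cpos a _ _ _).1 h
  have h2 := cpos_nonneg a x
  have h3 := cpos_nonneg a b
  rw [cpos_self] at h1
  have h4 : 0 < cpos a x ∧ cpos a x < cpos a b := by grind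
  have h5 : 0 < cpos a b := h4.1.trans h4.2
  refine ⟨((cpos a x / cpos a b : ℝ) : Circ), ?_⟩
  have h6 : cpos 0 ((cpos a x / cpos a b : ℝ) : Circ) = cpos a x / cpos a b :=
    cpos_eq (by positivity) ((div_lt_one h5).2 h4.2) (zero_add _)
  rw [← cpos_inj (a := a), cpos_arcParam, h6, mul_div_cancel₀ _ h5.ne']

theorem arcParam_mem {a b : Circ} (hne : a ≠ b) (s : Circ) :
    arcParam a b s = a ∨ sbtw a (arcParam a b s) b := by
  rcases (cpos_nonneg 0 s).eq_or_lt with h | h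
  · left; simp [arcParam, ← h]
  · right
    rw [sbtw_iff_cpos a, cpos_arcParam, cpos_self]
    have := cpos_pos hne
    exact Or.inl ⟨by positivity, by nlinarith [cpos_lt_one 0 s]⟩

theorem mem_faceOf_self {H : Set (Circ × Circ)} {x : Circ} (hx : OffChords H x) :
    x ∈ faceOf H x := ⟨hx, fun _ _ => Iff.rfl⟩

theorem faceOf_subset {H : Set (Circ × Circ)} {x : Circ} {p : Circ × Circ} (hp : p ∈ H)
    (h : sbtw p.1 x p.2) : faceOf H x ⊆ Set.cIoo p.1 p.2 := fun _ hy => (hy.2 p hp).1 h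

theorem sbtw_or {p : Circ × Circ} {x : Circ} (hp : p.1 ≠ p.2) (h1 : x ≠ p.1) (h2 : x ≠ p.2) :
    sbtw p.1 x p.2 ∨ sbtw p.2 x p.1 := by
  rw [sbtw_iff_cpos p.1, sbtw_iff_cpos p.1 p.2]
  rw [ne_eq, ← cpos_inj (a := p.1)] at h1 h2 hp
  grind

theorem side_iff {a b c d x : Circ}
    (h : ¬ Linked (a, b) (c, d)) (h1 : a ≠ c) (h2 : a ≠ d) (h3 : b ≠ c)
    (hc : ¬ sbtw a c b) (hx : sbtw a x b) :
    (sbtw c x d ↔ sbtw c a d) := by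
  unfold Linked at h
  simp only [sbtw_iff_cpos a, cpos_self] at *
  rw [ne_eq, ← cpos_inj (a := a)] at h1 h2 h3
  rw [cpos_self] at h1 h2
  have := cpos_nonneg a b
  have := cpos_nonneg a c
  have := cpos_nonneg a d
  have := cpos_nonneg a x
  grind

theorem linked_swap {a b : Circ} {q : Circ × Circ} : Linked (b, a) q ↔ Linked (a, b) q := by
  unfold Linked; tauto

theorem unlinked_side {a b c d : Circ} (h : ¬ Linked (a, b) (c, d)) (hab : a ≠ b)
    (h1 : a ≠ c) (h2 : a ≠ d) (h3 : b ≠ c) (h4 : b ≠ d) : sbtw a c b ↔ sbtw a d b := by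
  have hc := sbtw_or (p := (a, b)) hab h1.symm h3.symm
  have hd := sbtw_or (p := (a, b)) hab h2.symm h4.symm
  unfold Linked at h
  have := @sbtw_asymm _ _ a c b
  have := @sbtw_asymm _ _ a d b
  dsimp only at hc hd h
  tauto

theorem exists_runsAlong (n : ℕ) : ∀ (α : GenericLoop S) (H : Set (Circ × Circ)) (x : Circ),
    IsChordSystem H → H.ncard = n → (∀ p ∈ H, α.toFun p.1 = α.toFun p.2) → OffChords H x →
    ∃ β, RunsAlong α H (faceOf H x) β := by
  induction n using Nat.strong_induction_on with
  | _ n ih =>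
  intro α H x hH hn hα hx
  rcases H.eq_empty_or_nonempty with rfl | ⟨p, hp⟩
  · exact ⟨α, id, fun _ _ _ h => h, fun y _ => ⟨y, rfl⟩, fun y _ q hq => absurd hq (by simp),
      fun _ => rfl⟩
  obtain ⟨a, b, hne, hab, hxab, hpab⟩ : ∃ a b, a ≠ b ∧ α.toFun a = α.toFun b ∧ sbtw a x b ∧
      (p = (a, b) ∨ p = (b, a)) := by
    rcases sbtw_or (hH.ne p hp) (hx p hp).1 (hx p hp).2 with h | h
    · exact ⟨p.1, p.2, hH.ne p hp, hα p hp, h, Or.inl rfl⟩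
    · exact ⟨p.2, p.1, (hH.ne p hp).symm, (hα p hp).symm, h, Or.inr rfl⟩
  have hdis : ∀ q ∈ H, q ≠ p → ¬ Linked (a, b) q ∧ a ≠ q.1 ∧ a ≠ q.2 ∧ b ≠ q.1 ∧ b ≠ q.2 := by
    intro q hq hqp
    have h1 := hH.disjoint p hp q hq hqp.symm
    have h2 := hH.unlinked p hp q hq hqp.symm
    rcases hpab with rfl | rfl
    · exact ⟨h2, h1⟩
    · exact ⟨fun h => h2 (linked_swap.2 h), h1.2.2.1, h1.2.2.2, h1.1, h1.2.1⟩
  have hi := arcParam_injective hne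
  obtain ⟨x', rfl⟩ := exists_arcParam hxab
  set g := arcParam a b with hg
  set H' : Set (Circ × Circ) := {q | (g q.1, g q.2) ∈ H} with hH'
  have hinj : Function.Injective (fun q : Circ × Circ => (g q.1, g q.2)) := hi.prodMap hi
  have hH'c : IsChordSystem H' := by
    refine ⟨hH.finite.preimage hinj.injOn, fun q hq h => hH.ne _ hq (congrArg g h), ?_, ?_⟩
    · intro q hq r hr hqr
      have := hH.disjoint _ hq _ hr (fun h => hqr (hinj h))
      exact ⟨fun h => this.1 (congrArg g h), fun h => this.2.1 (congrArg g h),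
        fun h => this.2.2.1 (congrArg g h), fun h => this.2.2.2 (congrArg g h)⟩
    · intro q hq r hr hqr hl
      refine hH.unlinked _ hq _ hr (fun h => hqr (hinj h)) ?_
      simpa only [Linked, hg, sbtw_arcParam hne] using hl
  have hlt : H'.ncard < n := by
    rw [← hn, ← Set.ncard_image_of_injective H' hinj]
    refine Set.ncard_lt_ncard ?_ hH.finite
    refine ⟨by rintro _ ⟨q, hq, rfl⟩; exact hq, fun hsub => ?_⟩
    obtain ⟨q, -, hq⟩ := hsub hp
    have := @arcParam_ne a b q.1 hne
    have := @arcParam_ne a b q.2 hne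
    rcases hpab with rfl | rfl <;> simp only [Prod.mk.injEq] at hq <;> tauto
  have hx' : OffChords H' x' := fun q hq =>
    ⟨fun h => (hx _ hq).1 (congrArg g h), fun h => (hx _ hq).2 (congrArg g h)⟩
  obtain ⟨β, g₂, hmono, hsub, hrange, hβ⟩ := ih _ hlt (α.arc a b hne hab) H' x' hH'c rfl
    (fun q hq => hα _ hq) hx'
  refine ⟨β, g ∘ g₂, fun y z w h => (sbtw_arcParam hne _ _ _).2 (hmono y z w h), ?_, ?_, hβ⟩
  · intro z hz
    have hzab : sbtw a z b := by
      have h1 := (hz.2 p hp)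
      have h2 := sbtw_or (hH.ne p hp) (hz.1 p hp).1 (hz.1 p hp).2
      have := sbtw_asymm hxab
      rcases hpab with rfl | rfl
      · exact h1.1 hxab
      · exact h2.resolve_left fun h => this (h1.2 h)
    obtain ⟨z', rfl⟩ := exists_arcParam hzab
    have hz' : z' ∈ faceOf H' x' := by
      refine ⟨fun q hq => ⟨fun h => (hz.1 _ hq).1 (congrArg g h),
        fun h => (hz.1 _ hq).2 (congrArg g h)⟩, fun q hq => ?_⟩
      have := hz.2 _ hq
      simpa only [hg, sbtw_arcParam hne] using this
    obtain ⟨s, rfl⟩ := hsub hz'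
    exact ⟨s, rfl⟩
  · rintro _ ⟨s, rfl⟩ q hq
    have hy := hrange ⟨s, rfl⟩
    have hxF := mem_faceOf_self hx
    have hmem := arcParam_mem hne (g₂ s)
    rw [Function.comp, ← hg] at *
    by_cases hqp : q = p
    · have h1 : btw a (g (g₂ s)) b := by
        rcases hmem with h | h
        · rw [h]; exact btw_refl_left _ _
        · exact h.btw
      have := sbtw_asymm hxab
      subst hqp
      rcases hpab with rfl | rfl
      · exact ⟨fun _ => h1, fun h => absurd (h hxF) this⟩
      · exact ⟨fun h => absurd (h hxF) this, fun _ => h1⟩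
    · obtain ⟨h0, h1, h2, h3, h4⟩ := hdis q hq hqp
      by_cases hs : sbtw a q.1 b
      · have hs2 := (unlinked_side h0 hne h1 h2 h3 h4).1 hs
        obtain ⟨c, hc⟩ := exists_arcParam hs
        obtain ⟨d, hd⟩ := exists_arcParam hs2
        have hcd : (c, d) ∈ H' := by
          change (arcParam a b c, arcParam a b d) ∈ H
          rw [hc, hd]; exact hq
        have := hy (c, d) hcd
        rw [← hc, ← hd]
        simp only [Set.mem_cIcc, btw_iff_not_sbtw] at this ⊢
        refine ⟨fun h => (sbtw_arcParam hne _ _ _).not.2 (this.1 (faceOf_subset hcd ?_)),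
          fun h => (sbtw_arcParam hne _ _ _).not.2 (this.2 fun w hw => ?_)⟩
        · exact (sbtw_arcParam hne _ _ _).1 (h hxF)
        · have h5 : sbtw d x' c := (sbtw_arcParam hne _ _ _).1 (h hxF)
          have h6 := (hw.2 _ hcd).not.1 (sbtw_asymm h5)
          exact (sbtw_or (p := (c, d)) (hH'c.ne _ hcd) (hw.1 _ hcd).1 (hw.1 _ hcd).2).resolve_left h6
      · have hs2 := (unlinked_side h0 hne h1 h2 h3 h4).not.1 hs
        have e1 := fun w => side_iff (x := w) h0 h1 h2 h3 hs
        have h0' : ¬ Linked (a, b) (q.2, q.1) := fun h => h0 (by unfold Linked at *; tauto)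
        have e2 := fun w => side_iff (x := w) h0' h2 h1 h4 hs2
        constructor
        · intro h
          have h5 := (e1 _ hxab).1 (h hxF)
          rcases hmem with h6 | h6
          · rw [h6]; exact h5.btw
          · exact ((e1 _ h6).2 h5).btw
        · intro h
          have h5 := (e2 _ hxab).1 (h hxF)
          rcases hmem with h6 | h6
          · rw [h6]; exact h5.btw
          · exact ((e2 _ h6).2 h5).btw

end Chords

section Trees

/-- A finite tree with oriented edges, with vertices labeled by elements of `L`, and with a planar
structure, i.e. a (counterclockwise) cyclic order on the edges incident to each vertex.
`dir u v`: there is an edge from `u` to `v`. `cyc v a b c`: the edges of `v` leading to its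
neighbours `a`, `b`, `c` are distinct and follow each other in this cyclic order around `v`. -/
structure PlaneTree (L : Type*) where
  V : Type
  finite : Finite V
  dir : V → V → Prop
  dir_asymm : ∀ u v, dir u v → ¬ dir v u
  isTree : (SimpleGraph.fromRel dir).IsTree
  label : V → L
  cyc : V → V → V → V → Prop
  cyc_adj : ∀ v a b c, cyc v a b c → (SimpleGraph.fromRel dir).Adj v a
  cyc_rotate : ∀ v a b c, cyc v a b c → cyc v b c a
  cyc_asymm : ∀ v a b c, cyc v a b c → ¬ cyc v c b a
  cyc_trans : ∀ v a b c d, cyc v a b c → cyc v a c d → cyc v a b d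
  cyc_total : ∀ v a b c, (SimpleGraph.fromRel dir).Adj v a → (SimpleGraph.fromRel dir).Adj v b →
    (SimpleGraph.fromRel dir).Adj v c → a ≠ b → b ≠ c → a ≠ c → cyc v a b c ∨ cyc v c b a

namespace PlaneTree

variable {L : Type*}

/-- The underlying graph. -/
def graph (T : PlaneTree L) : SimpleGraph T.V := SimpleGraph.fromRel T.dir

/-- Homeomorphism of trees preserving orientations of edges, labels and planar structures. -/
def Homeomorphic (T T' : PlaneTree L) : Prop :=
  ∃ φ : T.V ≃ T'.V, (∀ u v, T'.dir (φ u) (φ v) ↔ T.dir u v) ∧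
    (∀ v, T'.label (φ v) = T.label v) ∧
    ∀ v a b c, T'.cyc (φ v) (φ a) (φ b) (φ c) ↔ T.cyc v a b c

variable (L) in
def setoid : Setoid (PlaneTree L) where
  r := Homeomorphic
  iseqv :=
    { refl := fun T => ⟨Equiv.refl _, fun _ _ => Iff.rfl, fun _ => rfl, fun _ _ _ _ => Iff.rfl⟩
      symm := by
        rintro T T' ⟨φ, h1, h2, h3⟩
        refine ⟨φ.symm, fun u v => ?_, fun v => ?_, fun v a b c => ?_⟩
        · rw [← h1]; simp
        · rw [← h2]; simp
        · rw [← h3]; simp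
      trans := by
        rintro T T' T'' ⟨φ, h1, h2, h3⟩ ⟨ψ, k1, k2, k3⟩
        refine ⟨φ.trans ψ, fun u v => ?_, fun v => ?_, fun v a b c => ?_⟩
        · simp [k1, h1]
        · simp [k2, h2]
        · simp [k3, h3] }

theorem fromRel_restrict (T : PlaneTree L) (s : Set T.V) :
    SimpleGraph.fromRel (fun u v : s => T.dir u v) = T.graph.induce s := by
  ext u v
  simp [graph, SimpleGraph.fromRel_adj, Subtype.ext_iff]

/-- The subtree with vertex set `s`, with all structures restricted to it. -/
def restrict (T : PlaneTree L) (s : Set T.V) (hs : (T.graph.induce s).Connected) :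
    PlaneTree L where
  V := s
  finite := by have := T.finite; infer_instance
  dir u v := T.dir u v
  dir_asymm u v := T.dir_asymm u v
  isTree := by
    rw [fromRel_restrict]
    exact ⟨hs, T.isTree.isAcyclic.induce s⟩
  label v := T.label v
  cyc v a b c := T.cyc v a b c
  cyc_adj v a b c h := by
    rw [fromRel_restrict]; exact T.cyc_adj _ _ _ _ h
  cyc_rotate v a b c := T.cyc_rotate _ _ _ _
  cyc_asymm v a b c := T.cyc_asymm _ _ _ _
  cyc_trans v a b c d := T.cyc_trans _ _ _ _ _
  cyc_total v a b c ha hb hc h1 h2 h3 := by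
    rw [fromRel_restrict] at ha hb hc
    exact T.cyc_total _ _ _ _ ha hb hc (fun h => h1 (Subtype.ext h)) (fun h => h2 (Subtype.ext h))
      (fun h => h3 (Subtype.ext h))

/-- The vertices of the component of `w` after the edge between `u` and `v` is removed. -/
def branch (T : PlaneTree L) (u v w : T.V) : Set T.V :=
  {x | (T.graph.deleteEdges {s(u, v)}).Reachable w x}

theorem branch_connected (T : PlaneTree L) (u v w : T.V) :
    (T.graph.induce (T.branch u v w)).Connected := by
  set C := (T.graph.deleteEdges {s(u, v)}).connectedComponentMk w with hC
  have h : ((T.graph.deleteEdges {s(u, v)}).induce C.supp).Connected := C.connected_toSimpleGraph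
  have hs : C.supp = T.branch u v w := by
    ext x
    simp only [SimpleGraph.ConnectedComponent.mem_supp_iff, hC, SimpleGraph.ConnectedComponent.eq,
      branch, Set.mem_ofPred_eq]
    exact SimpleGraph.reachable_comm
  rw [hs] at h
  exact h.mono (SimpleGraph.comap_monotone _ (SimpleGraph.deleteEdges_le _))

/-- The component of `w` after the edge between `u` and `v` is removed, as a tree. -/
def branchTree (T : PlaneTree L) (u v w : T.V) : PlaneTree L :=
  T.restrict (T.branch u v w) (T.branch_connected u v w)

end PlaneTree

end Trees

section DualTree

theorem agree_side {a b c d x y : Circ} (h : ¬ Linked (a, b) (c, d))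
    (h1 : a ≠ c) (h2 : a ≠ d)
    (hx : sbtw a x b) (hy : sbtw b y a) (hxy : sbtw c x d ↔ sbtw c y d) :
    (sbtw c x d ↔ sbtw c a d) := by
  unfold Linked at h
  simp only [sbtw_iff_cpos a, cpos_self] at *
  rw [ne_eq, ← cpos_inj (a := a)] at h1 h2
  rw [cpos_self] at h1 h2
  have := cpos_nonneg a b
  have := cpos_nonneg a c
  have := cpos_nonneg a d
  have := cpos_nonneg a x
  have := cpos_nonneg a y
  grind

theorem sbtw_of_same_side {a b x x' y z : Circ} (hx : sbtw a x b) (hx' : sbtw a x' b)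
    (hy : sbtw b y a) (hz : sbtw b z a) (h : sbtw x y z) : sbtw x' y z := by
  simp only [sbtw_iff_cpos a, cpos_self] at *
  have := cpos_nonneg a b
  have := cpos_nonneg a x
  have := cpos_nonneg a x'
  have := cpos_nonneg a y
  have := cpos_nonneg a z
  grind

theorem exists_just_after (E : Set Circ) (hE : E.Finite) (a : Circ) :
    ∃ x, 0 < cpos a x ∧ ∀ e ∈ E, e ≠ a → cpos a x < cpos a e := by
  induction E, hE using Set.Finite.induction_on with
  | empty =>
    exact ⟨a + ((1 / 2 : ℝ) : Circ), by
      rw [cpos_eq (t := 1 / 2) (by norm_num) (by norm_num) rfl]; norm_num, by simp⟩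
  | @insert e s _ _ ih =>
    obtain ⟨x, hx, h⟩ := ih
    by_cases hea : e = a
    · exact ⟨x, hx, fun f hf hfa => (Set.mem_insert_iff.1 hf).elim
        (fun h' => absurd (h'.trans hea) hfa) fun h' => h f h' hfa⟩
    have he : 0 < cpos a e := cpos_pos (Ne.symm hea)
    have hm : 0 < min (cpos a x) (cpos a e / 2) := by positivity
    have hm1 : min (cpos a x) (cpos a e / 2) < 1 := (min_le_left _ _).trans_lt (cpos_lt_one _ _)
    refine ⟨a + ((min (cpos a x) (cpos a e / 2) : ℝ) : Circ), ?_, fun f hf hfa => ?_⟩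
    · rw [cpos_eq hm.le hm1 rfl]; exact hm
    · rw [cpos_eq hm.le hm1 rfl]
      rcases Set.mem_insert_iff.1 hf with rfl | h'
      · exact (min_le_right _ _).trans_lt (by linarith)
      · exact (min_le_left _ _).trans_lt (h f h' hfa)

variable {H : Set (Circ × Circ)}

/-- The end points of the chords. -/
def ends (H : Set (Circ × Circ)) : Set Circ := Prod.fst '' H ∪ Prod.snd '' H

theorem exists_next (hH : IsChordSystem H) (a b : Circ) (hp : (a, b) ∈ H ∨ (b, a) ∈ H) :
    ∃ x, OffChords H x ∧ sbtw a x b ∧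
      ∀ q ∈ H, a ≠ q.1 → a ≠ q.2 → (sbtw q.1 x q.2 ↔ sbtw q.1 a q.2) := by
  obtain ⟨x, hx0, hx⟩ := exists_just_after (ends H)
    ((hH.finite.image _).union (hH.finite.image _)) a
  have e1 : ∀ q ∈ H, q.1 ∈ ends H := fun q hq => Or.inl ⟨q, hq, rfl⟩
  have e2 : ∀ q ∈ H, q.2 ∈ ends H := fun q hq => Or.inr ⟨q, hq, rfl⟩
  have hxa : x ≠ a := by rintro rfl; simp at hx0
  have hne : ∀ e ∈ ends H, x ≠ e := by
    rintro e he rfl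
    exact lt_irrefl _ (hx x he hxa)
  have hb : b ∈ ends H ∧ b ≠ a := by
    rcases hp with h | h
    · exact ⟨e2 _ h, (hH.ne _ h).symm⟩
    · exact ⟨e1 _ h, hH.ne _ h⟩
  refine ⟨x, fun q hq => ⟨hne _ (e1 q hq), hne _ (e2 q hq)⟩, ?_, fun q hq h1 h2 => ?_⟩
  · rw [sbtw_iff_cpos a, cpos_self]
    exact Or.inl ⟨hx0, hx b hb.1 hb.2⟩
  · have k1 := hx _ (e1 q hq) h1.symm
    have k2 := hx _ (e2 q hq) h2.symm
    simp only [sbtw_iff_cpos a, cpos_self]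
    grind

namespace Face

/-- `V` lies on the side of the arc from `p.1` to `p.2`. -/
def Side (V : Face H) (p : Circ × Circ) : Prop := V.1 ⊆ Set.cIoo p.1 p.2

theorem eq_faceOf (V : Face H) {x : Circ} (hx : x ∈ V.1) : V.1 = faceOf H x := by
  obtain ⟨y, hy, h⟩ := V.2
  rw [h] at hx ⊢
  ext z
  exact ⟨fun hz => ⟨hz.1, fun p hp => (hx.2 p hp).symm.trans (hz.2 p hp)⟩,
    fun hz => ⟨hz.1, fun p hp => (hx.2 p hp).trans (hz.2 p hp)⟩⟩

theorem nonempty (V : Face H) : V.1.Nonempty := by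
  obtain ⟨y, hy, h⟩ := V.2
  exact ⟨y, h ▸ mem_faceOf_self hy⟩

theorem off (V : Face H) {x : Circ} (hx : x ∈ V.1) : OffChords H x := by
  obtain ⟨y, hy, h⟩ := V.2
  exact (h ▸ hx : x ∈ faceOf H y).1

theorem side_iff (V : Face H) {x : Circ} (hx : x ∈ V.1) {p : Circ × Circ} (hp : p ∈ H) :
    V.Side p ↔ sbtw p.1 x p.2 :=
  ⟨fun h => h hx, fun h => by rw [Side, V.eq_faceOf hx]; exact faceOf_subset hp h⟩

theorem not_side_iff (hH : IsChordSystem H) (V : Face H) {x : Circ} (hx : x ∈ V.1)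
    {p : Circ × Circ} (hp : p ∈ H) : ¬ V.Side p ↔ sbtw p.2 x p.1 := by
  rw [V.side_iff hx hp]
  exact ⟨(sbtw_or (hH.ne p hp) (V.off hx p hp).1 (V.off hx p hp).2).resolve_left, sbtw_asymm⟩

theorem ext_side {V W : Face H} (h : ∀ p ∈ H, V.Side p ↔ W.Side p) : V = W := by
  obtain ⟨x, hx⟩ := V.nonempty
  obtain ⟨y, hy⟩ := W.nonempty
  apply Subtype.ext
  rw [V.eq_faceOf hx]
  have : y ∈ faceOf H x := ⟨W.off hy, fun p hp => by
    rw [← V.side_iff hx hp, ← W.side_iff hy hp]; exact h p hp⟩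
  rw [W.eq_faceOf hy]
  exact (Face.eq_faceOf ⟨faceOf H x, x, V.off hx, rfl⟩ this)

theorem finite (hH : IsChordSystem H) : Finite (Face H) := by
  have := hH.finite.to_subtype
  refine Finite.of_injective (fun (V : Face H) (p : H) => V.Side p) fun V W h => ?_
  exact ext_side fun p hp => iff_of_eq (congrFun h ⟨p, hp⟩)

/-- The edge `[p]` dual to the chord `p`, directed so that (`[p]`, `p`) is a positive basis where the
chord is directed from `p.1` to `p.2`: it goes from the region `V` at the chord on the side of the
arc from `p.2` to `p.1` to the region `W` at the chord on the side of the arc from `p.1` to `p.2`.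
(`V` and `W` are the regions adjacent to `p`: no other chord separates them.) -/
def Dir (V W : Face H) : Prop :=
  ∃ p ∈ H, ¬ V.Side p ∧ W.Side p ∧ ∀ q ∈ H, q ≠ p → (V.Side q ↔ W.Side q)

/-- `V` and `W` are separated by the chord `p` and by no other chord. -/
def Via (p : Circ × Circ) (V W : Face H) : Prop :=
  (V.Side p ↔ ¬ W.Side p) ∧ ∀ q ∈ H, q ≠ p → (V.Side q ↔ W.Side q)

theorem Via.symm {p : Circ × Circ} {V W : Face H} (h : Via p V W) : Via p W V :=
  ⟨by have := h.1; tauto, fun q hq hqp => (h.2 q hq hqp).symm⟩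

theorem adj_iff {V W : Face H} : (SimpleGraph.fromRel Dir).Adj V W ↔ ∃ p ∈ H, Via p V W := by
  rw [SimpleGraph.fromRel_adj]
  constructor
  · rintro ⟨-, ⟨p, hp, h1, h2, h3⟩ | ⟨p, hp, h1, h2, h3⟩⟩
    · exact ⟨p, hp, by tauto, h3⟩
    · exact ⟨p, hp, by tauto, fun q hq hqp => (h3 q hq hqp).symm⟩
  · rintro ⟨p, hp, h1, h2⟩
    refine ⟨by rintro rfl; tauto, ?_⟩
    by_cases h : V.Side p
    · exact Or.inr ⟨p, hp, h1.1 h, h, fun q hq hqp => (h2 q hq hqp).symm⟩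
    · exact Or.inl ⟨p, hp, h, by tauto, h2⟩

theorem agree (hH : IsChordSystem H) {V W : Face H} {p q : Circ × Circ} (hp : p ∈ H) (hq : q ∈ H)
    (hqp : q ≠ p) (h : V.Side p ↔ ¬ W.Side p) (hVW : V.Side q ↔ W.Side q) :
    V.Side q ↔ sbtw q.1 p.1 q.2 := by
  obtain ⟨x, hx⟩ := V.nonempty
  obtain ⟨y, hy⟩ := W.nonempty
  have hd := hH.disjoint p hp q hq hqp.symm
  have hl := hH.unlinked p hp q hq hqp.symm
  by_cases hV : V.Side p
  · have hW := (W.not_side_iff hH hy hp).1 (h.1 hV)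
    rw [V.side_iff hx hq, W.side_iff hy hq] at hVW
    rw [V.side_iff hx hq]
    exact agree_side hl hd.1 hd.2.1 ((V.side_iff hx hp).1 hV) hW hVW
  · have hW : W.Side p := by tauto
    have hV' := (V.not_side_iff hH hx hp).1 hV
    rw [hVW]
    rw [V.side_iff hx hq, W.side_iff hy hq] at hVW
    rw [W.side_iff hy hq]
    exact agree_side hl hd.1 hd.2.1 ((W.side_iff hy hp).1 hW) hV' hVW.symm

theorem exists_next_face (hH : IsChordSystem H) {p : Circ × Circ} (hp : p ∈ H) (P : Prop) :
    ∃ V : Face H, (V.Side p ↔ P) ∧ ∀ q ∈ H, q ≠ p → (V.Side q ↔ sbtw q.1 p.1 q.2) := by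
  by_cases hP : P
  · obtain ⟨x, hx, h1, h2⟩ := exists_next hH p.1 p.2 (Or.inl hp)
    let V : Face H := ⟨faceOf H x, x, hx, rfl⟩
    have hV : x ∈ V.1 := mem_faceOf_self hx
    refine ⟨V, ?_, fun q hq hqp => ?_⟩
    · rw [V.side_iff hV hp]; tauto
    · have hd := hH.disjoint p hp q hq hqp.symm
      rw [V.side_iff hV hq]
      exact h2 q hq hd.1 hd.2.1
  · obtain ⟨x, hx, h1, h2⟩ := exists_next hH p.2 p.1 (Or.inr hp)
    let V : Face H := ⟨faceOf H x, x, hx, rfl⟩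
    have hV : x ∈ V.1 := mem_faceOf_self hx
    refine ⟨V, ?_, fun q hq hqp => ?_⟩
    · have := (V.not_side_iff hH hV hp).2 h1
      tauto
    · have hd := hH.disjoint p hp q hq hqp.symm
      have hl := hH.unlinked q hq p hp hqp
      rw [V.side_iff hV hq, h2 q hq hd.2.2.1 hd.2.2.2]
      exact (unlinked_side hl (hH.ne q hq) hd.1.symm hd.2.2.1.symm hd.2.1.symm
        hd.2.2.2.symm).symm

theorem reachable (hH : IsChordSystem H) (n : ℕ) : ∀ V W : Face H,
    {p | p ∈ H ∧ ¬ (V.Side p ↔ W.Side p)}.ncard = n →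
    (SimpleGraph.fromRel (Dir (H := H))).Reachable V W := by
  induction n using Nat.strong_induction_on with
  | _ n ih =>
  intro V W hn
  by_cases hVW : ∀ p ∈ H, V.Side p ↔ W.Side p
  · rw [ext_side hVW]
  push Not at hVW
  obtain ⟨p, hp, hpVW⟩ := hVW
  have hpVW : V.Side p ↔ ¬ W.Side p := by tauto
  obtain ⟨V', hV', hV''⟩ := exists_next_face hH hp (V.Side p)
  obtain ⟨W', hW', hW''⟩ := exists_next_face hH hp (W.Side p)
  have hfin : {p | p ∈ H ∧ ¬ (V.Side p ↔ W.Side p)}.Finite := hH.finite.subset fun q hq => hq.1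
  have hadj : (SimpleGraph.fromRel (Dir (H := H))).Adj V' W' :=
    adj_iff.2 ⟨p, hp, by tauto, fun q hq hqp => (hV'' q hq hqp).trans (hW'' q hq hqp).symm⟩
  have r1 : (SimpleGraph.fromRel (Dir (H := H))).Reachable V V' := by
    refine ih _ ?_ V V' rfl
    rw [← hn]
    refine Set.ncard_lt_ncard ⟨fun q hq => ⟨hq.1, fun h => hq.2 ?_⟩, fun hs => ?_⟩ hfin
    · by_cases hqp : q = p
      · rw [hqp]; tauto
      · rw [hV'' q hq.1 hqp]; exact agree hH hp hq.1 hqp hpVW h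
    · exact (hs (show p ∈ _ from ⟨hp, by tauto⟩)).2 hV'.symm
  have r2 : (SimpleGraph.fromRel (Dir (H := H))).Reachable W' W := by
    refine ih _ ?_ W' W rfl
    rw [← hn]
    refine Set.ncard_lt_ncard ⟨fun q hq => ⟨hq.1, fun h => hq.2 ?_⟩, fun hs => ?_⟩ hfin
    · by_cases hqp : q = p
      · rw [hqp]; tauto
      · rw [hW'' q hq.1 hqp]; exact (agree hH hp hq.1 hqp (by tauto) h.symm).symm
    · exact (hs (show p ∈ _ from ⟨hp, by tauto⟩)).2 hW'
  exact r1.trans (hadj.reachable.trans r2)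

theorem isTree (hH : IsChordSystem H) : (SimpleGraph.fromRel (Dir (H := H))).IsTree := by
  have hN : Nonempty (Face H) := by
    by_cases hne : H.Nonempty
    · obtain ⟨p, hp⟩ := hne
      exact ⟨(exists_next_face hH hp True).choose⟩
    · exact ⟨⟨_, 0, fun p hp => absurd ⟨p, hp⟩ hne, rfl⟩⟩
  refine ⟨⟨fun V W => reachable hH _ V W rfl⟩, ?_⟩
  · rw [SimpleGraph.isAcyclic_iff_forall_adj_isBridge]
    intro V W hVW
    obtain ⟨p, hp, h⟩ := adj_iff.1 hVW
    rw [SimpleGraph.isBridge_iff]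
    intro hr
    have key : ∀ A B : Face H, ((SimpleGraph.fromRel (Dir (H := H))).deleteEdges
        {s(V, W)}).Adj A B → (A.Side p ↔ B.Side p) := by
      intro A B hAB
      rw [SimpleGraph.deleteEdges_adj] at hAB
      obtain ⟨q, hq, hq'⟩ := adj_iff.1 hAB.1
      by_cases hqp : q = p
      · subst hqp
        exfalso
        apply hAB.2
        have hA : ∀ r ∈ H, r ≠ q → (A.Side r ↔ V.Side r) := fun r hr hrq =>
          (agree hH hp hr hrq hq'.1 (hq'.2 r hr hrq)).trans
            (agree hH hp hr hrq h.1 (h.2 r hr hrq)).symm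
        have hB : ∀ r ∈ H, r ≠ q → (B.Side r ↔ V.Side r) := fun r hr hrq =>
          (hq'.2 r hr hrq).symm.trans (hA r hr hrq)
        have h1 := h.1
        have h2 := hq'.1
        by_cases hs : A.Side q ↔ V.Side q
        · have e1 : A = V := ext_side fun r hr => by
            by_cases hrq : r = q
            · rw [hrq]; exact hs
            · exact hA r hr hrq
          have e2 : B = W := ext_side fun r hr => by
            by_cases hrq : r = q
            · rw [hrq]; tauto
            · exact (hB r hr hrq).trans (h.2 r hr hrq)
          rw [e1, e2]; rfl
        · have e1 : A = W := ext_side fun r hr => by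
            by_cases hrq : r = q
            · rw [hrq]; tauto
            · exact (hA r hr hrq).trans (h.2 r hr hrq)
          have e2 : B = V := ext_side fun r hr => by
            by_cases hrq : r = q
            · rw [hrq]; tauto
            · exact hB r hr hrq
          rw [e1, e2]; exact Sym2.eq_swap
      · exact hq'.2 p hp (Ne.symm hqp)
    rw [SimpleGraph.reachable_iff_reflTransGen] at hr
    have key2 : ∀ B, Relation.ReflTransGen ((SimpleGraph.fromRel (Dir (H := H))).deleteEdges
        {s(V, W)}).Adj V B → (V.Side p ↔ B.Side p) := by
      intro B hB
      induction hB with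
      | refl => exact Iff.rfl
      | tail _ hadj ih => exact ih.trans (key _ _ hadj)
    have := key2 W hr
    have := h.1
    tauto

/-- The cyclic order of the neighbours of `V`: for regions `A`, `B`, `C` adjacent to `V`, the order
in which they are met going counterclockwise along the circle. -/
def Cyc (V A B C : Face H) : Prop :=
  (SimpleGraph.fromRel Dir).Adj V A ∧ (SimpleGraph.fromRel Dir).Adj V B ∧
    (SimpleGraph.fromRel Dir).Adj V C ∧ ∀ a ∈ A.1, ∀ b ∈ B.1, ∀ c ∈ C.1, sbtw a b c

theorem side_other {V A B : Face H} {p : Circ × Circ} (hp : p ∈ H) (hA : Via p V A)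
    (hB : (SimpleGraph.fromRel Dir).Adj V B) (h : A ≠ B) : B.Side p ↔ ¬ A.Side p := by
  obtain ⟨q, hq, hB⟩ := adj_iff.1 hB
  by_cases hqp : q = p
  · subst hqp
    refine absurd (ext_side fun r hr => ?_) h
    by_cases hrq : r = q
    · have := hA.1; have := hB.1
      rw [hrq]; tauto
    · exact (hA.2 r hr hrq).symm.trans (hB.2 r hr hrq)
  · have := hB.2 p hp (Ne.symm hqp)
    have := hA.1
    tauto

theorem sbtw_congr (hH : IsChordSystem H) {V A B C : Face H}
    (hA : (SimpleGraph.fromRel Dir).Adj V A) (hB : (SimpleGraph.fromRel Dir).Adj V B)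
    (hC : (SimpleGraph.fromRel Dir).Adj V C) (hAB : A ≠ B) (hAC : A ≠ C) {a a' b c : Circ}
    (ha : a ∈ A.1) (ha' : a' ∈ A.1) (hb : b ∈ B.1) (hc : c ∈ C.1) (h : sbtw a b c) :
    sbtw a' b c := by
  obtain ⟨p, hp, hA⟩ := adj_iff.1 hA
  have h1 := side_other hp hA hB hAB
  have h2 := side_other hp hA hC hAC
  by_cases hs : A.Side p
  · exact sbtw_of_same_side ((A.side_iff ha hp).1 hs) ((A.side_iff ha' hp).1 hs)
      ((B.not_side_iff hH hb hp).1 (by tauto)) ((C.not_side_iff hH hc hp).1 (by tauto)) h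
  · exact sbtw_of_same_side ((A.not_side_iff hH ha hp).1 hs) ((A.not_side_iff hH ha' hp).1 hs)
      ((B.side_iff hb hp).1 (by tauto)) ((C.side_iff hc hp).1 (by tauto)) h

theorem cyc_total (hH : IsChordSystem H) {V A B C : Face H}
    (hA : (SimpleGraph.fromRel Dir).Adj V A) (hB : (SimpleGraph.fromRel Dir).Adj V B)
    (hC : (SimpleGraph.fromRel Dir).Adj V C) (hAB : A ≠ B) (hBC : B ≠ C) (hAC : A ≠ C) :
    Cyc V A B C ∨ Cyc V C B A := by
  have key : ∀ {A B C : Face H}, (SimpleGraph.fromRel Dir).Adj V A →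
      (SimpleGraph.fromRel Dir).Adj V B → (SimpleGraph.fromRel Dir).Adj V C → A ≠ B → B ≠ C →
      A ≠ C → (∃ a ∈ A.1, ∃ b ∈ B.1, ∃ c ∈ C.1, sbtw a b c) → Cyc V A B C := by
    rintro A B C hA hB hC hAB hBC hAC ⟨a, ha, b, hb, c, hc, h⟩
    refine ⟨hA, hB, hC, fun a' ha' b' hb' c' hc' => ?_⟩
    have h1 := (sbtw_congr hH hA hB hC hAB hAC ha ha' hb hc h).cyclic_left
    have h2 := (sbtw_congr hH hB hC hA hBC hAB.symm hb hb' hc ha' h1).cyclic_left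
    exact (sbtw_congr hH hC hA hB hAC.symm hBC.symm hc hc' ha' hb' h2).cyclic_left
  obtain ⟨a, ha⟩ := A.nonempty
  obtain ⟨b, hb⟩ := B.nonempty
  obtain ⟨c, hc⟩ := C.nonempty
  have hne : ∀ {A B : Face H} {a b : Circ}, a ∈ A.1 → b ∈ B.1 → A ≠ B → a ≠ b := by
    rintro A B a b ha hb h rfl
    exact h (Subtype.ext ((A.eq_faceOf ha).trans (B.eq_faceOf hb).symm))
  have h1 := hne ha hb hAB
  have h2 := hne hb hc hBC
  have h3 := hne ha hc hAC
  rcases sbtw_or (p := (a, c)) (x := b) h3 h1.symm h2 with h | h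
  · exact Or.inl (key hA hB hC hAB hBC hAC ⟨a, ha, b, hb, c, hc, h⟩)
  · exact Or.inr (key hC hB hA hBC.symm hAB.symm hAC.symm ⟨c, hc, b, hb, a, ha, h⟩)

end Face

/-- The planar oriented tree dual to the splitting of the disk by the chords of `H`. -/
def dualTree {L : Type*} (H : Set (Circ × Circ)) (hH : IsChordSystem H) (label : Face H → L) :
    PlaneTree L where
  V := Face H
  finite := Face.finite hH
  dir := Face.Dir
  dir_asymm := by
    rintro V W ⟨p, hp, h1, h2, h3⟩ ⟨q, hq, k1, k2, k3⟩
    have := h3 q hq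
    by_cases hqp : q = p
    · subst hqp; exact k1 h2
    · tauto
  isTree := Face.isTree hH
  label := label
  cyc := Face.Cyc
  cyc_adj v a b c h := h.1
  cyc_rotate v a b c h := ⟨h.2.1, h.2.2.1, h.1,
    fun y hy z hz x hx => (h.2.2.2 x hx y hy z hz).cyclic_left⟩
  cyc_asymm v a b c h h' := by
    obtain ⟨x, hx⟩ := a.nonempty
    obtain ⟨y, hy⟩ := b.nonempty
    obtain ⟨z, hz⟩ := c.nonempty
    exact sbtw_asymm (h.2.2.2 x hx y hy z hz) (h'.2.2.2 z hz y hy x hx)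
  cyc_trans v a b c d h h' := by
    obtain ⟨z, hz⟩ := c.nonempty
    exact ⟨h.1, h.2.1, h'.2.2.1, fun x hx y hy w hw =>
      sbtw_trans_right (h.2.2.2 x hx y hy z hz) (h'.2.2.2 x hx z hz w hw)⟩
  cyc_total v a b c ha hb hc h1 h2 h3 := Face.cyc_total hH ha hb hc h1 h2 h3

end DualTree

section Classes

variable {S : Type*} [TopologicalSpace S] [ChartedSpace (EuclideanHalfSpace 2) S]

/-- Isotopy of (non-pointed) loops: `β = h₁ ∘ α ∘ f` with `f` an orientation preserving
homeomorphism of the circle and `h` a continuous family of homeomorphisms of the surface that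
starts at the identity. -/
def Isotopic (α β : GenericLoop S) : Prop :=
  ∃ f : Circ ≃ₜ Circ, (∀ x y z, sbtw x y z → sbtw (f x) (f y) (f z)) ∧
    ∃ h : unitInterval → S ≃ₜ S, Continuous (fun p : unitInterval × S => h p.1 p.2) ∧
      h 0 = Homeomorph.refl S ∧ ∀ x, β.toFun x = h 1 (α.toFun (f x))

theorem sbtw_symm_of_sbtw {f : Circ ≃ₜ Circ} (hf : ∀ x y z, sbtw x y z → sbtw (f x) (f y) (f z))
    (x y z : Circ) (h : sbtw x y z) : sbtw (f.symm x) (f.symm y) (f.symm z) := by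
  rw [sbtw_iff_not_btw]
  intro hb
  have hne : f.symm z ≠ f.symm y ∧ f.symm y ≠ f.symm x ∧ f.symm z ≠ f.symm x := by
    refine ⟨fun e => ?_, fun e => ?_, fun e => ?_⟩ <;> have e := f.symm.injective e <;> subst e
    · exact sbtw_irrefl_right h
    · exact sbtw_irrefl_left h
    · exact sbtw_irrefl_left_right h
  have hs : sbtw (f.symm z) (f.symm y) (f.symm x) :=
    (sbtw_or (p := (f.symm z, f.symm x)) hne.2.2 hne.1.symm hne.2.1).resolve_right
      fun h' => not_btw_of_sbtw h' hb
  have := hf _ _ _ hs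
  simp only [Homeomorph.apply_symm_apply] at this
  exact sbtw_asymm h this

variable (S) in
/-- Isotopy is an equivalence relation. -/
def isotopySetoid : Setoid (GenericLoop S) where
  r := Isotopic
  iseqv :=
    { refl := fun α => ⟨Homeomorph.refl _, fun _ _ _ h => h, fun _ => Homeomorph.refl S,
        continuous_snd, rfl, fun _ => rfl⟩
      symm := by
        rintro α β ⟨f, hf, h, hc, h0, hβ⟩
        refine ⟨f.symm, sbtw_symm_of_sbtw hf, fun t => (h 1).symm.trans (h (unitInterval.symm t)),
          ?_, ?_, fun x => ?_⟩
        · exact hc.comp ((unitInterval.continuous_symm.comp continuous_fst).prodMk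
            ((h 1).symm.continuous.comp continuous_snd))
        · ext x; simp
        · simp [hβ, h0]
      trans := by
        rintro α β γ ⟨f, hf, h, hc, h0, hβ⟩ ⟨k, hk, l, lc, l0, hγ⟩
        refine ⟨k.trans f, fun x y z hs => hf _ _ _ (hk _ _ _ hs), fun t => (h t).trans (l t),
          ?_, ?_, fun x => ?_⟩
        · exact lc.comp (continuous_fst.prodMk hc)
        · ext x; simp [h0, l0]
        · simp [hγ, hβ] }

variable (S) in
/-- Isotopy classes of (non-pointed) loops on the surface `S`. -/
def LoopClass : Type _ := Quotient (isotopySetoid S)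

/-- The isotopy class of a loop. -/
def GenericLoop.cls (α : GenericLoop S) : LoopClass S := Quotient.mk (isotopySetoid S) α

/-- The crossings of a loop `α`. A crossing is encoded by the pair `(p¹, p²)` of its two preimages,
ordered so that (tangent direction at `p¹`, tangent direction at `p²`) is a positive basis; so every
crossing is listed exactly once. -/
def GenericLoop.crossings (α : GenericLoop S) : Set (Circ × Circ) :=
  {p | p.1 ≠ p.2 ∧ α.toFun p.1 = α.toFun p.2 ∧
    0 < det₂ (velocity fun u : ℝ => α.toFun (p.1 + u)) (velocity fun u : ℝ => α.toFun (p.2 + u))}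

theorem GenericLoop.crossings_finite (α : GenericLoop S) : α.crossings.Finite :=
  α.finite_crossings.subset fun _ hp => ⟨hp.1, hp.2.1⟩

noncomputable instance (α : GenericLoop S) : Fintype α.crossings :=
  α.crossings_finite.fintype

/-- A cut of `α`: a set of pairwise unlinked crossings. -/
structure Cut (α : GenericLoop S) where
  chords : Set (Circ × Circ)
  subset : chords ⊆ α.crossings
  unlinked : ∀ p ∈ chords, ∀ q ∈ chords, p ≠ q → ¬ Linked p q

instance (α : GenericLoop S) : Finite (Cut α) := by
  have : Finite (Set.powerset α.crossings) := α.crossings_finite.finite_subsets.to_subtype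
  refine Finite.of_injective (fun H : Cut α => (⟨H.chords, H.subset⟩ : Set.powerset α.crossings))
    fun H K h => ?_
  obtain ⟨c, hc, hc'⟩ := H
  obtain ⟨d, hd, hd'⟩ := K
  obtain rfl : c = d := congrArg Subtype.val h
  rfl

noncomputable instance (α : GenericLoop S) : Fintype (Cut α) := Fintype.ofFinite _

theorem Cut.isChordSystem {α : GenericLoop S} (H : Cut α) : IsChordSystem H.chords := by
  refine ⟨α.crossings_finite.subset H.subset, fun p hp => (H.subset hp).1, ?_, H.unlinked⟩
  rintro ⟨a, b⟩ hp ⟨c, d⟩ hq hpq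
  obtain ⟨h1, h2, h3⟩ := H.subset hp
  obtain ⟨k1, k2, k3⟩ := H.subset hq
  dsimp only at *
  have anti : ∀ v w : EuclideanSpace ℝ (Fin 2), 0 < det₂ v w → ¬ 0 < det₂ w v := by
    intro v w h h'
    simp only [det₂] at h h'
    linarith
  have key : ∀ x y z : Circ, α.toFun x = α.toFun y → α.toFun x = α.toFun z → x ≠ y → x ≠ z →
      y = z := fun x y z e1 e2 n1 n2 => by
    rcases α.double_points y x z e1.symm e2 with h | h | h
    · exact absurd h.symm n1
    · exact absurd h n2
    · exact h
  refine ⟨?_, ?_, ?_, ?_⟩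
  · rintro rfl
    exact hpq (by rw [key a b d h2 k2 h1 k1])
  · rintro rfl
    obtain rfl := key a b c h2 k2.symm h1 k1.symm
    exact anti _ _ h3 k3
  · rintro rfl
    obtain rfl := key b a d h2.symm k2 h1.symm k1
    exact anti _ _ h3 k3
  · rintro rfl
    exact hpq (by rw [key b a c h2.symm k2.symm h1.symm k1.symm])

theorem Cut.exists_runsAlong {α : GenericLoop S} (H : Cut α) (V : Face H.chords) :
    ∃ β, RunsAlong α H.chords V.1 β := by
  obtain ⟨x, hx, hV⟩ := V.2
  rw [hV]
  exact LoopTree.exists_runsAlong _ α H.chords x H.isChordSystem rfl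
    (fun p hp => (H.subset hp).2.1) hx

/-- The loop obtained by moving along the boundary of the face `V` and applying `α` on the part of
it that lies on the circle (well defined up to reparametrization). -/
noncomputable def Cut.faceLoop {α : GenericLoop S} (H : Cut α) (V : Face H.chords) :
    GenericLoop S :=
  Classical.choose (H.exists_runsAlong V)

/-- The oriented planar tree `T_H` of a cut `H`: the tree dual to the splitting of the disk into
`H`-faces, each vertex labeled by the isotopy class of the loop along the boundary of its face. -/
noncomputable def Cut.tree {α : GenericLoop S} (H : Cut α) : PlaneTree (LoopClass S) :=
  dualTree H.chords H.isChordSystem fun V => (H.faceLoop V).cls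

end Classes

section Coalgebras

variable (R : Type*) [CommRing R]

/-- The permutation `τ (x ⊗ y ⊗ z) = z ⊗ x ⊗ y`. -/
noncomputable def cyclicShift (A : Type*) [AddCommGroup A] [Module R A] :
    A ⊗[R] (A ⊗[R] A) →ₗ[R] A ⊗[R] (A ⊗[R] A) :=
  (TensorProduct.comm R (A ⊗[R] A) A).toLinearMap ∘ₗ (TensorProduct.assoc R A A A).symm.toLinearMap

/-- `ν` is a Lie cobracket: `Perm ∘ ν = -ν` and `(id + τ + τ²) ∘ (id ⊗ ν) ∘ ν = 0`. -/
structure IsLieCobracket {R A : Type*} [CommRing R] [AddCommGroup A] [Module R A]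
    (ν : A →ₗ[R] A ⊗[R] A) : Prop where
  skew : (TensorProduct.comm R A A).toLinearMap ∘ₗ ν = -ν
  jacobi : (LinearMap.id + cyclicShift R A + cyclicShift R A ∘ₗ cyclicShift R A) ∘ₗ
    TensorProduct.map LinearMap.id ν ∘ₗ ν = 0

/-- `f` is a Lie coalgebra homomorphism `(A, ν) → (A', ν')` if `ν' f = (f ⊗ f) ν`. -/
def IsLieCoalgebraHom {R A A' : Type*} [CommRing R] [AddCommGroup A] [Module R A]
    [AddCommGroup A'] [Module R A'] (ν : A →ₗ[R] A ⊗[R] A) (ν' : A' →ₗ[R] A' ⊗[R] A')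
    (f : A →ₗ[R] A') : Prop :=
  ν' ∘ₗ f = TensorProduct.map f f ∘ₗ ν

/-- The free module on the isotopy classes of (non-pointed) loops on `S`. -/
abbrev LoopModule (S : Type*) [TopologicalSpace S] [ChartedSpace (EuclideanHalfSpace 2) S] :
    Type _ :=
  LoopClass S →₀ R

/-- The free module on the homeomorphism classes of oriented planar trees with vertices labeled
by elements of `L`. -/
abbrev TreeModule (L : Type*) : Type _ := Quotient (PlaneTree.setoid L) →₀ R

section

variable {S : Type*} [TopologicalSpace S] [ChartedSpace (EuclideanHalfSpace 2) S]

/-- The generator of the module of loops given by the loop `α`. -/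
noncomputable def GenericLoop.gen (α : GenericLoop S) : LoopModule R S := Finsupp.single α.cls 1

/-- `∑ₚ α_{p¹,p²} ⊗ α_{p²,p¹} - α_{p²,p¹} ⊗ α_{p¹,p²}` -/
noncomputable def GenericLoop.cobracket (α : GenericLoop S) :
    LoopModule R S ⊗[R] LoopModule R S :=
  ∑ p : α.crossings,
    ((α.arc p.1.1 p.1.2 p.2.1 p.2.2.1).gen R ⊗ₜ[R]
        (α.arc p.1.2 p.1.1 p.2.1.symm p.2.2.1.symm).gen R -
      (α.arc p.1.2 p.1.1 p.2.1.symm p.2.2.1.symm).gen R ⊗ₜ[R]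
        (α.arc p.1.1 p.1.2 p.2.1 p.2.2.1).gen R)

end

namespace PlaneTree

variable {L : Type*}

/-- The generator of the module of trees given by the tree `T`. -/
noncomputable def gen (T : PlaneTree L) : TreeModule R L :=
  Finsupp.single (Quotient.mk (PlaneTree.setoid L) T) 1

/-- The (oriented) edges of `T`; the edge `e` goes from `e.1` to `e.2`. -/
def Edge (T : PlaneTree L) : Type := {e : T.V × T.V // T.dir e.1 e.2}

noncomputable instance (T : PlaneTree L) : Fintype T.Edge :=
  have := T.finite
  have : Finite T.Edge := Subtype.finite
  Fintype.ofFinite _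

/-- `T¹ₑ`: the component of the head of `e` after the edge `e` is removed. -/
def headTree (T : PlaneTree L) (e : T.Edge) : PlaneTree L := T.branchTree e.1.1 e.1.2 e.1.2

/-- `T²ₑ`: the component of the tail of `e` after the edge `e` is removed. -/
def tailTree (T : PlaneTree L) (e : T.Edge) : PlaneTree L := T.branchTree e.1.1 e.1.2 e.1.1

/-- `∑ₑ T¹ₑ ⊗ T²ₑ - T²ₑ ⊗ T¹ₑ` -/
noncomputable def cobracket (T : PlaneTree L) : TreeModule R L ⊗[R] TreeModule R L :=
  ∑ e : T.Edge, ((T.headTree e).gen R ⊗ₜ[R] (T.tailTree e).gen R -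
    (T.tailTree e).gen R ⊗ₜ[R] (T.headTree e).gen R)

end PlaneTree

end Coalgebras

end LoopTree

open LoopTree

/-! The co-Jacobi identity is proved for trees and carried back to loops along `η₀`.

Applying the tree cobracket twice cuts two edges and leaves three pieces in a row: two outer
branches and a middle. Direct both edges away from the middle, and let `a` be the signed sum of
outer ⊗ outer ⊗ middle over ordered pairs of edges. The iterated cobracket is then `a - τ² a`, which
`1 + τ + τ²` kills because `τ³ = 1` (`jacobi_of_branches`, `treeCobracket_branchGen`).

The homomorphism property is a double count of pairs `(H, p)` with `p ∈ H`. Deleting the edge `[p]`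
from `T_H` separates the faces on the two sides of the chord of `p`, and the two pieces are the
trees of the cuts that `H` induces on the two arcs at `p` (`cobracket_dualTree`, `Cut.genOn_arc`).
Conversely, `p` together with a cut of each arc is a cut of `α` (`Cut.arc_bijective`), so the sum
over all `H` containing `p` factors as a tensor product.

`η₀` has a left inverse: read the label of a one-vertex tree and kill all other trees; only the
empty cut produces a single vertex. Hence the tensor powers of `η₀` are injective, and the
identities for loops follow from those for trees (`IsLieCobracket.of_leftInverse`).

Well-definedness rests on two geometric facts. The loop along a face is determined only through a
cyclically monotone, possibly discontinuous map of the circle; two such maps whose ranges agree up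
to finite sets differ, off a finite set, by a homeomorphism of the circle
(`CycMono.exists_reparam`). Moreover, an isotopy moves loops by homeomorphisms that need not be
differentiable, and yet it must respect the order of the two preimages of a crossing. The sign of a
crossing of curves `σ`, `τ` is therefore expressed by the winding number of `(u, v) ↦ σ u - τ v`
along a small circle. This number is constant along the isotopy (`posCrossing_family`), and at a
transversal crossing it is minus the sign of the determinant of the tangent vectors
(`posCrossing_iff_of_hasDerivAt`). -/

namespace LoopTree

/-! ### Cyclically monotone maps of the circle and their lifts -/

section CyclicMaps

/-- Maps of the circle that preserve the (strict) cyclic order. -/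
def CycMono (g : Circ → Circ) : Prop := ∀ x y z, sbtw x y z → sbtw (g x) (g y) (g z)

/-- Lifting to a single period trades the cyclic order for the linear order of `ℝ`. -/
theorem sbtw_iff_exists_lift {x y z : Circ} :
    sbtw x y z ↔ ∃ a b c : ℝ, a < b ∧ b < c ∧ c < a + 1 ∧ (a : Circ) = x ∧ (b : Circ) = y ∧
      (c : Circ) = z := by
  constructor
  · intro h
    obtain ⟨a, rfl⟩ := QuotientAddGroup.mk_surjective x
    change sbtw (a : Circ) y z at h
    change ∃ a' b c : ℝ, a' < b ∧ b < c ∧ c < a' + 1 ∧ (a' : Circ) = (a : Circ) ∧ _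
    rw [sbtw_iff_cpos (a : Circ), cpos_self] at h
    have h1 := cpos_nonneg (a : Circ) y
    have h2 := cpos_nonneg (a : Circ) z
    have h3 := cpos_lt_one (a : Circ) z
    refine ⟨a, a + cpos (a : Circ) y, a + cpos (a : Circ) z, ?_, ?_, by linarith, rfl, ?_, ?_⟩
    · grind
    · grind
    · rw [AddCircle.coe_add, add_cpos]
    · rw [AddCircle.coe_add, add_cpos]
  · rintro ⟨a, b, c, h1, h2, h3, rfl, rfl, rfl⟩
    have e1 : cpos (a : Circ) (b : Circ) = b - a :=
      cpos_eq (by linarith) (by linarith) (by rw [← AddCircle.coe_add]; congr 1; ring)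
    have e2 : cpos (a : Circ) (c : Circ) = c - a :=
      cpos_eq (by linarith) (by linarith) (by rw [← AddCircle.coe_add]; congr 1; ring)
    rw [sbtw_iff_cpos (a : Circ), cpos_self, e1, e2]
    exact Or.inl ⟨by linarith, by linarith⟩

theorem exists_sbtw {x y : Circ} (h : x ≠ y) : ∃ z, sbtw x z y := by
  have h0 := cpos_pos h
  have h1 := cpos_lt_one x y
  refine ⟨x + ((cpos x y / 2 : ℝ) : Circ), ?_⟩
  rw [sbtw_iff_cpos x, cpos_self, cpos_eq (t := cpos x y / 2) (by linarith) (by linarith) rfl]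
  exact Or.inl ⟨by linarith, by linarith⟩

theorem ne_of_sbtw {x y z : Circ} (h : sbtw x y z) : x ≠ y ∧ y ≠ z ∧ x ≠ z := by
  refine ⟨?_, ?_, ?_⟩ <;> rintro rfl
  · exact sbtw_irrefl_left h
  · exact sbtw_irrefl_right h
  · exact sbtw_irrefl_left_right h

theorem coe_intCast (n : ℤ) : (((n : ℝ) : ℝ) : Circ) = 0 :=
  (AddCircle.coe_eq_zero_iff 1).2 ⟨n, by simp⟩

theorem exists_int_of_coe_eq {s t : ℝ} (h : (s : Circ) = (t : Circ)) : ∃ n : ℤ, t = s + n := by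
  have h1 : ((t - s : ℝ) : Circ) = 0 := by rw [AddCircle.coe_sub, h, sub_self]
  obtain ⟨n, hn⟩ := (AddCircle.coe_eq_zero_iff 1).1 h1
  exact ⟨n, by simp at hn; linarith⟩

namespace CycMono

variable {g : Circ → Circ}

theorem injective (hg : CycMono g) : Function.Injective g := by
  intro x y h
  by_contra hne
  obtain ⟨z, hz⟩ := exists_sbtw hne
  exact (ne_of_sbtw (hg _ _ _ hz)).2.2 h

theorem sbtw_iff (hg : CycMono g) {x y z : Circ} : sbtw (g x) (g y) (g z) ↔ sbtw x y z := by
  refine ⟨fun h => ?_, hg x y z⟩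
  obtain ⟨h1, h2, h3⟩ := ne_of_sbtw h
  refine (sbtw_or (p := (x, z)) (x := y) (fun e => h3 (congrArg g e))
    (fun e => h1 (congrArg g e).symm) (fun e => h2 (congrArg g e))).resolve_right fun h' => ?_
  exact sbtw_asymm h (hg _ _ _ h')

theorem comp {f : Circ → Circ} (hg : CycMono g) (hf : CycMono f) : CycMono (g ∘ f) :=
  fun _ _ _ h => hg _ _ _ (hf _ _ _ h)

/-- The floor counts full turns, and the arc length from `g 0` measures the position within a turn.
Continuity plays no role: `g` may jump over chords. -/
theorem exists_lift (hg : CycMono g) :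
    ∃ G : CircleDeg1Lift, StrictMono G ∧ ∀ t : ℝ, g (t : Circ) = (G t : Circ) := by
  obtain ⟨c, hc⟩ := QuotientAddGroup.mk_surjective (g 0)
  change (c : Circ) = g 0 at hc
  let G : ℝ → ℝ := fun t => c + ⌊t⌋ + cpos (g 0) (g (t : Circ))
  have hfr : ∀ t : ℝ, ((Int.fract t : ℝ) : Circ) = t := fun t => by
    rw [Int.fract, AddCircle.coe_sub, coe_intCast, sub_zero]
  have hmono : StrictMono G := by
    intro s t hst
    have h1 := cpos_nonneg (g 0) (g (t : Circ))
    have h2 := cpos_lt_one (g 0) (g (s : Circ))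
    rcases (Int.floor_mono hst.le).lt_or_eq with h | h
    · have : ((⌊s⌋ : ℝ) + 1) ≤ ⌊t⌋ := by exact_mod_cast h
      simp only [G]; linarith
    · have hf : Int.fract s < Int.fract t := by
        simp only [Int.fract, h]; linarith
      have h3 := Int.fract_nonneg s
      have h4 := Int.fract_lt_one t
      -- Within one turn the points `0`, `fract s`, `fract t` are in cyclic order, and `g` keeps it.
      -- If `fract s = 0` there are only two points, and injectivity replaces the order.
      have key : cpos (g 0) (g (s : Circ)) < cpos (g 0) (g (t : Circ)) := by
        rw [← hfr s, ← hfr t]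
        rcases h3.eq_or_lt with h5 | h5
        · rw [← h5]
          simp only [AddCircle.coe_zero, cpos_self]
          refine cpos_pos fun e => ?_
          have h6 : (0 : Circ) = ((Int.fract t : ℝ) : Circ) := hg.injective e
          have h7 : cpos 0 ((Int.fract t : ℝ) : Circ) = Int.fract t :=
            cpos_eq (by linarith) h4 (zero_add _)
          rw [← h6, cpos_self] at h7
          linarith
        · have h6 : sbtw (0 : Circ) ((Int.fract s : ℝ) : Circ) ((Int.fract t : ℝ) : Circ) :=
            sbtw_iff_exists_lift.2 ⟨0, _, _, h5, hf, by linarith, rfl, rfl, rfl⟩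
          have h7 := hg _ _ _ h6
          rw [sbtw_iff_cpos (g 0), cpos_self] at h7
          have := cpos_nonneg (g 0) (g ((Int.fract s : ℝ) : Circ))
          have := cpos_nonneg (g 0) (g ((Int.fract t : ℝ) : Circ))
          grind
      simp only [G, h]; linarith
  refine ⟨⟨⟨G, hmono.monotone⟩, fun t => ?_⟩, hmono, fun t => ?_⟩
  · simp [G]; ring
  · change _ = ((c + ⌊t⌋ + cpos (g 0) (g (t : Circ)) : ℝ) : Circ)
    rw [add_right_comm, AddCircle.coe_add, AddCircle.coe_add, hc, add_cpos]
    simp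

end CycMono

/-- A monotone surjection of `ℝ` is continuous, and a bijective degree one lift is a unit whose
inverse is again such a lift; both descend to the circle. -/
theorem exists_homeomorph_of_lift (K : CircleDeg1Lift) (hK : StrictMono K)
    (hs : Function.Surjective K) :
    ∃ k : Circ ≃ₜ Circ, CycMono k ∧ ∀ t : ℝ, k (t : Circ) = (K t : Circ) := by
  have key : ∀ K : CircleDeg1Lift, Function.Surjective K →
      ∃ k : Circ → Circ, Continuous k ∧ ∀ t : ℝ, k (t : Circ) = (K t : Circ) := by
    intro K hs
    have h : ∀ t : ℝ, ((K (cpos 0 (t : Circ)) : ℝ) : Circ) = (K t : Circ) := fun t => by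
      have h1 : ((cpos 0 (t : Circ) : ℝ) : Circ) = (t : Circ) := by
        have := add_cpos 0 (t : Circ); rwa [zero_add] at this
      obtain ⟨n, h2⟩ := exists_int_of_coe_eq h1
      conv_rhs => rw [h2]
      rw [K.map_add_int, AddCircle.coe_add, coe_intCast, add_zero]
    refine ⟨fun x => ((K (cpos 0 x) : ℝ) : Circ), ?_, h⟩
    refine (QuotientAddGroup.isQuotientMap_mk (AddSubgroup.zmultiples (1 : ℝ))).continuous_iff.2 ?_
    exact ((AddCircle.continuous_mk' 1).comp (K.continuous_iff_surjective.2 hs)).congr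
      fun t => (h t).symm
  obtain ⟨u, rfl⟩ := CircleDeg1Lift.isUnit_iff_bijective.2 ⟨hK.injective, hs⟩
  obtain ⟨k, hk, hk'⟩ := key u hs
  obtain ⟨l, hl, hl'⟩ := key (u⁻¹ : CircleDeg1Liftˣ)
    (CircleDeg1Lift.isUnit_iff_bijective.1 ⟨u⁻¹, rfl⟩).2
  refine ⟨⟨⟨k, l, fun x => ?_, fun x => ?_⟩, hk, hl⟩, ?_, hk'⟩
  · obtain ⟨t, rfl⟩ := QuotientAddGroup.mk_surjective x
    rw [hk', hl', CircleDeg1Lift.units_inv_apply_apply]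
  · obtain ⟨t, rfl⟩ := QuotientAddGroup.mk_surjective x
    rw [hl', hk', CircleDeg1Lift.units_apply_inv_apply]
  · intro x y z h
    obtain ⟨a, b, c, h1, h2, h3, rfl, rfl, rfl⟩ := sbtw_iff_exists_lift.1 h
    refine sbtw_iff_exists_lift.2 ⟨_, _, _, hK h1, hK h2, ?_, (hk' a).symm, (hk' b).symm,
      (hk' c).symm⟩
    have := hK h3
    rwa [CircleDeg1Lift.map_add_one] at this

/-- An interval of at most half a turn embeds in the circle, so its infinitely many points cannot
all land in a finite set. -/
theorem dense_lift_of_finite_compl {A : Set Circ} (hA : Aᶜ.Finite) {x y : ℝ} (hxy : x < y) :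
    ∃ t, x < t ∧ t < y ∧ (t : Circ) ∈ A := by
  wlog h : y ≤ x + 1 / 2 generalizing y
  · obtain ⟨t, h1, h2, h3⟩ := this (y := x + 1 / 2) (by linarith) le_rfl
    exact ⟨t, h1, by linarith, h3⟩
  have hinj : InjOn (fun t : ℝ => (t : Circ)) (Ioo x y) := by
    intro s hs t ht hst
    refine (AddCircle.coe_eq_coe_iff_of_mem_Ico (p := 1) (a := x) ?_ ?_).1 hst
    · exact ⟨hs.1.le, by linarith [hs.2]⟩
    · exact ⟨ht.1.le, by linarith [ht.2]⟩
  by_contra hcon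
  push Not at hcon
  have : (Ioo x y).Finite := by
    refine Set.Finite.of_finite_image (hA.subset ?_) hinj
    rintro _ ⟨t, ht, rfl⟩
    exact hcon t ht.1 ht.2
  exact (Ioo_infinite hxy) this

/-- Two cyclically monotone maps whose ranges agree up to finitely many points differ by a
reparametrization, off a finite set. -/
theorem CycMono.exists_reparam {g₁ g₂ : Circ → Circ} (h₁ : CycMono g₁) (h₂ : CycMono g₂)
    {A : Set Circ} (hA₁ : A ⊆ range g₁) (hA₂ : A ⊆ range g₂) (hf₁ : (range g₁ \ A).Finite)
    (hf₂ : (range g₂ \ A).Finite) :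
    ∃ k : Circ ≃ₜ Circ, CycMono k ∧ {x | g₁ (k x) ≠ g₂ x}.Finite := by
  obtain ⟨G₁, hG₁, hl₁⟩ := h₁.exists_lift
  obtain ⟨G₂, hG₂, hl₂⟩ := h₂.exists_lift
  have fin : ∀ {g : Circ → Circ}, CycMono g → (range g \ A).Finite → (g ⁻¹' A)ᶜ.Finite := by
    intro g hg hf
    refine (hf.preimage hg.injective.injOn).subset fun x hx => ⟨⟨x, rfl⟩, hx⟩
  have hne : ∀ t, {s | G₁ s ≤ G₂ t}.Nonempty := fun t =>
    (G₁.tendsto_atBot.eventually_le_atBot (G₂ t)).exists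
  have hbdd : ∀ t, BddAbove {s | G₁ s ≤ G₂ t} := fun t => by
    obtain ⟨b, hb⟩ := (G₁.tendsto_atTop.eventually_gt_atTop (G₂ t)).exists
    exact ⟨b, fun s hs => (hG₁.lt_iff_lt.1 (lt_of_le_of_lt hs hb)).le⟩
  -- This plays the role of `G₁⁻¹ ∘ G₂`. Since `G₁` need not be onto, the supremum of the times at
  -- which `G₁` has not yet passed `G₂ t` is taken; where an exact preimage exists, it is that
  -- preimage.
  let K : ℝ → ℝ := fun t => sSup {s | G₁ s ≤ G₂ t}
  have hKeq : ∀ s t, G₁ s = G₂ t → K t = s := fun s t hst => by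
    have : {s | G₁ s ≤ G₂ t} = Iic s := by
      ext r; rw [mem_Iic, ← hG₁.le_iff_le, hst]; rfl
    simp only [K, this, csSup_Iic]
  have hKm : Monotone K := fun s t hst =>
    csSup_le_csSup (hbdd t) (hne s) fun r hr => le_trans (show G₁ r ≤ G₂ s from hr) (G₂.mono hst)
  have hlift : ∀ {g g' : Circ → Circ} {G G' : CircleDeg1Lift}, (∀ t : ℝ, g (t : Circ) = (G t : Circ)) →
      (∀ t : ℝ, g' (t : Circ) = (G' t : Circ)) → A ⊆ range g' → ∀ t : ℝ, g (t : Circ) ∈ A →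
      ∃ s, G' s = G t := by
    intro g g' G G' hl hl' hA t ht
    obtain ⟨x, hx⟩ := hA ht
    obtain ⟨s, rfl⟩ := QuotientAddGroup.mk_surjective x
    change g' (s : Circ) = _ at hx
    rw [hl, hl'] at hx
    obtain ⟨n, hn⟩ := exists_int_of_coe_eq hx
    exact ⟨s + n, by rw [CircleDeg1Lift.map_add_int, hn]⟩
  -- Between `x` and `y` there are two times whose `g₂`-values lie in `A`; at these `K` is an exact
  -- inverse, and so strictly increasing.
  have hKs : StrictMono K := by
    intro x y hxy
    obtain ⟨t, h1, h2, h3⟩ := dense_lift_of_finite_compl (fin h₂ hf₂) hxy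
    obtain ⟨t', h1', h2', h3'⟩ := dense_lift_of_finite_compl (fin h₂ hf₂) h2
    obtain ⟨s, hs⟩ := hlift hl₂ hl₁ hA₁ t h3
    obtain ⟨s', hs'⟩ := hlift hl₂ hl₁ hA₁ t' h3'
    have h4 : s < s' := hG₁.lt_iff_lt.1 (by rw [hs, hs']; exact hG₂ h1')
    calc K x ≤ K t := hKm h1.le
      _ < K t' := by rw [hKeq s t hs, hKeq s' t' hs']; exact h4
      _ ≤ K y := hKm h2'.le
  -- A monotone map with dense range has no jumps. The values of `K` include every time at which
  -- `g₁` lies in `A`.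
  have hKd : DenseRange K := by
    refine dense_of_exists_between fun x y hxy => ?_
    obtain ⟨t, h1, h2, h3⟩ := dense_lift_of_finite_compl (fin h₁ hf₁) hxy
    obtain ⟨s, hs⟩ := hlift hl₁ hl₂ hA₂ t h3
    exact ⟨t, ⟨s, hKeq t s hs.symm⟩, h1, h2⟩
  let K' : CircleDeg1Lift := ⟨⟨K, hKm⟩, fun t => by
    have : {s | G₁ s ≤ G₂ (t + 1)} = (fun s => s + 1) '' {s | G₁ s ≤ G₂ t} := by
      ext s
      simp only [mem_image, Set.mem_ofPred_eq, CircleDeg1Lift.map_add_one]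
      constructor
      · intro h
        refine ⟨s - 1, ?_, by ring⟩
        have := G₁.map_add_one (s - 1)
        rw [sub_add_cancel] at this
        linarith
      · rintro ⟨r, hr, rfl⟩
        rw [CircleDeg1Lift.map_add_one]; linarith
    change sSup _ = sSup _ + 1
    rw [this]
    exact ((OrderIso.addRight (1 : ℝ)).map_csSup' (hne t) (hbdd t)).symm⟩
  obtain ⟨k, hk, hk'⟩ := exists_homeomorph_of_lift K' hKs
    (K'.continuous_iff_surjective.1 (hKm.continuous_of_denseRange hKd))
  refine ⟨k, hk, (fin h₂ hf₂).subset fun x hx hxA => hx ?_⟩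
  obtain ⟨t, rfl⟩ := QuotientAddGroup.mk_surjective x
  obtain ⟨s, hs⟩ := hlift hl₂ hl₁ hA₁ t hxA
  rw [hk' t, hl₁, hl₂, ← hs]
  exact congrArg (fun r => ((G₁ r : ℝ) : Circ)) (hKeq s t hs)

theorem dense_of_finite_compl {A : Set Circ} (hA : Aᶜ.Finite) : Dense A := by
  intro x
  obtain ⟨t, rfl⟩ := QuotientAddGroup.mk_surjective x
  have hd : Dense ((fun t : ℝ => (t : Circ)) ⁻¹' A) := dense_of_exists_between fun x y hxy => by
    obtain ⟨t, h1, h2, h3⟩ := dense_lift_of_finite_compl hA hxy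
    exact ⟨t, h3, h1, h2⟩
  exact (AddCircle.continuous_mk' 1).closure_preimage_subset A (hd t)

end CyclicMaps

/-! ### Isotopy of loops that trace nearly the same points -/

section Reparametrization

variable {S : Type*} [TopologicalSpace S] [ChartedSpace (EuclideanHalfSpace 2) S]

/-- The source of all isotopies below, both between face loops and between arcs. The
reparametrization matches the two loops off a finite set; the complement is dense, and continuous
maps into a Hausdorff space that agree on a dense set are equal. -/
theorem isotopic_of_cycMono [T2Space S] {α : Circ → S} {g₁ g₂ : Circ → Circ}
    (h₁ : CycMono g₁) (h₂ : CycMono g₂)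
    {A : Set Circ} (hA₁ : A ⊆ range g₁) (hA₂ : A ⊆ range g₂) (hf₁ : (range g₁ \ A).Finite)
    (hf₂ : (range g₂ \ A).Finite) (h : unitInterval → S ≃ₜ S)
    (hc : Continuous (fun p : unitInterval × S => h p.1 p.2)) (h0 : h 0 = Homeomorph.refl S)
    {β₁ β₂ : GenericLoop S} (hβ₁ : ∀ x, β₁.toFun x = α (g₁ x))
    (hβ₂ : ∀ x, β₂.toFun x = h 1 (α (g₂ x))) : Isotopic β₁ β₂ := by
  obtain ⟨k, hk, hfin⟩ := h₁.exists_reparam h₂ hA₁ hA₂ hf₁ hf₂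
  refine ⟨k, hk, h, hc, h0, fun x => ?_⟩
  have hd : Dense {x | g₁ (k x) = g₂ x} := dense_of_finite_compl hfin
  have := Continuous.ext_on hd β₂.continuous
    ((h 1).continuous.comp (β₁.continuous.comp k.continuous)) fun x hx => by
      simp only [Function.comp, hβ₁, hβ₂]; rw [show g₁ (k x) = g₂ x from hx]
  exact congrFun this x

end Reparametrization

/-! ### Winding numbers of maps from the circle to the punctured plane -/

section Winding

open Filter Topology ComplexConjugate

/-- Two maps from the circle to `ℂ ∖ 0` have the same winding number: their quotient has a
continuous logarithm. -/
def LogEquiv (f g : Circle → ℂ) : Prop :=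
  ∃ L : Circle → ℂ, Continuous L ∧ ∀ z, g z = f z * Complex.exp (L z)

theorem continuous_coe_circle : Continuous fun z : Circle => (z : ℂ) := continuous_subtype_val

namespace LogEquiv

variable {f g h : Circle → ℂ}

theorem symm : LogEquiv f g → LogEquiv g f := by
  rintro ⟨L, hL, h⟩
  exact ⟨fun z => -L z, hL.neg, fun z => by rw [h, mul_assoc, ← Complex.exp_add]; simp⟩

theorem trans : LogEquiv f g → LogEquiv g h → LogEquiv f h := by
  rintro ⟨L, hL, h1⟩ ⟨M, hM, h2⟩
  exact ⟨fun z => L z + M z, hL.add hM, fun z => by rw [h2, h1, mul_assoc, ← Complex.exp_add]⟩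

/-- The quotient `g / f` stays in the open unit disk around `1`, where the principal logarithm is
continuous. -/
theorem of_near (hf : Continuous f) (hg : Continuous g) (h : ∀ z, ‖g z - f z‖ < ‖f z‖) :
    LogEquiv f g := by
  have hne : ∀ z, f z ≠ 0 := fun z h0 => by
    have := h z; rw [h0, norm_zero] at this; exact absurd this (norm_nonneg _).not_gt
  have hs : ∀ z, g z / f z ∈ Complex.slitPlane := fun z => by
    have h1 : g z / f z = 1 + (g z - f z) / f z := by have := hne z; field_simp; ring
    rw [h1]
    apply Complex.mem_slitPlane_of_norm_lt_one
    rw [norm_div, div_lt_one (norm_pos_iff.2 (hne z))]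
    exact h z
  refine ⟨fun z => Complex.log (g z / f z), (hg.div hf hne).clog hs, fun z => ?_⟩
  rw [Complex.exp_log (Complex.slitPlane_ne_zero (hs z)), mul_div_cancel₀ _ (hne z)]

theorem const_mul {a : ℂ} (ha : a ≠ 0) (f : Circle → ℂ) : LogEquiv f (fun z => a * f z) :=
  ⟨fun _ => Complex.log a, continuous_const, fun z => by rw [Complex.exp_log ha, mul_comm]⟩

/-- Compactness of the circle makes the nearness required by `of_near` uniform in `z`. Thus the
winding number is locally constant in the parameter. -/
theorem eventually {X : Type*} [TopologicalSpace X] {s : Set X} {x₀ : X} (hx₀ : x₀ ∈ s)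
    {F : X → Circle → ℂ} (hF : ContinuousOn (fun p : X × Circle => F p.1 p.2) (s ×ˢ univ))
    (hne : ∀ z, F x₀ z ≠ 0) : ∀ᶠ x in 𝓝[s] x₀, LogEquiv (F x₀) (F x) := by
  have hc : ∀ x ∈ s, Continuous (F x) := fun x hx => by
    rw [← continuousOn_univ]
    exact hF.comp (f := fun z : Circle => (x, z)) (by fun_prop) fun z _ => ⟨hx, mem_univ _⟩
  have key : ∀ᶠ x in 𝓝 x₀, ∀ z ∈ (univ : Set Circle), x ∈ s → ‖F x z - F x₀ z‖ < ‖F x₀ z‖ := by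
    refine isCompact_univ.eventually_forall_of_forall_eventually fun z _ => ?_
    have h1 : ContinuousWithinAt (fun p : X × Circle => ‖F p.1 p.2 - F x₀ p.2‖) (s ×ˢ univ)
        (x₀, z) :=
      ((hF (x₀, z) ⟨hx₀, mem_univ _⟩).sub
        ((hc x₀ hx₀).comp continuous_snd).continuousWithinAt).norm
    have h2 : ContinuousWithinAt (fun p : X × Circle => ‖F x₀ p.2‖) (s ×ˢ univ) (x₀, z) :=
      ((hc x₀ hx₀).comp continuous_snd).norm.continuousWithinAt
    have h3 := h1.tendsto.eventually_lt h2.tendsto (by simpa using hne z)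
    rw [eventually_nhdsWithin_iff] at h3
    filter_upwards [h3] with p hp hps using hp ⟨hps, mem_univ _⟩
  rw [eventually_nhdsWithin_iff]
  filter_upwards [key] with x hx hxs
  exact of_near (hc x₀ hx₀) (hc x hxs) fun z => hx z (mem_univ _) hxs

theorem of_homotopy {X : Type*} [TopologicalSpace X] {s : Set X} (hs : IsPreconnected s)
    {F : X → Circle → ℂ} (hF : ContinuousOn (fun p : X × Circle => F p.1 p.2) (s ×ˢ univ))
    (hne : ∀ x ∈ s, ∀ z, F x z ≠ 0) {x y : X} (hx : x ∈ s) (hy : y ∈ s) :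
    LogEquiv (F x) (F y) :=
  hs.induction₂ (fun x y => LogEquiv (F x) (F y)) (fun x hx => eventually hx hF (hne x hx))
    (fun _ _ _ _ _ _ h h' => h.trans h') (fun _ _ _ _ h => h.symm) hx hy

/-- With `z = exp (i t)`, a logarithm `L` of `conj z / z` makes `L + 2 i t` an integer multiple of
`2 π i`. Over a full turn that integer would have to grow by `2`, but continuity would then produce
a half-integer on the way. -/
theorem not_id_conj : ¬ LogEquiv (fun z => (z : ℂ)) (fun z => conj (z : ℂ)) := by
  rintro ⟨L, hL, h⟩
  let M : ℝ → ℂ := fun t => L (Circle.exp t) + 2 * t * Complex.I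
  have hM : Continuous M := (hL.comp Circle.exp.continuous).add (by fun_prop)
  have hexp : ∀ t, Complex.exp (M t) = 1 := fun t => by
    have h1 : conj (Circle.exp t : ℂ) = (Circle.exp t : ℂ) * Complex.exp (L (Circle.exp t)) :=
      h (Circle.exp t)
    rw [Circle.coe_exp, ← Complex.exp_conj] at h1
    simp only [map_mul, Complex.conj_ofReal, Complex.conj_I] at h1
    have h2 : Complex.exp (t * Complex.I) ≠ 0 := Complex.exp_ne_zero _
    have h3 : Complex.exp (L (Circle.exp t)) = Complex.exp (t * -Complex.I - t * Complex.I) := by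
      rw [Complex.exp_sub, h1, mul_div_cancel_left₀ _ h2]
    rw [Complex.exp_add, h3, ← Complex.exp_add]
    ring_nf; exact Complex.exp_zero
  have hint : ∀ t, ∃ n : ℤ, (M t).im / (2 * Real.pi) = n := fun t => by
    obtain ⟨n, hn⟩ := Complex.exp_eq_one_iff.1 (hexp t)
    refine ⟨n, ?_⟩
    rw [hn]
    have := Real.pi_ne_zero
    simp
  let g : ℝ → ℝ := fun t => (M t).im / (2 * Real.pi)
  have hg : Continuous g := (Complex.continuous_im.comp hM).div_const _
  have hend : g (2 * Real.pi) = g 0 + 2 := by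
    have := Real.pi_ne_zero
    simp only [g, M, Circle.exp_two_pi, Circle.exp_zero]
    simp
    field_simp
  obtain ⟨n, hn⟩ := hint 0
  obtain ⟨t, -, ht⟩ := intermediate_value_Icc (f := g) (a := 0) (b := 2 * Real.pi)
    (by positivity) hg.continuousOn (show g 0 + 1 / 2 ∈ Icc (g 0) (g (2 * Real.pi)) from
      ⟨by linarith, by linarith⟩)
  obtain ⟨m, hm⟩ := hint t
  have h1 : (m : ℝ) = n + 1 / 2 := by rw [← hm, ← hn]; exact ht
  have h2 : (2 * m : ℝ) = ((2 * n + 1 : ℤ) : ℝ) := by rw [h1]; push_cast; ring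
  have h3 : 2 * m = 2 * n + 1 := by exact_mod_cast h2
  omega

/-- A real linear map `w ↦ a w + b (conj w)` has determinant `‖a‖² - ‖b‖²`. If this is positive, the
term `a w` dominates and the other one can be dropped. -/
theorem linear {f : Circle → ℂ} (hf : Continuous f) (hne : ∀ z, f z ≠ 0) {p q : ℂ}
    (h : 0 < p.re * q.im - p.im * q.re) :
    LogEquiv f (fun z => (f z).re * p + (f z).im * q) := by
  set a : ℂ := (p - Complex.I * q) / 2
  set b : ℂ := (p + Complex.I * q) / 2
  have e : ∀ w : ℂ, w.re * p + w.im * q = a * w + b * conj w := fun w => by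
    apply Complex.ext <;> simp [a, b] <;> ring
  have hab : ‖b‖ < ‖a‖ := by
    rw [← sq_lt_sq₀ (norm_nonneg _) (norm_nonneg _), Complex.sq_norm, Complex.sq_norm,
      Complex.normSq_apply, Complex.normSq_apply]
    simp [a, b]
    nlinarith
  have ha : a ≠ 0 := norm_pos_iff.1 ((norm_nonneg b).trans_lt hab)
  refine (const_mul ha f).trans (of_near (by fun_prop) ?_ fun z => ?_)
  · exact ((Complex.continuous_ofReal.comp (Complex.continuous_re.comp hf)).mul
      continuous_const).add ((Complex.continuous_ofReal.comp (Complex.continuous_im.comp hf)).mul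
      continuous_const)
  · simp only [e]
    rw [add_sub_cancel_left, norm_mul, norm_mul, RCLike.norm_conj]
    exact mul_lt_mul_of_pos_right hab (norm_pos_iff.2 (hne z))

end LogEquiv

/-! ### The sign of an isolated crossing as a winding number -/

section CrossingSign

set_option linter.unusedSectionVars false

variable {S : Type*} [TopologicalSpace S] [ChartedSpace (EuclideanHalfSpace 2) S]

/-- The Euclidean plane as the complex plane. -/
noncomputable def planeToComplex : EuclideanSpace ℝ (Fin 2) ≃ₗᵢ[ℝ] ℂ :=
  Complex.orthonormalBasisOneI.repr.symm

theorem planeToComplex_re (x : EuclideanSpace ℝ (Fin 2)) : (planeToComplex x).re = x 0 := by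
  simp [planeToComplex, Complex.orthonormalBasisOneI_repr_symm_apply]

theorem planeToComplex_im (x : EuclideanSpace ℝ (Fin 2)) : (planeToComplex x).im = x 1 := by
  simp [planeToComplex, Complex.orthonormalBasisOneI_repr_symm_apply]

/-- The map `(u, v) ↦ σ u - τ v` on the circle of radius `r`, in the chart `e`. -/
noncomputable def chordMap (e : OpenPartialHomeomorph S (EuclideanHalfSpace 2)) (σ τ : ℝ → S)
    (r : ℝ) (z : Circle) : ℂ :=
  planeToComplex (e.extend (𝓡∂ 2) (σ (r * (z : ℂ).re)) - e.extend (𝓡∂ 2) (τ (r * (z : ℂ).im)))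

/-- `σ` and `τ` meet at time `0` and nowhere else as long as time stays within `ρ`. -/
structure IsolatedCrossing (σ τ : ℝ → S) (ρ : ℝ) : Prop where
  left : Continuous σ
  right : Continuous τ
  pos : 0 < ρ
  eq : σ 0 = τ 0
  isolated : ∀ u v, |u| ≤ ρ → |v| ≤ ρ → σ u = τ v → u = 0 ∧ v = 0

/-- The curves `σ` and `τ` stay in the domain of the chart as long as time stays within `r`. -/
def InChart (e : OpenPartialHomeomorph S (EuclideanHalfSpace 2)) (σ τ : ℝ → S) (r : ℝ) : Prop :=
  ∀ u, |u| ≤ r → σ u ∈ e.source ∧ τ u ∈ e.source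

theorem abs_mul_re_le {r : ℝ} (hr : 0 ≤ r) (z : Circle) : |r * (z : ℂ).re| ≤ r := by
  rw [abs_mul, abs_of_nonneg hr]
  have := Complex.abs_re_le_norm (z : ℂ)
  rw [Circle.norm_coe] at this
  nlinarith

theorem abs_mul_im_le {r : ℝ} (hr : 0 ≤ r) (z : Circle) : |r * (z : ℂ).im| ≤ r := by
  rw [abs_mul, abs_of_nonneg hr]
  have := Complex.abs_im_le_norm (z : ℂ)
  rw [Circle.norm_coe] at this
  nlinarith

theorem InChart.mono {e : OpenPartialHomeomorph S (EuclideanHalfSpace 2)} {σ τ : ℝ → S} {r r' : ℝ}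
    (h : InChart e σ τ r) (hr : r' ≤ r) : InChart e σ τ r' := fun u hu => h u (hu.trans hr)

/-- A zero would be a common point of the two curves, as the chart is injective; isolation then puts
both times at `0`, impossible on a circle of positive radius. -/
theorem IsolatedCrossing.chordMap_ne {e : OpenPartialHomeomorph S (EuclideanHalfSpace 2)}
    {σ τ : ℝ → S} {ρ r : ℝ} (h : IsolatedCrossing σ τ ρ) (hr : 0 < r) (hrρ : r ≤ ρ)
    (hc : InChart e σ τ r) (z : Circle) : chordMap e σ τ r z ≠ 0 := by
  intro h0
  have h1 := abs_mul_re_le hr.le z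
  have h2 := abs_mul_im_le hr.le z
  rw [chordMap, planeToComplex.map_eq_zero_iff, sub_eq_zero] at h0
  have h3 := (e.extend (𝓡∂ 2)).injOn (by rw [e.extend_source]; exact (hc _ h1).1)
    (by rw [e.extend_source]; exact (hc _ h2).2) h0
  obtain ⟨h4, h5⟩ := h.isolated _ _ (h1.trans hrρ) (h2.trans hrρ) h3
  have h6 : (z : ℂ) = 0 := Complex.ext (by simpa [hr.ne'] using h4) (by simpa [hr.ne'] using h5)
  exact Circle.coe_ne_zero z h6

theorem continuousOn_chordMap {X : Type*} [TopologicalSpace X] {s : Set X}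
    {e : OpenPartialHomeomorph S (EuclideanHalfSpace 2)} {σ τ : X → ℝ → S} {r : X → ℝ}
    (hσ : Continuous fun p : X × ℝ => σ p.1 p.2) (hτ : Continuous fun p : X × ℝ => τ p.1 p.2)
    (hr : Continuous r) (hr0 : ∀ x ∈ s, 0 ≤ r x) (hc : ∀ x ∈ s, InChart e (σ x) (τ x) (r x)) :
    ContinuousOn (fun p : X × Circle => chordMap e (σ p.1) (τ p.1) (r p.1) p.2) (s ×ˢ univ) := by
  have h1 : Continuous fun p : X × Circle => σ p.1 (r p.1 * (p.2 : ℂ).re) :=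
    hσ.comp (continuous_fst.prodMk ((hr.comp continuous_fst).mul
      (Complex.continuous_re.comp (continuous_coe_circle.comp continuous_snd))))
  have h2 : Continuous fun p : X × Circle => τ p.1 (r p.1 * (p.2 : ℂ).im) :=
    hτ.comp (continuous_fst.prodMk ((hr.comp continuous_fst).mul
      (Complex.continuous_im.comp (continuous_coe_circle.comp continuous_snd))))
  refine planeToComplex.continuous.comp_continuousOn (ContinuousOn.sub ?_ ?_)
  · exact (e.continuousOn_extend (I := 𝓡∂ 2)).comp h1.continuousOn fun p hp => by
      rw [e.extend_source]; exact (hc _ hp.1 _ (abs_mul_re_le (hr0 _ hp.1) _)).1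
  · exact (e.continuousOn_extend (I := 𝓡∂ 2)).comp h2.continuousOn fun p hp => by
      rw [e.extend_source]; exact (hc _ hp.1 _ (abs_mul_im_le (hr0 _ hp.1) _)).2

theorem continuous_chordMap {e : OpenPartialHomeomorph S (EuclideanHalfSpace 2)} {σ τ : ℝ → S}
    (hσ : Continuous σ) (hτ : Continuous τ) {r : ℝ} (hr : 0 ≤ r) (hc : InChart e σ τ r) :
    Continuous (chordMap e σ τ r) := by
  have h := continuousOn_chordMap (X := Unit) (s := univ) (e := e) (σ := fun _ => σ) (τ := fun _ => τ)
    (r := fun _ => r) (hσ.comp continuous_snd) (hτ.comp continuous_snd) continuous_const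
    (fun _ _ => hr) fun _ _ => hc
  rw [← continuousOn_univ]
  exact h.comp (f := fun z : Circle => ((), z)) (by fun_prop) fun z _ => ⟨mem_univ _, mem_univ _⟩

theorem IsolatedCrossing.logEquiv_radius {e : OpenPartialHomeomorph S (EuclideanHalfSpace 2)}
    {σ τ : ℝ → S} {ρ r r' : ℝ} (h : IsolatedCrossing σ τ ρ) (hr : 0 < r) (hrρ : r ≤ ρ)
    (hc : InChart e σ τ r) (hr' : 0 < r') (hr'ρ : r' ≤ r) :
    LogEquiv (chordMap e σ τ r) (chordMap e σ τ r') :=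
  LogEquiv.of_homotopy (isPreconnected_Ioc (a := 0) (b := r)) (F := fun r => chordMap e σ τ r)
    (continuousOn_chordMap (σ := fun _ => σ) (τ := fun _ => τ) (r := fun r => r)
      (h.left.comp continuous_snd) (h.right.comp continuous_snd)
      continuous_id (fun _ hx => hx.1.le) (fun _ hx => hc.mono hx.2))
    (fun _ hx => h.chordMap_ne hx.1 (hx.2.trans hrρ) (hc.mono hx.2)) ⟨hr, le_rfl⟩ ⟨hr', hr'ρ⟩

theorem eventually_inChart {X : Type*} [TopologicalSpace X] {x₀ : X}
    {e : OpenPartialHomeomorph S (EuclideanHalfSpace 2)} {σ τ : X → ℝ → S}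
    (hσ : Continuous fun p : X × ℝ => σ p.1 p.2) (hτ : Continuous fun p : X × ℝ => τ p.1 p.2)
    (h1 : σ x₀ 0 ∈ e.source) (h2 : τ x₀ 0 ∈ e.source) :
    ∃ r, 0 < r ∧ ∀ᶠ x in 𝓝 x₀, InChart e (σ x) (τ x) r := by
  have h : ∀ᶠ p in 𝓝 (x₀, (0 : ℝ)), σ p.1 p.2 ∈ e.source ∧ τ p.1 p.2 ∈ e.source :=
    (hσ.continuousAt.eventually (e.open_source.mem_nhds h1)).and
      (hτ.continuousAt.eventually (e.open_source.mem_nhds h2))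
  rw [nhds_prod_eq] at h
  obtain ⟨P, hP, Q, hQ, hPQ⟩ := eventually_prod_iff.1 h
  obtain ⟨r, hr, hrQ⟩ := Metric.eventually_nhds_iff.1 hQ
  refine ⟨r / 2, by positivity, hP.mono fun x hx u hu => hPQ hx (hrQ ?_)⟩
  rw [Real.dist_eq, sub_zero]
  linarith

theorem exists_inChart {e : OpenPartialHomeomorph S (EuclideanHalfSpace 2)} {σ τ : ℝ → S}
    (hσ : Continuous σ) (hτ : Continuous τ) (h1 : σ 0 ∈ e.source) (h2 : τ 0 ∈ e.source) :
    ∃ r, 0 < r ∧ InChart e σ τ r := by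
  obtain ⟨r, hr, h⟩ := eventually_inChart (x₀ := ()) (σ := fun _ => σ) (τ := fun _ => τ)
    (hσ.comp continuous_snd) (hτ.comp continuous_snd) h1 h2
  exact ⟨r, hr, h.self_of_nhds⟩

theorem planeToComplex_map (A : EuclideanSpace ℝ (Fin 2) →L[ℝ] EuclideanSpace ℝ (Fin 2))
    (x : EuclideanSpace ℝ (Fin 2)) : planeToComplex (A x) =
      (planeToComplex x).re * planeToComplex (A (EuclideanSpace.single 0 1)) +
        (planeToComplex x).im * planeToComplex (A (EuclideanSpace.single 1 1)) := by
  have h : x = x 0 • EuclideanSpace.single 0 (1 : ℝ) + x 1 • EuclideanSpace.single 1 (1 : ℝ) := by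
    ext i; fin_cases i <;> simp
  conv_lhs => rw [h]
  rw [map_add, map_smul, map_smul, map_add, map_smul, map_smul, planeToComplex_re,
    planeToComplex_im]
  simp

theorem det_eq_planeToComplex (A : EuclideanSpace ℝ (Fin 2) →L[ℝ] EuclideanSpace ℝ (Fin 2)) :
    A.det = (planeToComplex (A (EuclideanSpace.single 0 1))).re *
        (planeToComplex (A (EuclideanSpace.single 1 1))).im -
      (planeToComplex (A (EuclideanSpace.single 0 1))).im *
        (planeToComplex (A (EuclideanSpace.single 1 1))).re := by
  rw [ContinuousLinearMap.det,
    ← LinearMap.det_toMatrix (EuclideanSpace.basisFun (Fin 2) ℝ).toBasis, Matrix.det_fin_two]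
  simp [LinearMap.toMatrix_apply, planeToComplex_re, planeToComplex_im]
  ring

/-- A coordinate change does not change the winding number of `chordMap`. -/
theorem IsolatedCrossing.logEquiv_chart [IsManifold (𝓡∂ 2) ∞ S] [OrientedAtlas S]
    {e e' : OpenPartialHomeomorph S (EuclideanHalfSpace 2)}
    (he : e ∈ atlas (EuclideanHalfSpace 2) S) (he' : e' ∈ atlas (EuclideanHalfSpace 2) S)
    {σ τ : ℝ → S} {ρ : ℝ} (h : IsolatedCrossing σ τ ρ) (h1 : σ 0 ∈ e.source)
    (h2 : σ 0 ∈ e'.source) :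
    ∃ δ, 0 < δ ∧ ∀ r, 0 < r → r ≤ δ → LogEquiv (chordMap e σ τ r) (chordMap e' σ τ r) := by
  set T := e'.extend (𝓡∂ 2) ∘ (e.extend (𝓡∂ 2)).symm with hT
  set x₀ := e.extend (𝓡∂ 2) (σ 0) with hx₀
  set A := fderivWithin ℝ T (range (𝓡∂ 2)) x₀ with hA
  have hdet : 0 < A.det := OrientedAtlas.det_pos e he e' he' (σ 0) ⟨h1, h2⟩
  have hmem : x₀ ∈ range (𝓡∂ 2) := mem_range_self _
  have hsm : ContDiffWithinAt ℝ ∞ T (range (𝓡∂ 2)) x₀ :=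
    (𝓡∂ 2).contDiffWithinAt_extendCoordChange' (IsManifold.subset_maximalAtlas he)
      (IsManifold.subset_maximalAtlas he') h1 h2
  -- `A` stretches every vector by more than `c`, so a linearization error of at most `c * ‖w‖` is
  -- harmless. The `+ 1` in the witness makes the bound strict.
  obtain ⟨c, hc, hcA⟩ : ∃ c : ℝ, 0 < c ∧ ∀ w, c * ‖w‖ < ‖A w‖ ∨ w = 0 := by
    let B := A.toContinuousLinearEquivOfDetNeZero hdet.ne'
    refine ⟨(‖(B.symm : EuclideanSpace ℝ (Fin 2) →L[ℝ] EuclideanSpace ℝ (Fin 2))‖ + 1)⁻¹,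
      by positivity, fun w => ?_⟩
    by_cases hw : w = 0
    · exact Or.inr hw
    left
    have hBw : B w = A w := rfl
    have h3 : ‖w‖ ≤ ‖(B.symm : EuclideanSpace ℝ (Fin 2) →L[ℝ] EuclideanSpace ℝ (Fin 2))‖ * ‖A w‖ := by
      have := (B.symm : EuclideanSpace ℝ (Fin 2) →L[ℝ] EuclideanSpace ℝ (Fin 2)).le_opNorm (B w)
      rw [hBw] at this
      simpa [← hBw] using this
    have h4 : 0 < ‖A w‖ := by
      refine norm_pos_iff.2 fun h0 => hw ?_
      rw [← hBw] at h0
      simpa using h0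
    rw [inv_mul_lt_iff₀ (by positivity)]
    linarith
  -- Both points move, so differentiability at `x₀` alone is too weak. The mean value inequality on
  -- the convex set ball ∩ half plane gives the two-point estimate, at boundary points as well.
  have hstrict : ∃ ε > 0, ∀ x ∈ Metric.ball x₀ ε ∩ range (𝓡∂ 2),
      ∀ y ∈ Metric.ball x₀ ε ∩ range (𝓡∂ 2), ‖T y - T x - A (y - x)‖ ≤ c * ‖y - x‖ := by
    have hd : ∀ᶠ x in 𝓝[range (𝓡∂ 2)] x₀, DifferentiableWithinAt ℝ T (range (𝓡∂ 2)) x := by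
      have := (hsm.of_le (m := 1) (by exact_mod_cast le_top)).eventually (by simp)
      rw [insert_eq_of_mem hmem] at this
      exact this.mono fun x hx => hx.differentiableWithinAt (by simp)
    have hcont := hsm.continuousWithinAt_fderivWithin (𝓡∂ 2).uniqueDiffOn (by simp) hmem
    have hb : ∀ᶠ x in 𝓝[range (𝓡∂ 2)] x₀, ‖fderivWithin ℝ T (range (𝓡∂ 2)) x - A‖ < c := by
      have := hcont.eventually (Metric.ball_mem_nhds _ hc)
      simpa only [dist_eq_norm, Metric.mem_ball] using this
    obtain ⟨ε, hε, hball⟩ := Metric.mem_nhdsWithin_iff.1 (hd.and hb)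
    refine ⟨ε, hε, fun x hx y hy => ?_⟩
    refine Convex.norm_image_sub_le_of_norm_hasFDerivWithin_le' (𝕜 := ℝ)
      (s := Metric.ball x₀ ε ∩ range (𝓡∂ 2))
      (fun z hz => ((hball hz).1.hasFDerivWithinAt.mono inter_subset_right))
      (fun z hz => (hball hz).2.le) ((convex_ball _ _).inter (𝓡∂ 2).convex_range) hx hy
  obtain ⟨ε, hε, hstrict⟩ := hstrict
  obtain ⟨r₁, hr₁, hc₁⟩ := exists_inChart h.left h.right h1 (h.eq ▸ h1)
  obtain ⟨r₂, hr₂, hc₂⟩ := exists_inChart h.left h.right h2 (h.eq ▸ h2)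
  have hnear : ∀ σ' : ℝ → S, Continuous σ' → σ' 0 = σ 0 →
      ∃ δ > 0, ∀ u, |u| ≤ δ → e.extend (𝓡∂ 2) (σ' u) ∈ Metric.ball x₀ ε := by
    intro σ' hσ' h0
    have hcont : ContinuousAt (fun u => e.extend (𝓡∂ 2) (σ' u)) 0 :=
      ContinuousAt.comp (f := σ') (e.continuousAt_extend (I := 𝓡∂ 2) (h0 ▸ h1)) hσ'.continuousAt
    have := hcont.eventually (Metric.ball_mem_nhds _ hε)
    obtain ⟨δ, hδ, hδ'⟩ := Metric.eventually_nhds_iff.1 this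
    refine ⟨δ / 2, by positivity, fun u hu => ?_⟩
    have := hδ' (show dist u 0 < δ by rw [Real.dist_eq, sub_zero]; linarith)
    rw [Metric.mem_ball, hx₀, ← h0]
    exact this
  obtain ⟨δ₁, hδ₁, hn₁⟩ := hnear σ h.left rfl
  obtain ⟨δ₂, hδ₂, hn₂⟩ := hnear τ h.right h.eq.symm
  refine ⟨min (min ρ (min r₁ r₂)) (min δ₁ δ₂), ?_, fun r hr hrm => ?_⟩
  · have := h.pos
    positivity
  simp only [le_min_iff] at hrm
  obtain ⟨⟨k1, k2, k3⟩, k4, k5⟩ := hrm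
  have hcr := hc₁.mono k2
  have hcr' := hc₂.mono k3
  have hne := h.chordMap_ne hr k1 hcr
  have hcont := continuous_chordMap h.left h.right hr.le hcr
  -- Applying `A` to the difference preserves the winding number since `det A > 0`; the difference
  -- of the images under `T` is then close to the result.
  refine (LogEquiv.linear hcont hne ((det_eq_planeToComplex A).symm ▸ hdet)).trans
    (LogEquiv.of_near ?_ (continuous_chordMap h.left h.right hr.le hcr') fun z => ?_)
  · exact ((Complex.continuous_ofReal.comp (Complex.continuous_re.comp hcont)).mul
      continuous_const).add ((Complex.continuous_ofReal.comp (Complex.continuous_im.comp hcont)).mul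
      continuous_const)
  · have m1 := abs_mul_re_le hr.le z
    have m2 := abs_mul_im_le hr.le z
    set y := e.extend (𝓡∂ 2) (σ (r * (z : ℂ).re)) with hy
    set x := e.extend (𝓡∂ 2) (τ (r * (z : ℂ).im)) with hx
    have ey : T y = e'.extend (𝓡∂ 2) (σ (r * (z : ℂ).re)) := by
      rw [hT, hy, Function.comp, e.extend_left_inv (hcr _ m1).1]
    have ex : T x = e'.extend (𝓡∂ 2) (τ (r * (z : ℂ).im)) := by
      rw [hT, hx, Function.comp, e.extend_left_inv (hcr _ m2).2]
    have hyx : y - x ≠ 0 := fun h0 => hne z (by rw [chordMap, ← hx, ← hy, h0, map_zero])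
    have e1 := planeToComplex_map A (y - x)
    have e2 : chordMap e σ τ r z = planeToComplex (y - x) := rfl
    have e3 : chordMap e' σ τ r z = planeToComplex (T y - T x) := by rw [ey, ex]; rfl
    rw [e2, e3, ← e1, ← map_sub, LinearIsometryEquiv.norm_map, LinearIsometryEquiv.norm_map]
    refine (hstrict x ⟨hn₂ _ (m2.trans k5), mem_range_self _⟩ y
      ⟨hn₁ _ (m1.trans k4), mem_range_self _⟩).trans_lt ?_
    exact (hcA _).resolve_right hyx

/-- The crossing of `σ` and `τ` at time `0` is positive. -/
def PosCrossing (σ τ : ℝ → S) : Prop :=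
  ∃ e ∈ atlas (EuclideanHalfSpace 2) S, ∃ ρ r, IsolatedCrossing σ τ ρ ∧ 0 < r ∧ r ≤ ρ ∧
    InChart e σ τ r ∧ LogEquiv (chordMap e σ τ r) fun z => conj (z : ℂ)

/-- The winding number depends neither on the radius nor on the chart, so one admissible choice
decides. Two choices are compared after shrinking both to a common small radius. -/
theorem posCrossing_iff [IsManifold (𝓡∂ 2) ∞ S] [OrientedAtlas S]
    {e : OpenPartialHomeomorph S (EuclideanHalfSpace 2)}
    (he : e ∈ atlas (EuclideanHalfSpace 2) S) {σ τ : ℝ → S} {ρ r : ℝ} (h : IsolatedCrossing σ τ ρ)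
    (hr : 0 < r) (hrρ : r ≤ ρ) (hc : InChart e σ τ r) :
    PosCrossing σ τ ↔ LogEquiv (chordMap e σ τ r) fun z => conj (z : ℂ) := by
  refine ⟨?_, fun hl => ⟨e, he, ρ, r, h, hr, hrρ, hc, hl⟩⟩
  rintro ⟨e', he', ρ', r', h', hr', hrρ', hc', hl⟩
  have hz : ∀ {r : ℝ}, 0 < r → |(0 : ℝ)| ≤ r := fun hr => by simpa using hr.le
  obtain ⟨δ, hδ, hd⟩ := h.logEquiv_chart he he' (hc 0 (hz hr)).1 (hc' 0 (hz hr')).1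
  have hm : 0 < min δ (min r r') := by positivity
  refine (h.logEquiv_radius hr hrρ hc hm ((min_le_right _ _).trans (min_le_left _ _))).trans
    ((hd _ hm (min_le_left _ _)).trans (LogEquiv.trans (LogEquiv.symm ?_) hl))
  exact h'.logEquiv_radius hr' hrρ' hc' hm ((min_le_right _ _).trans (min_le_right _ _))

/-- Since `ρ` does not depend on `t`, one chart and one radius serve all parameters near a given
one. The sign is thus locally constant on the connected interval. -/
theorem posCrossing_family [IsManifold (𝓡∂ 2) ∞ S] [OrientedAtlas S]
    {σ τ : unitInterval → ℝ → S} {ρ : ℝ}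
    (hσ : Continuous fun p : unitInterval × ℝ => σ p.1 p.2)
    (hτ : Continuous fun p : unitInterval × ℝ => τ p.1 p.2)
    (h : ∀ t, IsolatedCrossing (σ t) (τ t) ρ) :
    PosCrossing (σ 0) (τ 0) ↔ PosCrossing (σ 1) (τ 1) := by
  refine isPreconnected_univ.induction₂
    (fun s t => PosCrossing (σ s) (τ s) ↔ PosCrossing (σ t) (τ t)) (fun t _ => ?_)
    (fun _ _ _ _ _ _ h h' => h.trans h') (fun _ _ _ _ h => h.symm)
    (mem_univ (0 : unitInterval)) (mem_univ 1)
  rw [nhdsWithin_univ]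
  set e := chartAt (EuclideanHalfSpace 2) (σ t 0)
  have he : e ∈ atlas (EuclideanHalfSpace 2) S := chart_mem_atlas _ _
  have h0 : σ t 0 ∈ e.source := mem_chart_source _ _
  obtain ⟨r₀, hr₀, hc₀⟩ := eventually_inChart (x₀ := t) hσ hτ h0 ((h t).eq ▸ h0)
  have hr : 0 < min r₀ ρ := lt_min hr₀ (h t).pos
  have hc : ∀ᶠ x in 𝓝 t, InChart e (σ x) (τ x) (min r₀ ρ) :=
    hc₀.mono fun x hx => hx.mono (min_le_left _ _)
  have hl := LogEquiv.eventually (s := {x | InChart e (σ x) (τ x) (min r₀ ρ)})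
    (F := fun x => chordMap e (σ x) (τ x) (min r₀ ρ)) hc.self_of_nhds
    (continuousOn_chordMap hσ hτ (r := fun _ => min r₀ ρ) continuous_const (fun _ _ => hr.le)
      fun x hx => hx) ((h t).chordMap_ne hr (min_le_right _ _) hc.self_of_nhds)
  rw [nhdsWithin_eq_nhds.2 hc] at hl
  filter_upwards [hl, hc] with x hx hcx
  rw [posCrossing_iff he (h t) hr (min_le_right _ _) hc.self_of_nhds,
    posCrossing_iff he (h x) hr (min_le_right _ _) hcx]
  exact ⟨hx.symm.trans, hx.trans⟩

/-- On a small circle of radius `r`, `chordMap` is `r` times its linearization, up to an error small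
compared with the minimum of the linearization on the unit circle. -/
theorem exists_logEquiv_linear {e : OpenPartialHomeomorph S (EuclideanHalfSpace 2)} {σ τ : ℝ → S}
    {ρ : ℝ} (h : IsolatedCrossing σ τ ρ) (h1 : σ 0 ∈ e.source) {v w : EuclideanSpace ℝ (Fin 2)}
    (hv : HasDerivAt (fun u => e.extend (𝓡∂ 2) (σ u)) v 0)
    (hw : HasDerivAt (fun u => e.extend (𝓡∂ 2) (τ u)) w 0) (hvw : det₂ v w ≠ 0) :
    ∃ r, 0 < r ∧ r ≤ ρ ∧ InChart e σ τ r ∧ LogEquiv (fun z : Circle =>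
      ((z : ℂ).re * planeToComplex v + (z : ℂ).im * planeToComplex (-w))) (chordMap e σ τ r) := by
  set l : Circle → ℂ := fun z => (z : ℂ).re * planeToComplex v + (z : ℂ).im * planeToComplex (-w)
    with hl
  have hlc : Continuous l := by
    refine ((Complex.continuous_ofReal.comp (Complex.continuous_re.comp
      continuous_coe_circle)).mul continuous_const).add ((Complex.continuous_ofReal.comp
      (Complex.continuous_im.comp continuous_coe_circle)).mul continuous_const)
  have hlne : ∀ z, l z ≠ 0 := by
    intro z h0
    have hre := congrArg Complex.re h0
    have him := congrArg Complex.im h0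
    simp [hl, planeToComplex_re, planeToComplex_im] at hre him
    have h3 : (z : ℂ).re * det₂ v w = 0 := by
      simp only [det₂]; linear_combination w 1 * hre - w 0 * him
    have h4 : (z : ℂ).im * det₂ v w = 0 := by
      simp only [det₂]; linear_combination v 1 * hre - v 0 * him
    exact Circle.coe_ne_zero z (Complex.ext (by simpa [hvw] using h3) (by simpa [hvw] using h4))
  -- The linear model is at least `c` in norm. Each curve contributes an error of at most `c / 4 *
  -- r`, and the total `c / 2 * r` stays below `c * r`.
  obtain ⟨c, hc, hcl⟩ := isCompact_univ.exists_forall_le' hlc.norm.continuousOn (a := 0)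
    fun z _ => norm_pos_iff.2 (hlne z)
  obtain ⟨r₁, hr₁, hc₁⟩ := exists_inChart h.left h.right h1 (h.eq ▸ h1)
  have hsmall : ∀ {σ' : ℝ → S} {v'}, HasDerivAt (fun u => e.extend (𝓡∂ 2) (σ' u)) v' 0 →
      ∃ δ > 0, ∀ u, |u| ≤ δ →
        ‖e.extend (𝓡∂ 2) (σ' u) - e.extend (𝓡∂ 2) (σ' 0) - u • v'‖ ≤ c / 4 * |u| := by
    intro σ' v' hd
    have h3 := (hasDerivAt_iff_isLittleO.1 hd).bound (c := c / 4) (by positivity)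
    obtain ⟨δ, hδ, hδ'⟩ := Metric.eventually_nhds_iff.1 h3
    refine ⟨δ / 2, by positivity, fun u hu => ?_⟩
    have := hδ' (show dist u 0 < δ by rw [Real.dist_eq, sub_zero]; linarith)
    simpa using this
  obtain ⟨δ₁, hδ₁, hn₁⟩ := hsmall hv
  obtain ⟨δ₂, hδ₂, hn₂⟩ := hsmall hw
  have hρ := h.pos
  set r := min (min ρ r₁) (min δ₁ δ₂) with hr
  have hr0 : 0 < r := by positivity
  have hrm : r ≤ min (min ρ r₁) (min δ₁ δ₂) := le_rfl
  simp only [le_min_iff] at hrm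
  obtain ⟨⟨k1, k2⟩, k3, k4⟩ := hrm
  refine ⟨r, hr0, k1, hc₁.mono k2, ?_⟩
  refine (LogEquiv.const_mul (a := (r : ℂ)) (by exact_mod_cast hr0.ne') l).trans
    (LogEquiv.of_near (continuous_const.mul hlc)
      (continuous_chordMap h.left h.right hr0.le (hc₁.mono k2)) fun z => ?_)
  have m1 := abs_mul_re_le hr0.le z
  have m2 := abs_mul_im_le hr0.le z
  have e1 : chordMap e σ τ r z - r * l z = planeToComplex
      ((e.extend (𝓡∂ 2) (σ (r * (z : ℂ).re)) - e.extend (𝓡∂ 2) (σ 0) - (r * (z : ℂ).re) • v) -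
      (e.extend (𝓡∂ 2) (τ (r * (z : ℂ).im)) - e.extend (𝓡∂ 2) (τ 0) - (r * (z : ℂ).im) • w)) := by
    rw [h.eq]
    simp only [chordMap, hl, map_sub, map_neg, map_smul, Complex.real_smul, Complex.ofReal_mul]
    ring
  have n1 := (hn₁ _ (m1.trans k3)).trans (mul_le_mul_of_nonneg_left m1 (by positivity))
  have n2 := (hn₂ _ (m2.trans k4)).trans (mul_le_mul_of_nonneg_left m2 (by positivity))
  rw [e1, LinearIsometryEquiv.norm_map, norm_mul, Complex.norm_real, Real.norm_eq_abs,
    abs_of_pos hr0]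
  refine ((norm_sub_le _ _).trans (add_le_add n1 n2)).trans_lt ?_
  have := hcl z (mem_univ z)
  nlinarith

/-- The linearization has columns `v` and `-w`, hence determinant `-det₂ v w`. A positive basis
therefore winds like `conj` and a negative one like the identity, and these two are inequivalent. -/
theorem posCrossing_iff_of_hasDerivAt [IsManifold (𝓡∂ 2) ∞ S] [OrientedAtlas S]
    {e : OpenPartialHomeomorph S (EuclideanHalfSpace 2)}
    (he : e ∈ atlas (EuclideanHalfSpace 2) S) {σ τ : ℝ → S}
    {ρ : ℝ} (h : IsolatedCrossing σ τ ρ) (h1 : σ 0 ∈ e.source) {v w : EuclideanSpace ℝ (Fin 2)}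
    (hv : HasDerivAt (fun u => e.extend (𝓡∂ 2) (σ u)) v 0)
    (hw : HasDerivAt (fun u => e.extend (𝓡∂ 2) (τ u)) w 0) (hvw : det₂ v w ≠ 0) :
    PosCrossing σ τ ↔ 0 < det₂ v w := by
  obtain ⟨r, hr, hrρ, hc, hl⟩ := exists_logEquiv_linear h h1 hv hw hvw
  rw [posCrossing_iff he h hr hrρ hc]
  have hne : ∀ z : Circle, (z : ℂ) ≠ 0 := Circle.coe_ne_zero
  constructor
  · intro hp
    by_contra hn
    have h3 : det₂ v w < 0 := lt_of_le_of_ne (not_lt.1 hn) hvw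
    refine LogEquiv.not_id_conj (LogEquiv.trans ?_ (hl.trans hp))
    refine LogEquiv.linear continuous_coe_circle hne ?_
    simp only [planeToComplex_re, planeToComplex_im, PiLp.neg_apply]
    simp only [det₂] at h3
    linarith
  · intro hp
    refine hl.symm.trans (LogEquiv.symm ?_)
    have := LogEquiv.linear (f := fun z : Circle => conj (z : ℂ))
      (Complex.continuous_conj.comp continuous_coe_circle) (fun z => by simp)
      (p := planeToComplex v) (q := planeToComplex w) (by
        simp only [planeToComplex_re, planeToComplex_im]
        simp only [det₂] at hp
        linarith)
    simpa only [Complex.conj_re, Complex.conj_im, Complex.ofReal_neg, map_neg, mul_neg,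
      neg_mul] using this

theorem hasDerivAt_velocity {γ : ℝ → S} (h : ContMDiffAt 𝓘(ℝ, ℝ) (𝓡∂ 2) ∞ γ 0) :
    HasDerivAt (fun u => (chartAt (EuclideanHalfSpace 2) (γ 0)).extend (𝓡∂ 2) (γ u))
      (velocity γ) 0 := by
  have h1 := (h.mdifferentiableAt (by simp)).hasMFDerivAt.2
  simp only [writtenInExtChartAt, extChartAt_model_space_eq_id, PartialEquiv.refl_coe, range_id,
    modelWithCornersSelf_coe, PartialEquiv.refl_symm, Function.comp_id, id] at h1
  have key : ∀ A : ℝ →L[ℝ] EuclideanSpace ℝ (Fin 2),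
      HasFDerivWithinAt (fun u => (chartAt (EuclideanHalfSpace 2) (γ 0)).extend (𝓡∂ 2) (γ u))
        A univ 0 →
      HasDerivAt (fun u => (chartAt (EuclideanHalfSpace 2) (γ 0)).extend (𝓡∂ 2) (γ u)) (A 1) 0 :=
    fun A hA => (hasFDerivWithinAt_univ.1 hA).hasDerivAt
  exact key _ h1

end CrossingSign

end Winding

/-! ### Isotopy invariance of crossings and their signs -/

section CrossingInvariance

open Filter Topology

variable {S : Type*} [TopologicalSpace S] [ChartedSpace (EuclideanHalfSpace 2) S]

theorem GenericLoop.continuous_curve (α : GenericLoop S) (a : Circ) :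
    Continuous fun u : ℝ => α.toFun (a + u) :=
  α.continuous.comp (continuous_const.add (AddCircle.continuous_mk' 1))

/-- Near `(a, b)` the two parameters remain distinct, so any coincidence is one of finitely many
double points and must be `(a, b)` itself. The bound `1 / 2` makes `0` the only small time
representing `0` on the circle. -/
theorem GenericLoop.exists_isolatedCrossing (α : GenericLoop S) {a b : Circ} (hne : a ≠ b)
    (hab : α.toFun a = α.toFun b) :
    ∃ ρ, IsolatedCrossing (fun u : ℝ => α.toFun (a + u)) (fun u : ℝ => α.toFun (b + u)) ρ := by
  set N := {p : Circ × Circ | p.1 ≠ p.2 ∧ α.toFun p.1 = α.toFun p.2}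
  have hc : Continuous fun p : ℝ × ℝ => ((a + (p.1 : Circ), b + (p.2 : Circ)) : Circ × Circ) :=
    (continuous_const.add ((AddCircle.continuous_mk' 1).comp continuous_fst)).prodMk
      (continuous_const.add ((AddCircle.continuous_mk' 1).comp continuous_snd))
  have h1 : ∀ᶠ p in 𝓝 ((a, b) : Circ × Circ), p ∉ N \ {(a, b)} :=
    (α.finite_crossings.subset sdiff_subset).isClosed.isOpen_compl.mem_nhds (by simp)
  have h2 : ∀ᶠ p in 𝓝 ((a, b) : Circ × Circ), p.1 ≠ p.2 :=
    (isOpen_ne_fun continuous_fst continuous_snd).mem_nhds hne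
  have h3 : Tendsto (fun p : ℝ × ℝ => ((a + (p.1 : Circ), b + (p.2 : Circ)) : Circ × Circ))
      (𝓝 (0, 0)) (𝓝 (a, b)) := by
    have := hc.tendsto (0, 0)
    simpa using this
  obtain ⟨δ, hδ, hball⟩ := Metric.eventually_nhds_iff.1 (h3.eventually (h1.and h2))
  refine ⟨min (δ / 2) (1 / 2), α.continuous_curve a, α.continuous_curve b, by positivity,
    by simpa using hab, fun u v hu hv huv => ?_⟩
  rw [le_min_iff] at hu hv
  have hd : dist ((u, v) : ℝ × ℝ) (0, 0) < δ := by
    rw [Prod.dist_eq, max_lt_iff, Real.dist_eq, Real.dist_eq, sub_zero, sub_zero]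
    exact ⟨by linarith, by linarith⟩
  obtain ⟨k1, k2⟩ := hball hd
  have k3 : ((a + (u : Circ), b + (v : Circ)) : Circ × Circ) = (a, b) := by
    by_contra hcon
    exact k1 ⟨⟨k2, huv⟩, hcon⟩
  rw [Prod.mk.injEq, add_eq_left, add_eq_left] at k3
  have key : ∀ w : ℝ, (w : Circ) = 0 → |w| ≤ 1 / 2 → w = 0 := by
    intro w hw hw2
    obtain ⟨n, hn⟩ := exists_int_of_coe_eq (s := 0) (t := w) (by rw [hw]; rfl)
    rw [zero_add] at hn
    subst hn
    have h4 : (|n| : ℤ) < 1 := by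
      have : ((|n| : ℤ) : ℝ) < 1 := by push_cast; linarith
      exact_mod_cast this
    rw [Int.abs_lt_one_iff.1 h4]; simp
  exact ⟨key u k3.1 hu.2, key v k3.2 hv.2⟩

variable [IsManifold (𝓡∂ 2) ∞ S] [OrientedAtlas S]

/-- Replaces the tangent vectors, which a homeomorphism does not transport, by a topological
condition. -/
theorem GenericLoop.mem_crossings_iff (α : GenericLoop S) (p : Circ × Circ) :
    p ∈ α.crossings ↔ p.1 ≠ p.2 ∧ α.toFun p.1 = α.toFun p.2 ∧
      PosCrossing (fun u : ℝ => α.toFun (p.1 + u)) (fun u : ℝ => α.toFun (p.2 + u)) := by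
  refine and_congr_right fun h1 => and_congr_right fun h2 => Iff.symm ?_
  obtain ⟨ρ, hρ⟩ := α.exists_isolatedCrossing h1 h2
  have hv := hasDerivAt_velocity (α.smooth_at_crossing _ _ h1 h2)
  have hw := hasDerivAt_velocity (α.smooth_at_crossing _ _ h1.symm h2.symm)
  have e1 : (p.1 : Circ) + ((0 : ℝ) : Circ) = p.1 := by simp
  have e2 : (p.2 : Circ) + ((0 : ℝ) : Circ) = p.2 := by simp
  rw [e1] at hv
  rw [e2, ← h2] at hw
  refine posCrossing_iff_of_hasDerivAt (chart_mem_atlas _ (α.toFun p.1)) hρ ?_ hv hw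
    (α.transverse _ _ h1 h2)
  rw [e1]; exact mem_chart_source _ _

/-- The crossing of `α` is joined to that of `β` by a continuous family of uniformly isolated
crossings, which deforms the surface by `h t` and the parameter by `φ` simultaneously. -/
theorem mem_crossings_of_isotopy {α β : GenericLoop S} (f : Circ ≃ₜ Circ) (hf : CycMono f)
    (h : unitInterval → S ≃ₜ S) (hc : Continuous (fun p : unitInterval × S => h p.1 p.2))
    (h0 : h 0 = Homeomorph.refl S) (hβ : ∀ x, β.toFun x = h 1 (α.toFun (f x))) (p : Circ × Circ) :
    p ∈ β.crossings ↔ (f p.1, f p.2) ∈ α.crossings := by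
  rw [β.mem_crossings_iff, α.mem_crossings_iff]
  refine and_congr f.injective.ne_iff.symm ?_
  -- If the parameters coincide, both sides are false: a curve meets itself at every time, so no
  -- crossing is isolated.
  by_cases hne : p.1 = p.2
  · have hn : ∀ {γ : GenericLoop S} {a : Circ}, ¬ PosCrossing (fun u : ℝ => γ.toFun (a + u))
        (fun u : ℝ => γ.toFun (a + u)) := by
      rintro γ a ⟨-, -, ρ, r, hρ, -⟩
      have h1 := (hρ.isolated ρ ρ (abs_of_pos hρ.pos).le (abs_of_pos hρ.pos).le rfl).1
      exact hρ.pos.ne' h1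
    rw [hne]
    exact ⟨fun h => absurd h.2 hn, fun h => absurd h.2 hn⟩
  rw [show β.toFun p.1 = β.toFun p.2 ↔ α.toFun (f p.1) = α.toFun (f p.2) by
    rw [hβ, hβ]; exact (h 1).injective.eq_iff]
  refine and_congr_right fun h1 => ?_
  obtain ⟨F, hFm, hF⟩ := hf.exists_lift
  have hFs : Function.Surjective F := fun y => by
    obtain ⟨x, hx⟩ := f.surjective (y : Circ)
    obtain ⟨t, rfl⟩ := QuotientAddGroup.mk_surjective x
    obtain ⟨n, hn⟩ := exists_int_of_coe_eq ((hF t).symm.trans hx)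
    exact ⟨t + n, by rw [F.map_add_int, hn]⟩
  have hFc := F.continuous_iff_surjective.2 hFs
  obtain ⟨ρ, hρ⟩ := α.exists_isolatedCrossing (f.injective.ne hne) h1
  have hθ : ∀ c : ℝ, ∃ δ > 0, ∀ u, |u| ≤ δ → |F (c + u) - F c| ≤ ρ := by
    intro c
    have hcont : Continuous fun u => F (c + u) := hFc.comp (by fun_prop)
    have := hcont.continuousAt.eventually (Metric.ball_mem_nhds (F (c + 0)) hρ.pos)
    obtain ⟨δ, hδ, hδ'⟩ := Metric.eventually_nhds_iff.1 this
    refine ⟨δ / 2, by positivity, fun u hu => ?_⟩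
    have := hδ' (show dist u 0 < δ by rw [Real.dist_eq, sub_zero]; linarith)
    rw [Real.dist_eq, add_zero] at this
    exact this.le
  obtain ⟨a, ha⟩ := QuotientAddGroup.mk_surjective p.1
  obtain ⟨b, hb⟩ := QuotientAddGroup.mk_surjective p.2
  change (a : Circ) = p.1 at ha
  change (b : Circ) = p.2 at hb
  obtain ⟨δ₁, hδ₁, hd₁⟩ := hθ a
  obtain ⟨δ₂, hδ₂, hd₂⟩ := hθ b
  -- This interpolates between uniform time and the time change by `f`. Both terms have the sign of
  -- `u`, as `F` is strictly increasing, so it vanishes only at `u = 0` and the crossing stays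
  -- isolated for every `t`.
  let φ : ℝ → unitInterval → ℝ → ℝ := fun c t u => (1 - t) * u + t * (F (c + u) - F c)
  have hφc : ∀ c, Continuous fun p : unitInterval × ℝ => φ c p.1 p.2 := fun c => by
    have : Continuous fun p : unitInterval × ℝ => F (c + p.2) := hFc.comp (by fun_prop)
    fun_prop
  let σ : ℝ → unitInterval → ℝ → S := fun c t u => h t (α.toFun (f (c : Circ) + (φ c t u : Circ)))
  have hσc : ∀ c, Continuous fun p : unitInterval × ℝ => σ c p.1 p.2 := fun c =>
    hc.comp (continuous_fst.prodMk (α.continuous.comp (continuous_const.add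
      ((AddCircle.continuous_mk' 1).comp (hφc c)))))
  have hφle : ∀ c δ, (∀ u, |u| ≤ δ → |F (c + u) - F c| ≤ ρ) → ∀ t u, |u| ≤ min ρ δ →
      |φ c t u| ≤ ρ := by
    intro c δ hd t u hu
    rw [le_min_iff] at hu
    have e1 := abs_le.1 (hd u hu.2)
    have e2 := abs_le.1 hu.1
    have t0 := t.2.1
    have t1 := t.2.2
    rw [abs_le]
    constructor <;> simp only [φ] <;> nlinarith
  have hφ0 : ∀ c t u, φ c t u = 0 → u = 0 := by
    intro c t u hu
    have t0 := t.2.1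
    have t1 := t.2.2
    rcases lt_trichotomy u 0 with hlt | h' | hlt
    · have := hFm (show c + u < c by linarith)
      simp only [φ] at hu
      rcases t0.eq_or_lt with h3 | h3
      · rw [← h3] at hu; linarith
      · nlinarith
    · exact h'
    · have := hFm (show c < c + u by linarith)
      simp only [φ] at hu
      rcases t0.eq_or_lt with h3 | h3
      · rw [← h3] at hu; linarith
      · nlinarith
  have hφz : ∀ c t, φ c t 0 = 0 := fun c t => by simp [φ]
  have hfam := posCrossing_family (σ := σ a) (τ := σ b) (ρ := min (min ρ δ₁) (min ρ δ₂))
    (hσc a) (hσc b) fun t => by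
      refine ⟨(hσc a).comp (continuous_const.prodMk continuous_id),
        (hσc b).comp (continuous_const.prodMk continuous_id), ?_, ?_, fun u v hu hv huv => ?_⟩
      · have := hρ.pos; positivity
      · simp only [σ, hφz, AddCircle.coe_zero, add_zero, ha, hb, h1]
      · simp only [σ, ha, hb, (h t).injective.eq_iff] at huv
        obtain ⟨k1, k2⟩ := hρ.isolated _ _ (hφle a δ₁ hd₁ t u (hu.trans (min_le_left _ _)))
          (hφle b δ₂ hd₂ t v (hv.trans (min_le_right _ _))) huv
        exact ⟨hφ0 _ _ _ k1, hφ0 _ _ _ k2⟩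
  have e0 : ∀ c, σ c 0 = fun u : ℝ => α.toFun (f (c : Circ) + u) := fun c => by
    funext u
    simp [σ, φ, h0]
  have e1 : ∀ c, σ c 1 = fun u : ℝ => β.toFun ((c : Circ) + u) := fun c => by
    funext u
    rw [hβ, ← AddCircle.coe_add, hF]
    simp only [σ, φ]
    rw [hF, ← AddCircle.coe_add]
    congr 4
    simp
  rw [e0, e0, e1, e1, ha, hb] at hfam
  exact hfam.symm

end CrossingInvariance

/-! ### The co-Jacobi identity from pairs of diverging edges -/

section AbstractCobracket

variable {R A V : Type*} [CommRing R] [AddCommGroup A] [Module R A] [Fintype V]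

theorem cyclicShift_tmul (x y z : A) :
    cyclicShift R A (x ⊗ₜ[R] (y ⊗ₜ[R] z)) = z ⊗ₜ[R] (x ⊗ₜ[R] y) := by
  simp [cyclicShift]

theorem cyclicShift_cube (w : A ⊗[R] (A ⊗[R] A)) :
    cyclicShift R A (cyclicShift R A (cyclicShift R A w)) = w := by
  have : cyclicShift R A ∘ₗ cyclicShift R A ∘ₗ cyclicShift R A = LinearMap.id :=
    TensorProduct.ext (LinearMap.ext fun x => TensorProduct.ext (LinearMap.ext fun y =>
      LinearMap.ext fun z => by simp [cyclicShift_tmul]))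
  exact LinearMap.congr_fun this w

theorem comm_sum_eq_neg (ε : V → V → R) (hε : ∀ u v, ε v u = -ε u v) (X : V → V → A) :
    TensorProduct.comm R A A (∑ u, ∑ v, ε u v • (X u v ⊗ₜ[R] X v u)) =
      -∑ u, ∑ v, ε u v • (X u v ⊗ₜ[R] X v u) := by
  simp only [map_sum, map_smul, TensorProduct.comm_tmul]
  rw [Finset.sum_comm, ← Finset.sum_neg_distrib]
  refine Finset.sum_congr rfl fun u _ => ?_
  rw [← Finset.sum_neg_distrib]
  refine Finset.sum_congr rfl fun v _ => ?_
  rw [hε, neg_smul]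

-- `X u v` stands for the branch beyond the edge `uv`, `M` for the piece between two edges, and `P`
-- for edges leading away from each other. The symmetry of `M` and `P` under exchanging the two
-- edges turns the iterated cobracket into `a - τ² a`.
open Classical in
theorem jacobi_of_branches (ν : A →ₗ[R] A ⊗[R] A) (ε : V → V → R) (X : V → V → A)
    (M : V → V → V → V → A) (P : V → V → V → V → Prop) (hP : ∀ u v x y, P u v x y ↔ P x y u v)
    (hM : ∀ u v x y, M u v x y = M x y u v)
    (hν : ∀ u v, ε u v = 0 ∨ ν (X v u) = ∑ x, ∑ y, if P u v x y then
      ε x y • (X x y ⊗ₜ[R] M u v x y - M u v x y ⊗ₜ[R] X x y) else 0) :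
    (LinearMap.id + cyclicShift R A + cyclicShift R A ∘ₗ cyclicShift R A :
        A ⊗[R] (A ⊗[R] A) →ₗ[R] A ⊗[R] (A ⊗[R] A))
      (TensorProduct.map LinearMap.id ν (∑ u, ∑ v, ε u v • (X u v ⊗ₜ[R] X v u))) = 0 := by
  set a : A ⊗[R] (A ⊗[R] A) := ∑ u, ∑ v, ∑ x, ∑ y, if P u v x y then (ε u v * ε x y) •
    (X u v ⊗ₜ[R] (X x y ⊗ₜ[R] M u v x y)) else 0 with ha
  set b : A ⊗[R] (A ⊗[R] A) := ∑ u, ∑ v, ∑ x, ∑ y, if P u v x y then (ε u v * ε x y) •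
    (X u v ⊗ₜ[R] (M u v x y ⊗ₜ[R] X x y)) else 0 with hb
  have h1 : TensorProduct.map LinearMap.id ν (∑ u, ∑ v, ε u v • (X u v ⊗ₜ[R] X v u)) = a - b := by
    simp only [ha, hb, ← Finset.sum_sub_distrib, map_sum, map_smul, TensorProduct.map_tmul,
      LinearMap.id_apply]
    refine Finset.sum_congr rfl fun u _ => Finset.sum_congr rfl fun v _ => ?_
    rcases hν u v with h | h
    · simp [h]
    · rw [h]
      simp only [TensorProduct.tmul_sum, Finset.smul_sum]
      refine Finset.sum_congr rfl fun x _ => Finset.sum_congr rfl fun y _ => ?_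
      split_ifs
      · rw [TensorProduct.tmul_smul, smul_smul, TensorProduct.tmul_sub, smul_sub]
      · simp
  have h2 : cyclicShift R A (cyclicShift R A a) = b := by
    -- `τ²` moves the first factor to the end, giving `X x y ⊗ M ⊗ X u v`; exchanging the names of
    -- the two edges yields `b`.
    simp only [ha, hb, map_sum, apply_ite (cyclicShift R A), map_smul, map_zero, cyclicShift_tmul]
    have hcomm : ∀ F : V → V → V → V → A ⊗[R] (A ⊗[R] A),
        ∑ u, ∑ v, ∑ x, ∑ y, F u v x y = ∑ x, ∑ y, ∑ u, ∑ v, F u v x y := by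
      intro F
      have e1 := Finset.sum_comm (s := (Finset.univ : Finset (V × V)))
        (t := (Finset.univ : Finset (V × V))) (f := fun p q => F p.1 p.2 q.1 q.2)
      simpa only [Fintype.sum_prod_type] using e1
    rw [hcomm]
    refine Finset.sum_congr rfl fun x _ => Finset.sum_congr rfl fun y _ =>
      Finset.sum_congr rfl fun u _ => Finset.sum_congr rfl fun v _ => ?_
    rw [hM u v x y, mul_comm]
    exact if_congr (hP u v x y) rfl rfl
  rw [h1, ← h2]
  simp only [LinearMap.comp_apply, LinearMap.add_apply, LinearMap.id_apply, map_sub,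
    cyclicShift_cube]
  abel

end AbstractCobracket

/-! ### Branches of plane trees and the tree cobracket -/

namespace PlaneTree

variable {L : Type*}

noncomputable instance instFintypeV (T : PlaneTree L) : Fintype T.V :=
  have := T.finite
  Fintype.ofFinite _

theorem graph_adj (T : PlaneTree L) {u v : T.V} : T.graph.Adj u v ↔ T.dir u v ∨ T.dir v u := by
  rw [graph, SimpleGraph.fromRel_adj, and_iff_right_iff_imp]
  rintro h rfl
  have := T.dir_asymm u u
  tauto

section Branches

variable (T : PlaneTree L)

theorem branch_comm (u v w : T.V) : T.branch u v w = T.branch v u w := by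
  rw [branch, branch, Sym2.eq_swap]

theorem self_mem_branch (u v w : T.V) : w ∈ T.branch u v w := SimpleGraph.Reachable.refl _

theorem map_mem_branch {T T' : PlaneTree L} {φ : T.V → T'.V} (hφ : Function.Injective φ)
    (hadj : ∀ u v, T.graph.Adj u v → T'.graph.Adj (φ u) (φ v)) {u v w x : T.V}
    (h : x ∈ T.branch u v w) : φ x ∈ T'.branch (φ u) (φ v) (φ w) := by
  let f : T.graph.deleteEdges {s(u, v)} →g T'.graph.deleteEdges {s(φ u, φ v)} :=
    ⟨φ, fun {a b} hab => by
      rw [SimpleGraph.deleteEdges_adj] at hab ⊢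
      refine ⟨hadj _ _ hab.1, fun he => hab.2 ?_⟩
      rw [mem_singleton_iff] at he ⊢
      rw [← Sym2.map_mk, ← Sym2.map_mk] at he
      exact Sym2.map.injective hφ he⟩
  exact SimpleGraph.Reachable.map f h

theorem mem_branch_or {u v : T.V} (x : T.V) : x ∈ T.branch u v u ∨ x ∈ T.branch u v v := by
  have h := T.isTree.connected.preconnected u x
  rw [SimpleGraph.reachable_iff_reflTransGen] at h
  induction h with
  | refl => exact Or.inl (T.self_mem_branch u v u)
  | @tail y z _ hyz ih =>
    by_cases he : s(y, z) = s(u, v)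
    · rw [Sym2.eq_iff] at he
      rcases he with ⟨-, rfl⟩ | ⟨-, rfl⟩
      · exact Or.inr (T.self_mem_branch _ _ _)
      · exact Or.inl (T.self_mem_branch _ _ _)
    · have : (T.graph.deleteEdges {s(u, v)}).Adj y z :=
        SimpleGraph.deleteEdges_adj.2 ⟨hyz, he⟩
      exact ih.imp (fun h => h.trans this.reachable) fun h => h.trans this.reachable

theorem not_mem_branch_of_mem {u v x : T.V} (h : T.graph.Adj u v) (hx : x ∈ T.branch u v u) :
    x ∉ T.branch u v v := by
  intro hx'
  have := (SimpleGraph.isAcyclic_iff_forall_adj_isBridge.1 T.isTree.isAcyclic) h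
  rw [SimpleGraph.isBridge_iff] at this
  exact this (hx.trans hx'.symm)

theorem mem_branch_iff_of_adj {u v w x y : T.V} (h : T.graph.Adj x y) (hne : s(x, y) ≠ s(u, v)) :
    x ∈ T.branch u v w ↔ y ∈ T.branch u v w := by
  have : (T.graph.deleteEdges {s(u, v)}).Adj x y := SimpleGraph.deleteEdges_adj.2 ⟨h, hne⟩
  exact ⟨fun h => h.trans this.reachable, fun h => h.trans this.symm.reachable⟩

theorem iff_of_mem_branch {u v w x : T.V} {P : T.V → Prop}
    (hP : ∀ a b, T.graph.Adj a b → s(a, b) ≠ s(u, v) → (P a ↔ P b)) (hx : x ∈ T.branch u v w) :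
    P x ↔ P w := by
  change (T.graph.deleteEdges {s(u, v)}).Reachable w x at hx
  rw [SimpleGraph.reachable_iff_reflTransGen] at hx
  induction hx with
  | refl => exact Iff.rfl
  | tail _ hab ih =>
    rw [SimpleGraph.deleteEdges_adj] at hab
    exact (hP _ _ hab.1 hab.2).symm.trans ih

/-- The branch beyond `xy` seen from `u` is contained in a branch at `u` that contains `y`. -/
theorem branch_subset_branch {u v x y : T.V} (h : T.graph.Adj x y) (hu : u ∈ T.branch y x x)
    (hy : y ∈ T.branch v u u) : T.branch x y y ⊆ T.branch v u u := by
  intro z hz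
  change (T.graph.deleteEdges {s(x, y)}).Reachable y z at hz
  rw [SimpleGraph.reachable_iff_reflTransGen] at hz
  induction hz with
  | refl => exact hy
  | @tail a b ha hab ih =>
    have ha' : a ∈ T.branch x y y := (SimpleGraph.reachable_iff_reflTransGen _ _).2 ha
    have hb' : b ∈ T.branch x y y := ha'.trans hab.reachable
    have hab' := (SimpleGraph.deleteEdges_adj.1 hab).1
    -- The vertex `u` is not beyond `xy`, so a walk inside that branch never uses the edge `uv`.
    have hne : ∀ {c}, c ∈ T.branch x y y → c ≠ u := by
      rintro c hc rfl
      rw [T.branch_comm] at hu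
      exact T.not_mem_branch_of_mem h hu hc
    refine (T.mem_branch_iff_of_adj hab' fun he => ?_).1 ih
    rw [Sym2.eq_iff] at he
    rcases he with ⟨-, rfl⟩ | ⟨rfl, -⟩
    · exact hne hb' rfl
    · exact hne ha' rfl

theorem restrict_graph {s : Set T.V} (hs : (T.graph.induce s).Connected) :
    (T.restrict s hs).graph = T.graph.induce s := T.fromRel_restrict s

/-- Deleting an edge splits both the subtree and the whole tree in two. The inclusion of each half
of the subtree in the matching half of `T` therefore already forces equality. -/
theorem image_branch_restrict {s : Set T.V} (hs : (T.graph.induce s).Connected) {x y : s}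
    (h : T.graph.Adj x y) :
    Subtype.val '' ((T.restrict s hs).branch x y y) = s ∩ T.branch x y y := by
  have key : ∀ {w z : s}, z ∈ (T.restrict s hs).branch x y w → (z : T.V) ∈ T.branch x y w :=
    fun {w z} hz => map_mem_branch (T := T.restrict s hs) (T' := T) (φ := Subtype.val)
      Subtype.val_injective (fun u v huv => by rw [restrict_graph] at huv; exact huv) hz
  apply Subset.antisymm
  · rintro _ ⟨z, hz, rfl⟩
    exact ⟨z.2, key hz⟩
  · rintro z ⟨hzs, hz⟩
    refine ⟨⟨z, hzs⟩, ?_, rfl⟩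
    refine ((T.restrict s hs).mem_branch_or (u := x) (v := y) ⟨z, hzs⟩).resolve_left fun hx => ?_
    exact T.not_mem_branch_of_mem h (key hx) hz

end Branches

section Gen

variable (R : Type*) [CommRing R]

theorem gen_eq_of_homeomorphic {T T' : PlaneTree L} (h : Homeomorphic T T') :
    T.gen R = T'.gen R := by
  rw [gen, gen, Quotient.sound (s := PlaneTree.setoid L) h]

open Classical in
/-- The generator given by the subtree of `T` with vertex set `s`. -/
noncomputable def genOn (T : PlaneTree L) (s : Set T.V) : TreeModule R L :=
  if h : (T.graph.induce s).Connected then (T.restrict s h).gen R else 0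

theorem genOn_of_connected (T : PlaneTree L) {s : Set T.V} (h : (T.graph.induce s).Connected) :
    T.genOn R s = (T.restrict s h).gen R := dif_pos h

theorem genOn_congr {T T' : PlaneTree L} {s : Set T.V} {s' : Set T'.V} (φ : s ≃ s')
    (h1 : ∀ u v, T'.dir (φ u) (φ v) ↔ T.dir u v) (h2 : ∀ v, T'.label (φ v) = T.label v)
    (h3 : ∀ v a b c, T'.cyc (φ v) (φ a) (φ b) (φ c) ↔ T.cyc v a b c) :
    T.genOn R s = T'.genOn R s' := by
  let i : T.graph.induce s ≃g T'.graph.induce s' := ⟨φ, fun {a b} => by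
    simp only [SimpleGraph.induce, SimpleGraph.comap_adj, Function.Embedding.subtype_apply,
      graph_adj, h1]⟩
  by_cases h : (T.graph.induce s).Connected
  · rw [genOn_of_connected R T h, genOn_of_connected R T' (i.connected_iff.1 h)]
    exact gen_eq_of_homeomorphic R ⟨φ, h1, h2, h3⟩
  · rw [genOn, dif_neg h, genOn, dif_neg fun h' => h (i.connected_iff.2 h')]

theorem gen_eq_genOn_univ (T : PlaneTree L) : T.gen R = T.genOn R univ := by
  have i : T.graph.induce univ ≃g T.graph := SimpleGraph.induceUnivIso T.graph
  rw [genOn_of_connected R T (i.connected_iff.2 T.isTree.connected)]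
  exact gen_eq_of_homeomorphic R ⟨(Equiv.Set.univ T.V).symm, fun _ _ => Iff.rfl, fun _ => rfl,
    fun _ _ _ _ => Iff.rfl⟩

theorem genOn_eq_gen {T T' : PlaneTree L} {s : Set T.V} (φ : s ≃ T'.V)
    (h1 : ∀ u v, T'.dir (φ u) (φ v) ↔ T.dir u v) (h2 : ∀ v, T'.label (φ v) = T.label v)
    (h3 : ∀ v a b c, T'.cyc (φ v) (φ a) (φ b) (φ c) ↔ T.cyc v a b c) :
    T.genOn R s = T'.gen R := by
  rw [gen_eq_genOn_univ]
  exact genOn_congr R (φ.trans (Equiv.Set.univ T'.V).symm) h1 h2 h3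

theorem genOn_restrict (T : PlaneTree L) {s : Set T.V} (hs : (T.graph.induce s).Connected)
    (t : Set s) : (T.restrict s hs).genOn R t = T.genOn R (Subtype.val '' t) :=
  genOn_congr R (T := T.restrict s hs) (Equiv.Set.image Subtype.val t Subtype.val_injective)
    (fun _ _ => Iff.rfl) (fun _ => rfl) fun _ _ _ _ => Iff.rfl

theorem genOn_image {T T' : PlaneTree L} (φ : T.V ≃ T'.V)
    (h1 : ∀ u v, T'.dir (φ u) (φ v) ↔ T.dir u v) (h2 : ∀ v, T'.label (φ v) = T.label v)
    (h3 : ∀ v a b c, T'.cyc (φ v) (φ a) (φ b) (φ c) ↔ T.cyc v a b c) (s : Set T.V) :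
    T.genOn R s = T'.genOn R (φ '' s) :=
  genOn_congr R (φ.image s) (fun _ _ => h1 _ _) (fun _ => h2 _) fun _ _ _ _ => h3 _ _ _ _

end Gen

section TensorSums

variable {R M N ι : Type*} [CommRing R] [AddCommGroup M] [Module R M] [AddCommGroup N] [Module R N]

theorem tensor_neg_smul (c : R) (x : M ⊗[R] N) : (-c) • x = -(c • x) := neg_smul c x

theorem tensor_smul_sub (c : R) (x y : M ⊗[R] N) : c • (x - y) = c • x - c • y := smul_sub c x y

theorem tensor_sub_smul (c d : R) (x : M ⊗[R] N) : (c - d) • x = c • x - d • x := sub_smul c d x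

theorem tensor_sum_sub (s : Finset ι) (f g : ι → M ⊗[R] N) :
    ∑ i ∈ s, (f i - g i) = ∑ i ∈ s, f i - ∑ i ∈ s, g i := Finset.sum_sub_distrib f g

theorem tensor_sub_eq_add_neg (x y : M ⊗[R] N) : x - y = x + -y := sub_eq_add_neg x y

end TensorSums

section Cobracket

variable (R : Type*) [CommRing R]

open Classical in
/-- `1` for the edges from `u` to `v`, `-1` for the edges from `v` to `u`. -/
noncomputable def edgeSign (T : PlaneTree L) (u v : T.V) : R :=
  (if T.dir u v then 1 else 0) - if T.dir v u then 1 else 0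

theorem edgeSign_swap (T : PlaneTree L) (u v : T.V) : T.edgeSign R v u = -T.edgeSign R u v := by
  rw [edgeSign, edgeSign, neg_sub]

theorem edgeSign_eq_zero (T : PlaneTree L) {u v : T.V} (h : ¬ T.graph.Adj u v) :
    T.edgeSign R u v = 0 := by
  rw [graph_adj, not_or] at h
  rw [edgeSign, if_neg h.1, if_neg h.2, sub_zero]

/-- The branch of `v` behind the edge `uv`. -/
noncomputable def branchGen (T : PlaneTree L) (u v : T.V) : TreeModule R L :=
  T.genOn R (T.branch u v v)

/-- The antisymmetric coefficient gathers both terms of an edge and vanishes off the edges. Sums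
over all pairs of vertices can then be split and reordered freely. -/
theorem cobracket_eq_sum (T : PlaneTree L) : T.cobracket R =
    ∑ u, ∑ v, T.edgeSign R u v • (T.branchGen R u v ⊗ₜ[R] T.branchGen R v u) := by
  classical
  let F : T.V × T.V → TreeModule R L ⊗[R] TreeModule R L := fun p =>
    T.branchGen R p.1 p.2 ⊗ₜ[R] T.branchGen R p.2 p.1
  have h1 : T.cobracket R = ∑ e : T.Edge, (F e.1 - F e.1.swap) := by
    refine Finset.sum_congr rfl fun e _ => ?_
    have e1 : (T.headTree e).gen R = T.branchGen R e.1.1 e.1.2 :=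
      (genOn_of_connected R T (T.branch_connected _ _ _)).symm
    have e2 : (T.tailTree e).gen R = T.branchGen R e.1.2 e.1.1 := by
      rw [branchGen, branch_comm]
      exact (genOn_of_connected R T (T.branch_connected _ _ _)).symm
    rw [e1, e2]
    rfl
  have h2 : ∑ e : T.Edge, (F e.1 - F e.1.swap) =
      ∑ p : T.V × T.V, if T.dir p.1 p.2 then F p - F p.swap else 0 := by
    rw [← Finset.sum_filter]
    exact (Finset.sum_subtype (p := fun p : T.V × T.V => T.dir p.1 p.2)
      (Finset.univ.filter fun p : T.V × T.V => T.dir p.1 p.2) (by simp) fun p => F p - F p.swap).symm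
  have h3 : ∑ p : T.V × T.V, (if T.dir p.1 p.2 then F p.swap else 0) =
      ∑ p : T.V × T.V, if T.dir p.2 p.1 then F p else 0 :=
    Fintype.sum_equiv (Equiv.prodComm _ _) _ _ fun p => rfl
  rw [h1, h2, ← Fintype.sum_prod_type']
  calc _ = ∑ p : T.V × T.V, ((if T.dir p.1 p.2 then F p else 0) -
        if T.dir p.1 p.2 then F p.swap else 0) := by
        refine Finset.sum_congr rfl fun p _ => ?_
        split_ifs <;> simp
    _ = _ := by
        rw [tensor_sum_sub, h3, ← tensor_sum_sub]
        refine Finset.sum_congr rfl fun p _ => ?_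
        rw [edgeSign, tensor_sub_smul, ite_smul, ite_smul]
        simp [F]

theorem cobracket_eq_of_homeomorphic {T T' : PlaneTree L} (h : Homeomorphic T T') :
    T.cobracket R = T'.cobracket R := by
  classical
  obtain ⟨φ, h1, h2, h3⟩ := h
  have hb : ∀ u v, T.branchGen R u v = T'.branchGen R (φ u) (φ v) := by
    intro u v
    rw [branchGen, branchGen, genOn_image R φ h1 h2 h3]
    congr 1
    apply Subset.antisymm
    · rintro _ ⟨x, hx, rfl⟩
      exact map_mem_branch φ.injective (fun u v huv => by
        rwa [graph_adj, h1, h1, ← graph_adj]) hx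
    · intro x hx
      refine ⟨φ.symm x, ?_, by simp⟩
      have := map_mem_branch (T := T') (T' := T) φ.symm.injective (fun u v huv => by
        rw [graph_adj] at huv ⊢
        rwa [← h1, ← h1, Equiv.apply_symm_apply, Equiv.apply_symm_apply]) hx
      simpa using this
  rw [cobracket_eq_sum, cobracket_eq_sum]
  refine Fintype.sum_equiv φ _ _ fun u => Fintype.sum_equiv φ _ _ fun v => ?_
  have he : T.edgeSign R u v = T'.edgeSign R (φ u) (φ v) := by
    rw [edgeSign, edgeSign, if_congr (h1 u v) rfl rfl, if_congr (h1 v u) rfl rfl]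
  rw [hb, hb, he]

variable (L) in
/-- The cobracket on the module of trees. -/
noncomputable def treeCobracket : TreeModule R L →ₗ[R] TreeModule R L ⊗[R] TreeModule R L :=
  Finsupp.linearCombination R (Quotient.lift (s := PlaneTree.setoid L) (fun T => T.cobracket R)
    fun _ _ h => cobracket_eq_of_homeomorphic R h)

theorem treeCobracket_gen (T : PlaneTree L) : treeCobracket L R (T.gen R) = T.cobracket R := by
  rw [treeCobracket, gen, Finsupp.linearCombination_single, one_smul]
  rfl

theorem hom_ext {M : Type*} [AddCommMonoid M] [Module R M] {f g : TreeModule R L →ₗ[R] M}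
    (h : ∀ T : PlaneTree L, f (T.gen R) = g (T.gen R)) : f = g := by
  refine Finsupp.lhom_ext' fun q => LinearMap.ext_ring ?_
  obtain ⟨T, rfl⟩ := Quotient.exists_rep q
  exact h T

/-- The part of `T` between the edges `uv` and `xy` (which lead away from it). -/
noncomputable def middleGen (T : PlaneTree L) (u v x y : T.V) : TreeModule R L :=
  T.genOn R (T.branch v u u ∩ T.branch y x x)

/-- The edges `uv` and `xy` lead away from each other. -/
def Diverge (T : PlaneTree L) (u v x y : T.V) : Prop :=
  (x ∈ T.branch v u u ∧ y ∈ T.branch v u u) ∧ u ∈ T.branch y x x ∧ v ∈ T.branch y x x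

theorem sum_coe_set {V M : Type*} [Fintype V] [AddCommMonoid M] (s : Set V) [Fintype s]
    [DecidablePred (· ∈ s)] (F : V → M) : ∑ x : s, F x = ∑ x, if x ∈ s then F x else 0 := by
  rw [← Finset.sum_filter]
  exact (Finset.sum_subtype (p := (· ∈ s)) _ (by simp) _).symm

-- An edge `xy` of the branch `C` at `u`, directed away from `u`, cuts `C` into a full branch of `T`
-- beyond `y` and the piece between the two edges. This is the hypothesis on `ν` in
-- `jacobi_of_branches`.
open Classical in
theorem treeCobracket_branchGen (T : PlaneTree L) {u v : T.V} (h : T.graph.Adj u v) :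
    treeCobracket L R (T.branchGen R v u) = ∑ x, ∑ y, if T.Diverge u v x y then
      T.edgeSign R x y • (T.branchGen R x y ⊗ₜ[R] T.middleGen R u v x y -
        T.middleGen R u v x y ⊗ₜ[R] T.branchGen R x y) else 0 := by
  set C := T.branch v u u with hC
  have hconn := T.branch_connected v u u
  let G : T.V → T.V → TreeModule R L := fun x y => T.genOn R (C ∩ T.branch x y y)
  have hvC : v ∉ C := by
    intro hv
    rw [hC, T.branch_comm] at hv
    exact T.not_mem_branch_of_mem h hv (T.self_mem_branch _ _ _)
  have e1 : treeCobracket L R (T.branchGen R v u) = ∑ x, ∑ y, if x ∈ C ∧ y ∈ C then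
      T.edgeSign R x y • (G x y ⊗ₜ[R] G y x) else 0 := by
    rw [branchGen, genOn_of_connected R T hconn, treeCobracket_gen, cobracket_eq_sum]
    have hx : ∀ x y : C, (T.restrict C hconn).edgeSign R x y •
        ((T.restrict C hconn).branchGen R x y ⊗ₜ[R] (T.restrict C hconn).branchGen R y x) =
        T.edgeSign R (x : T.V) y • (G x y ⊗ₜ[R] G y x) := by
      intro x y
      have hs : (T.restrict C hconn).edgeSign R x y = T.edgeSign R (x : T.V) y := rfl
      rw [hs]
      by_cases hadj : T.graph.Adj x y
      · have hg : ∀ x y : C, T.graph.Adj x y → (T.restrict C hconn).branchGen R x y = G x y :=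
          fun x y hadj => (genOn_restrict R T hconn _).trans
            (congrArg (T.genOn R) (image_branch_restrict T hconn hadj))
        rw [hg x y hadj, hg y x hadj.symm]
      · rw [edgeSign_eq_zero R T hadj, zero_smul, zero_smul]
    let _ : Fintype C := instFintypeV (T.restrict C hconn)
    calc _ = ∑ x : C, ∑ y : C, T.edgeSign R (x : T.V) y • (G x y ⊗ₜ[R] G y x) :=
          Fintype.sum_congr _ _ fun x => Fintype.sum_congr _ _ fun y => hx x y
      _ = _ := by
          rw [sum_coe_set C fun x => ∑ y : C, T.edgeSign R x (y : T.V) • (G x y ⊗ₜ[R] G y x)]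
          refine Finset.sum_congr rfl fun x _ => ?_
          rw [sum_coe_set C fun y => T.edgeSign R x y • (G x y ⊗ₜ[R] G y x)]
          by_cases hxC : x ∈ C <;> simp [hxC]
  let E : T.V → T.V → TreeModule R L ⊗[R] TreeModule R L := fun x y =>
    T.edgeSign R x y • (G x y ⊗ₜ[R] G y x)
  -- For every edge, `u` lies at exactly one of its ends. The second half is later relabelled by `x
  -- ↔ y`, where the edge sign changes and produces the negative term.
  have e2 : ∀ x y, (if x ∈ C ∧ y ∈ C then E x y else 0) =
      (if (x ∈ C ∧ y ∈ C) ∧ u ∈ T.branch y x x then E x y else 0) +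
      if (y ∈ C ∧ x ∈ C) ∧ u ∈ T.branch x y y then E x y else 0 := by
    intro x y
    by_cases hadj : T.graph.Adj x y
    · have k1 := T.mem_branch_or (u := x) (v := y) u
      have k2 : u ∈ T.branch x y x → u ∉ T.branch x y y := T.not_mem_branch_of_mem hadj
      rw [T.branch_comm y x x]
      by_cases hx : x ∈ C <;> by_cases hy : y ∈ C <;> by_cases hu : u ∈ T.branch x y x <;>
        by_cases hu' : u ∈ T.branch x y y <;> simp_all
    · have : E x y = 0 := by simp only [E, edgeSign_eq_zero R T hadj, zero_smul]
      simp [this]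
  rw [e1]
  calc _ = ∑ x, ∑ y, ((if (x ∈ C ∧ y ∈ C) ∧ u ∈ T.branch y x x then E x y else 0) +
        if (y ∈ C ∧ x ∈ C) ∧ u ∈ T.branch x y y then E x y else 0) :=
        Fintype.sum_congr _ _ fun x => Fintype.sum_congr _ _ fun y => e2 x y
    _ = ∑ x, ∑ y, ((if (x ∈ C ∧ y ∈ C) ∧ u ∈ T.branch y x x then E x y else 0) +
        if (x ∈ C ∧ y ∈ C) ∧ u ∈ T.branch y x x then E y x else 0) := by
        simp only [Finset.sum_add_distrib]
        congr 1
        exact Finset.sum_comm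
    _ = _ := by
        refine Fintype.sum_congr _ _ fun x => Fintype.sum_congr _ _ fun y => ?_
        by_cases hadj : T.graph.Adj x y
        · have hd : T.Diverge u v x y ↔ (x ∈ C ∧ y ∈ C) ∧ u ∈ T.branch y x x := by
            refine and_congr_right fun hxy => and_iff_left_of_imp fun hu => ?_
            refine (T.mem_branch_iff_of_adj h fun he => ?_).1 hu
            rw [Sym2.eq_iff] at he
            rcases he with ⟨-, rfl⟩ | ⟨-, rfl⟩
            · exact hvC hxy.1
            · exact hvC hxy.2
          simp only [hd]
          split_ifs with hc
          · have hsub : C ∩ T.branch x y y = T.branch x y y :=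
              inter_eq_right.2 (T.branch_subset_branch hadj hc.2 hc.1.2)
            have g1 : G x y = T.branchGen R x y := by simp only [G, hsub]; rfl
            have g2 : G y x = T.middleGen R u v x y := rfl
            simp only [E, g1, g2, edgeSign_swap R T x y, tensor_neg_smul, tensor_smul_sub]
            rw [tensor_sub_eq_add_neg]
          · simp
        · have k1 := edgeSign_eq_zero R T hadj
          have k2 := edgeSign_eq_zero R T fun h' => hadj h'.symm
          simp [E, k1, k2]

theorem isLieCobracket_treeCobracket : IsLieCobracket (treeCobracket L R) := by
  classical
  refine ⟨hom_ext R fun T => ?_, hom_ext R fun T => ?_⟩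
  · have h := comm_sum_eq_neg (T.edgeSign R) (T.edgeSign_swap R) (T.branchGen R)
    rw [← cobracket_eq_sum, ← treeCobracket_gen] at h
    exact h
  · have h := jacobi_of_branches (treeCobracket L R) (T.edgeSign R) (T.branchGen R)
      (T.middleGen R) T.Diverge (fun _ _ _ _ => and_comm)
      (fun u v x y => by rw [middleGen, middleGen, inter_comm]) fun u v => by
        by_cases h : T.graph.Adj u v
        · exact Or.inr (treeCobracket_branchGen R T h)
        · exact Or.inl (edgeSign_eq_zero R T h)
    rw [← cobracket_eq_sum, ← treeCobracket_gen] at h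
    exact h

end Cobracket

end PlaneTree

/-! ### Faces of chord systems and parts of dual trees -/

section DualTrees

variable {H : Set (Circ × Circ)}

theorem ends_finite (hH : IsChordSystem H) : (ends H).Finite :=
  (hH.finite.image _).union (hH.finite.image _)

theorem offChords_iff {x : Circ} : OffChords H x ↔ x ∉ ends H := by
  constructor
  · rintro h (⟨p, hp, rfl⟩ | ⟨p, hp, rfl⟩)
    · exact (h p hp).1 rfl
    · exact (h p hp).2 rfl
  · intro h p hp
    exact ⟨fun e => h (Or.inl ⟨p, hp, e.symm⟩), fun e => h (Or.inr ⟨p, hp, e.symm⟩)⟩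

namespace Face

theorem eq_of_mem {V W : Face H} {x : Circ} (hV : x ∈ V.1) (hW : x ∈ W.1) : V = W :=
  Subtype.ext ((V.eq_faceOf hV).trans (W.eq_faceOf hW).symm)

/-- A point just after a point of `V`, before any chord end or point of `E`, is still in `V`. -/
theorem exists_mem_notMem (hH : IsChordSystem H) (V : Face H) {E : Set Circ} (hE : E.Finite) :
    ∃ y ∈ V.1, y ∉ E := by
  obtain ⟨x, hx⟩ := V.nonempty
  obtain ⟨y, hy0, hy⟩ := exists_just_after (E ∪ ends H) (hE.union (ends_finite hH)) x
  have hyx : y ≠ x := by rintro rfl; simp at hy0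
  have hyE : y ∉ E ∪ ends H := fun h => lt_irrefl _ (hy y h hyx)
  refine ⟨y, ?_, fun h => hyE (Or.inl h)⟩
  rw [V.eq_faceOf hx]
  refine ⟨offChords_iff.2 fun h => hyE (Or.inr h), fun q hq => ?_⟩
  have h1 := hy q.1 (Or.inr (Or.inl ⟨q, hq, rfl⟩)) (V.off hx q hq).1.symm
  have h2 := hy q.2 (Or.inr (Or.inr ⟨q, hq, rfl⟩)) (V.off hx q hq).2.symm
  simp only [sbtw_iff_cpos x, cpos_self]
  grind

/-- The closed face exceeds the face only by chord ends. A map as in `RunsAlong` thus has range `V`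
up to a finite set. -/
theorem mem_of_mem_closedFace (hH : IsChordSystem H) (V : Face H) {x : Circ}
    (hx : x ∈ closedFace H V.1) (hoff : OffChords H x) : x ∈ V.1 := by
  obtain ⟨v, hv⟩ := V.nonempty
  rw [V.eq_faceOf hv]
  refine ⟨hoff, fun q hq => ?_⟩
  have h1 := sbtw_or (hH.ne q hq) (hoff q hq).1 (hoff q hq).2
  by_cases hs : V.Side q
  · have h2 := (hx q hq).1 hs
    rw [Set.mem_cIcc, btw_iff_not_sbtw] at h2
    have := (V.side_iff hv hq).1 hs
    tauto
  · have h2 := (hx q hq).2 fun w hw => (V.not_side_iff hH hw hq).1 hs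
    rw [Set.mem_cIcc, btw_iff_not_sbtw] at h2
    have := (V.side_iff hv hq).not.1 hs
    tauto

/-- A face adjacent to `p` lies, for every other chord, on the side of the end point `p.1`
(`agree`). Only its side of `p` remains free. -/
theorem via_unique (hH : IsChordSystem H) {p : Circ × Circ} (hp : p ∈ H) {A B V W : Face H}
    (h : Via p A B) (h' : Via p V W) (hs : A.Side p ↔ V.Side p) : A = V := by
  refine ext_side fun r hr => ?_
  by_cases hrp : r = p
  · rw [hrp]; exact hs
  · exact (agree hH hp hr hrp h.1 (h.2 r hr hrp)).trans
      (agree hH hp hr hrp h'.1 (h'.2 r hr hrp)).symm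

/-- For distinct neighbours one choice of points decides the order; a condition on single points is
easy to transport along a cyclically monotone map. -/
theorem cyc_iff (hH : IsChordSystem H) {V A B C : Face H} : Cyc V A B C ↔
    (SimpleGraph.fromRel Dir).Adj V A ∧ (SimpleGraph.fromRel Dir).Adj V B ∧
      (SimpleGraph.fromRel Dir).Adj V C ∧ (A ≠ B ∧ B ≠ C ∧ A ≠ C) ∧
      ∃ a ∈ A.1, ∃ b ∈ B.1, ∃ c ∈ C.1, sbtw a b c := by
  obtain ⟨x, hx⟩ := A.nonempty
  obtain ⟨y, hy⟩ := B.nonempty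
  obtain ⟨z, hz⟩ := C.nonempty
  constructor
  · rintro ⟨h1, h2, h3, h⟩
    refine ⟨h1, h2, h3, ⟨?_, ?_, ?_⟩, x, hx, y, hy, z, hz, h x hx y hy z hz⟩ <;> rintro rfl
    · exact sbtw_irrefl_left (h x hx x hx z hz)
    · exact sbtw_irrefl_right (h x hx y hy y hy)
    · exact sbtw_irrefl_left_right (h x hx y hy x hx)
  · rintro ⟨h1, h2, h3, ⟨h4, h5, h6⟩, a, ha, b, hb, c, hc, h⟩
    refine (cyc_total hH h1 h2 h3 h4 h5 h6).resolve_right fun h' => ?_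
    exact sbtw_asymm h (h'.2.2.2 c hc b hb a ha)

end Face

/-- A part `s` of the splitting of the disk by `H` that is the image under the cyclically monotone
map `φ` of the splitting by `H'`. -/
structure IsSubsplitting (H H' : Set (Circ × Circ)) (φ : Circ → Circ) (s : Set (Face H)) : Prop where
  system : IsChordSystem H
  system' : IsChordSystem H'
  cycMono : CycMono φ
  mem_iff : ∀ q : Circ × Circ, q ∈ H' ↔ (φ q.1, φ q.2) ∈ H
  subset_range : ∀ F ∈ s, F.1 ⊆ range φ
  exists_face : ∀ x, OffChords H (φ x) → ∃ F ∈ s, φ x ∈ F.1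
  same_side : ∀ q ∈ H, (∃ q' : Circ × Circ, q = (φ q'.1, φ q'.2)) ∨
    ∀ F ∈ s, ∀ G ∈ s, (F.Side q ↔ G.Side q)

namespace IsSubsplitting

variable {H' : Set (Circ × Circ)} {φ : Circ → Circ} {s : Set (Face H)}

theorem off (h : IsSubsplitting H H' φ s) {x : Circ} (hx : OffChords H (φ x)) :
    OffChords H' x := fun q hq =>
  ⟨fun e => (hx _ ((h.mem_iff q).1 hq)).1 (congrArg φ e),
    fun e => (hx _ ((h.mem_iff q).1 hq)).2 (congrArg φ e)⟩

theorem exists_mem (h : IsSubsplitting H H' φ s) {F : Face H} (hF : F ∈ s) : ∃ x, φ x ∈ F.1 := by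
  obtain ⟨y, hy⟩ := F.nonempty
  obtain ⟨x, rfl⟩ := h.subset_range F hF hy
  exact ⟨x, hy⟩

theorem side_iff (h : IsSubsplitting H H' φ s) {F : Face H} {F' : Face H'} {x : Circ}
    (hx : φ x ∈ F.1) (hx' : x ∈ F'.1) {q : Circ × Circ} (hq : q ∈ H') :
    F'.Side q ↔ F.Side (φ q.1, φ q.2) := by
  rw [F'.side_iff hx' hq, F.side_iff hx ((h.mem_iff q).1 hq), h.cycMono.sbtw_iff]

/-- Two faces in `s` can be separated only by chords that come from `H'`, and those do not separate
points of one face of `H'`. -/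
theorem mem_of_mem (h : IsSubsplitting H H' φ s) {F : Face H} (hF : F ∈ s) {F' : Face H'}
    {x y : Circ} (hx : φ x ∈ F.1) (hx' : x ∈ F'.1) (hy : OffChords H (φ y)) (hy' : y ∈ F'.1) :
    φ y ∈ F.1 := by
  obtain ⟨G, hG, hyG⟩ := h.exists_face y hy
  have : G = F := Face.ext_side fun q hq => by
    rcases h.same_side q hq with ⟨q', rfl⟩ | h1
    · have hq' := (h.mem_iff q').2 hq
      rw [← h.side_iff hyG hy' hq', ← h.side_iff hx hx' hq']
    · exact h1 G hG F hF
  rwa [← this]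

theorem mem_of_map_mem (h : IsSubsplitting H H' φ s) {F : Face H} {F' : Face H'}
    {x y : Circ} (hx : φ x ∈ F.1) (hx' : x ∈ F'.1) (hy : φ y ∈ F.1) : y ∈ F'.1 := by
  rw [F'.eq_faceOf hx']
  refine ⟨h.off (F.off hy), fun q hq => ?_⟩
  rw [← h.cycMono.sbtw_iff, ← h.cycMono.sbtw_iff (x := q.1) (y := y)]
  have hq' := (h.mem_iff q).1 hq
  rw [← F.side_iff hx hq', ← F.side_iff hy hq']

/-- The faces of the part `s` correspond to the faces of `H'`. -/
theorem exists_equiv (h : IsSubsplitting H H' φ s) :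
    ∃ e : s ≃ Face H', ∀ (F : s) (x : Circ), φ x ∈ F.1.1 → x ∈ (e F).1 := by
  choose x hx using fun F : s => h.exists_mem F.2
  let e : s → Face H' := fun F => ⟨faceOf H' (x F), x F, h.off (F.1.off (hx F)), rfl⟩
  have hxe : ∀ F, x F ∈ (e F).1 := fun F => mem_faceOf_self (h.off (F.1.off (hx F)))
  refine ⟨Equiv.ofBijective e ⟨fun F G hFG => ?_, fun F' => ?_⟩, fun F y hy => ?_⟩
  · have h1 := hxe G
    rw [← hFG] at h1
    have := h.mem_of_mem F.2 (hx F) (hxe F) (G.1.off (hx G)) h1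
    exact Subtype.ext (Face.eq_of_mem this (hx G))
  -- Points of `F'` may be sent to chord ends of `H`, such as the base point of an arc; a point of
  -- `F'` avoiding these finitely many is needed.
  · have hfin : (φ ⁻¹' ends H).Finite := (ends_finite h.system).preimage h.cycMono.injective.injOn
    obtain ⟨y, hy, hyE⟩ := F'.exists_mem_notMem h.system' hfin
    obtain ⟨F, hF, hyF⟩ := h.exists_face y (offChords_iff.2 hyE)
    exact ⟨⟨F, hF⟩, Face.eq_of_mem (h.mem_of_map_mem (hx ⟨F, hF⟩) (hxe _) hyF) hy⟩
  · exact h.mem_of_map_mem (hx F) (hxe F) hy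

/-- By `same_side`, chords that do not come from `H'` never separate faces in `s`. Adjacency,
direction and cyclic order within `s` are therefore visible in `H'` alone. -/
theorem genOn_dualTree {R L : Type*} [CommRing R] (h : IsSubsplitting H H' φ s)
    (label : Face H → L) (label' : Face H' → L)
    (hl : ∀ F ∈ s, ∀ F' : Face H', (∀ x, φ x ∈ F.1 → x ∈ F'.1) → label' F' = label F) :
    (dualTree H h.system label).genOn R s = (dualTree H' h.system' label').gen R := by
  obtain ⟨e, he⟩ := h.exists_equiv
  have hside : ∀ (F : s) q, q ∈ H' → ((e F).Side q ↔ F.1.Side (φ q.1, φ q.2)) := fun F q hq => by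
    obtain ⟨x, hx⟩ := h.exists_mem F.2
    exact h.side_iff hx (he F x hx) hq
  have hdir : ∀ F G : s, Face.Dir (e F) (e G) ↔ Face.Dir F.1 G.1 := by
    intro F G
    constructor
    · rintro ⟨p, hp, h1, h2, h3⟩
      rw [hside _ _ hp] at h1 h2
      refine ⟨_, (h.mem_iff p).1 hp, h1, h2, fun q hq hqp => ?_⟩
      rcases h.same_side q hq with ⟨q', rfl⟩ | h4
      · have hq' := (h.mem_iff q').2 hq
        rw [← hside _ _ hq', ← hside _ _ hq']
        exact h3 q' hq' fun e => hqp (by rw [e])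
      · exact h4 _ F.2 _ G.2
    · rintro ⟨p, hp, h1, h2, h3⟩
      rcases h.same_side p hp with ⟨p', rfl⟩ | h4
      · have hp' := (h.mem_iff p').2 hp
        refine ⟨p', hp', by rwa [hside _ _ hp'], by rwa [hside _ _ hp'], fun q hq hqp => ?_⟩
        rw [hside _ _ hq, hside _ _ hq]
        refine h3 _ ((h.mem_iff q).1 hq) fun e => hqp ?_
        rw [Prod.mk.injEq] at e
        exact Prod.ext (h.cycMono.injective e.1) (h.cycMono.injective e.2)
      · exact absurd ((h4 _ F.2 _ G.2).2 h2) h1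
  have hadj : ∀ F G : s, (SimpleGraph.fromRel Face.Dir).Adj (e F) (e G) ↔
      (SimpleGraph.fromRel Face.Dir).Adj F.1 G.1 := fun F G => by
    rw [SimpleGraph.fromRel_adj, SimpleGraph.fromRel_adj, hdir, hdir, e.injective.ne_iff,
      Subtype.coe_injective.ne_iff]
  have hcyc : ∀ V A B C : s, Face.Cyc (e V) (e A) (e B) (e C) ↔
      Face.Cyc V.1 A.1 B.1 C.1 := by
    intro V A B C
    rw [Face.cyc_iff h.system, Face.cyc_iff h.system', hadj, hadj, hadj, e.injective.ne_iff,
      e.injective.ne_iff, e.injective.ne_iff, Subtype.coe_injective.ne_iff,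
      Subtype.coe_injective.ne_iff, Subtype.coe_injective.ne_iff]
    refine and_congr_right fun h1 => and_congr_right fun h2 => and_congr_right fun h3 =>
      and_congr_right fun h4 => ?_
    obtain ⟨x, hx⟩ := h.exists_mem A.2
    obtain ⟨y, hy⟩ := h.exists_mem B.2
    obtain ⟨z, hz⟩ := h.exists_mem C.2
    constructor
    · intro h5
      have h6 : Face.Cyc (e V) (e A) (e B) (e C) := (Face.cyc_iff h.system').2
        ⟨(hadj _ _).2 h1, (hadj _ _).2 h2, (hadj _ _).2 h3,
          by simpa only [e.injective.ne_iff, Subtype.coe_injective.ne_iff] using h4, h5⟩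
      exact ⟨_, hx, _, hy, _, hz, h.cycMono _ _ _
        (h6.2.2.2 x (he _ _ hx) y (he _ _ hy) z (he _ _ hz))⟩
    · intro h5
      have h6 : Face.Cyc V.1 A.1 B.1 C.1 := (Face.cyc_iff h.system).2
        ⟨h1, h2, h3, by simpa only [Subtype.coe_injective.ne_iff] using h4, h5⟩
      exact ⟨x, he _ _ hx, y, he _ _ hy, z, he _ _ hz, h.cycMono.sbtw_iff.1
        (h6.2.2.2 _ hx _ hy _ hz)⟩
  exact PlaneTree.genOn_eq_gen R (T := dualTree H h.system label)
    (T' := dualTree H' h.system' label') e hdir (fun F => hl F.1 F.2 _ (he F)) hcyc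

end IsSubsplitting

/-! ### The cobracket of a dual tree -/

section Cobracket

variable {L : Type*}

/-- Crossing any chord other than `p` keeps the side of `p`, and only the deleted edge crosses `p`.
So the side of `p` is constant on each of the two components and tells them apart. -/
theorem branch_dualTree (hH : IsChordSystem H) (label : Face H → L) {p : Circ × Circ} (hp : p ∈ H)
    {V W : Face H} (h : Face.Via p V W) :
    (dualTree H hH label).branch V W W = {F : Face H | F.Side p ↔ W.Side p} := by
  set T := dualTree H hH label
  have key : ∀ A B : Face H, B ∈ T.branch V W A → (B.Side p ↔ A.Side p) := by
    intro A B hB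
    refine T.iff_of_mem_branch (P := fun F : Face H => F.Side p) (fun A B hadj hne => ?_) hB
    obtain ⟨q, hq, hq'⟩ := Face.adj_iff.1 hadj
    by_cases hqp : q = p
    · subst hqp
      refine absurd (Sym2.eq_iff.2 ?_) hne
      have h1 := hq'.1
      have h2 := h.1
      by_cases hs : Face.Side A q ↔ V.Side q
      · exact Or.inl ⟨Face.via_unique hH hq hq' h hs,
          Face.via_unique hH hq hq'.symm h.symm (by tauto)⟩
      · exact Or.inr ⟨Face.via_unique hH hq hq' h.symm (by tauto),
          Face.via_unique hH hq hq'.symm h (by tauto)⟩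
    · exact hq'.2 p hp (Ne.symm hqp)
  apply Subset.antisymm
  · intro B hB
    exact key W B hB
  · intro B hB
    refine (T.mem_branch_or (u := V) (v := W) B).resolve_left fun hV => ?_
    have h1 := key V B hV
    have h2 : Face.Side B p ↔ W.Side p := hB
    have := h.1
    tauto

/-- Edges correspond bijectively to the chords they cross, the head lying on the side of the arc
from `p.1` to `p.2`. -/
theorem cobracket_dualTree {R : Type*} [CommRing R] (hH : IsChordSystem H) [Fintype H]
    (label : Face H → L) : (dualTree H hH label).cobracket R = ∑ p : H,
      ((dualTree H hH label).genOn R {F : Face H | F.Side p.1} ⊗ₜ[R]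
          (dualTree H hH label).genOn R {F : Face H | ¬ F.Side p.1} -
        (dualTree H hH label).genOn R {F : Face H | ¬ F.Side p.1} ⊗ₜ[R]
          (dualTree H hH label).genOn R {F : Face H | F.Side p.1}) := by
  set T := dualTree H hH label with hT
  have hex : ∀ e : T.Edge, ∃ p : H, ¬ Face.Side e.1.1 p.1 ∧ Face.Side e.1.2 p.1 ∧
      ∀ q ∈ H, q ≠ p.1 → (Face.Side e.1.1 q ↔ Face.Side e.1.2 q) := by
    rintro ⟨⟨V, W⟩, p, hp, h⟩
    exact ⟨⟨p, hp⟩, h⟩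
  choose f hf using hex
  have hvia : ∀ e, Face.Via (f e).1 e.1.1 e.1.2 := fun e =>
    ⟨by have := (hf e).1; have := (hf e).2.1; tauto, (hf e).2.2⟩
  refine Fintype.sum_bijective f ⟨fun e e' hee => ?_, fun p => ?_⟩ _ _ fun e => ?_
  · have h1 := hvia e
    have h2 := hvia e'
    rw [← hee] at h2
    have h3 := hf e
    have h4 := hf e'
    rw [← hee] at h4
    refine Subtype.ext (Prod.ext ?_ ?_)
    · exact Face.via_unique hH (f e).2 h1 h2 (by tauto)
    · exact Face.via_unique hH (f e).2 h1.symm h2.symm (by tauto)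
  · obtain ⟨V, hV, hV'⟩ := Face.exists_next_face hH p.2 False
    obtain ⟨W, hW, hW'⟩ := Face.exists_next_face hH p.2 True
    have h3 : ∀ q ∈ H, q ≠ p.1 → (V.Side q ↔ W.Side q) := fun q hq hqp =>
      (hV' q hq hqp).trans (hW' q hq hqp).symm
    let e : T.Edge := ⟨(V, W), p.1, p.2, by tauto, by tauto, h3⟩
    refine ⟨e, ?_⟩
    by_contra hne
    have h4 := h3 (f e).1 (f e).2 fun h => hne (Subtype.ext h)
    have h5 : ¬ V.Side (f e).1 := (hf e).1
    have h6 : W.Side (f e).1 := (hf e).2.1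
    tauto
  · have e1 : (T.headTree e).gen R = T.genOn R {F : Face H | F.Side (f e).1} := by
      refine (PlaneTree.genOn_of_connected R T (T.branch_connected _ _ _)).symm.trans ?_
      congr 1
      refine (branch_dualTree hH label (f e).2 (hvia e)).trans ?_
      ext F
      have := (hf e).2.1
      simp only [Set.mem_ofPred_eq]
      tauto
    have e2 : (T.tailTree e).gen R = T.genOn R {F : Face H | ¬ F.Side (f e).1} := by
      refine (PlaneTree.genOn_of_connected R T (T.branch_connected _ _ _)).symm.trans ?_
      rw [PlaneTree.branch_comm]
      congr 1
      refine (branch_dualTree hH label (f e).2 (hvia e).symm).trans ?_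
      ext F
      have := (hf e).1
      simp only [Set.mem_ofPred_eq]
      tauto
    rw [e1, e2]

end Cobracket

end DualTrees

/-! ### Cuts of a loop and the cuts they induce on its arcs -/

section Cuts

variable {S : Type*} [TopologicalSpace S] [ChartedSpace (EuclideanHalfSpace 2) S]

theorem Cut.ext {α : GenericLoop S} {H K : Cut α} (h : H.chords = K.chords) : H = K := by
  obtain ⟨c, hc, hc'⟩ := H
  obtain ⟨d, hd, hd'⟩ := K
  obtain rfl : c = d := h
  rfl

theorem cycMono_arcParam {a b : Circ} (hne : a ≠ b) : CycMono (arcParam a b) :=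
  fun _ _ _ h => (sbtw_arcParam hne _ _ _).2 h

theorem linked_iff_of_cycMono {φ : Circ → Circ} (hφ : CycMono φ) {p q : Circ × Circ} :
    Linked (φ p.1, φ p.2) (φ q.1, φ q.2) ↔ Linked p q := by
  simp only [Linked, hφ.sbtw_iff]

/-- The chords of a cut that are the images of crossings of `γ` under `φ`. -/
def Cut.pull {α γ : GenericLoop S} (H : Cut α) (φ : Circ → Circ) (hφ : CycMono φ)
    (hc : ∀ q : Circ × Circ, q ∈ γ.crossings ↔ (φ q.1, φ q.2) ∈ α.crossings) : Cut γ where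
  chords := {q | (φ q.1, φ q.2) ∈ H.chords}
  subset q hq := (hc q).2 (H.subset hq)
  unlinked p hp q hq hpq hl := H.unlinked _ hp _ hq (fun e => hpq (by
    rw [Prod.mk.injEq] at e
    exact Prod.ext (hφ.injective e.1) (hφ.injective e.2))) ((linked_iff_of_cycMono hφ).2 hl)

/-- The affine parametrization multiplies both velocities at a crossing by the same positive factor,
so the determinant is scaled by its square. -/
theorem GenericLoop.mem_crossings_arc (α : GenericLoop S) {a b : Circ} (hne : a ≠ b)
    (hab : α.toFun a = α.toFun b) (q : Circ × Circ) : q ∈ (α.arc a b hne hab).crossings ↔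
      (arcParam a b q.1, arcParam a b q.2) ∈ α.crossings := by
  refine and_congr (arcParam_injective hne).ne_iff.symm Iff.rfl |>.trans ?_ |>.trans Iff.rfl
  refine and_congr_right fun h1 => and_congr_right fun h2 => ?_
  have h3 : q.1 ≠ q.2 := fun e => h1 (congrArg _ e)
  have e1 := (α.arc_crossing a b hne hab q.1 q.2 h3 h2).2
  have e2 := (α.arc_crossing a b hne hab q.2 q.1 h3.symm h2.symm).2
  change 0 < det₂ (velocity fun u : ℝ => α.toFun (arcParam a b (q.1 + u)))
    (velocity fun u : ℝ => α.toFun (arcParam a b (q.2 + u))) ↔ _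
  rw [e1, e2]
  have h4 : ∀ v w : EuclideanSpace ℝ (Fin 2), det₂ (cpos a b • v) (cpos a b • w) =
      cpos a b * cpos a b * det₂ v w := fun v w => by
    simp only [det₂, PiLp.smul_apply, smul_eq_mul]; ring
  rw [h4]
  exact mul_pos_iff_of_pos_left (mul_pos (cpos_pos hne) (cpos_pos hne))

/-- The tree of the cut induced on a part of the disk. -/
theorem Cut.genOn_tree [T2Space S] {R : Type*} [CommRing R] {α γ : GenericLoop S} {H : Cut α}
    {H' : Cut γ} {φ : Circ → Circ} {s : Set (Face H.chords)}
    (hs : IsSubsplitting H.chords H'.chords φ s) (h : unitInterval → S ≃ₜ S)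
    (hc : Continuous (fun p : unitInterval × S => h p.1 p.2)) (h0 : h 0 = Homeomorph.refl S)
    (hγ : ∀ x, γ.toFun x = h 1 (α.toFun (φ x))) :
    H.tree.genOn R s = H'.tree.gen R := by
  refine hs.genOn_dualTree _ _ fun F hF F' hFF' => ?_
  obtain ⟨g, hg, hg1, hg2, hg3⟩ := Classical.choose_spec (H.exists_runsAlong F)
  obtain ⟨g', hg', hg1', hg2', hg3'⟩ := Classical.choose_spec (H'.exists_runsAlong F')
  have hfin := ends_finite H.isChordSystem
  -- The labels agree because `g` and `φ ∘ g'` both cover the face `F` and exceed it only by chord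
  -- ends.
  refine (Quotient.sound (s := isotopySetoid S) (isotopic_of_cycMono (A := F.1) (α := α.toFun) hg
    (hs.cycMono.comp hg') hg1 ?_ (hfin.subset ?_) (hfin.subset ?_) h hc h0 hg3 fun x => ?_)).symm
  · intro y hy
    obtain ⟨x, rfl⟩ := hs.subset_range F hF hy
    obtain ⟨t, rfl⟩ := hg1' (hFF' x hy)
    exact ⟨t, rfl⟩
  · rintro y ⟨hy, hyF⟩
    by_contra hye
    exact hyF (F.mem_of_mem_closedFace H.isChordSystem (hg2 hy) (offChords_iff.2 hye))
  · rintro _ ⟨⟨t, rfl⟩, hyF⟩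
    by_contra hye
    have hoff := offChords_iff.2 hye
    obtain ⟨x, hx⟩ := hs.exists_mem hF
    have h1 := F'.mem_of_mem_closedFace H'.isChordSystem (hg2' ⟨t, rfl⟩) (hs.off hoff)
    exact hyF (hs.mem_of_mem hF hx (hFF' x hx) hoff h1)
  · exact (hg3' x).trans (hγ _)

theorem isSubsplitting_pull {α γ : GenericLoop S} (H : Cut α) {φ : Circ → Circ} (hφ : CycMono φ)
    (hφs : Function.Surjective φ)
    (hc : ∀ q : Circ × Circ, q ∈ γ.crossings ↔ (φ q.1, φ q.2) ∈ α.crossings) :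
    IsSubsplitting H.chords (H.pull φ hφ hc).chords φ univ where
  system := H.isChordSystem
  system' := Cut.isChordSystem _
  cycMono := hφ
  mem_iff _ := Iff.rfl
  subset_range _ _ := by rw [hφs.range_eq]; exact subset_univ _
  exists_face x hx := ⟨⟨_, _, hx, rfl⟩, mem_univ _, mem_faceOf_self hx⟩
  same_side q _ := by
    obtain ⟨c, hc⟩ := hφs q.1
    obtain ⟨d, hd⟩ := hφs q.2
    exact Or.inl ⟨(c, d), by simp [hc, hd]⟩

/-- The cut induced on an arc of the loop. -/
noncomputable def Cut.arc {α : GenericLoop S} (H : Cut α) (a b : Circ) (hne : a ≠ b)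
    (hab : α.toFun a = α.toFun b) : Cut (α.arc a b hne hab) :=
  H.pull (arcParam a b) (cycMono_arcParam hne) (α.mem_crossings_arc hne hab)

/-- A chord unlinked from the one joining `a` and `b` either has both ends in the open arc, and
comes from the arc, or has the whole open arc on one of its sides. The chord joining `a` and `b`
also has all these faces on one side. -/
theorem isSubsplitting_arc {α : GenericLoop S} (H : Cut α) {a b : Circ} (hne : a ≠ b)
    (hab : α.toFun a = α.toFun b) (hp : (a, b) ∈ H.chords ∨ (b, a) ∈ H.chords) :
    IsSubsplitting H.chords (H.arc a b hne hab).chords (arcParam a b)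
      {F | F.1 ⊆ Set.cIoo a b} where
  system := H.isChordSystem
  system' := Cut.isChordSystem _
  cycMono := cycMono_arcParam hne
  mem_iff _ := Iff.rfl
  subset_range F hF x hx := exists_arcParam (hF hx)
  exists_face x hx := by
    have h1 : sbtw a (arcParam a b x) b := by
      refine (arcParam_mem hne x).resolve_left fun h => ?_
      rcases hp with hp | hp
      · exact (hx _ hp).1 h
      · exact (hx _ hp).2 h
    refine ⟨⟨_, _, hx, rfl⟩, ?_, mem_faceOf_self hx⟩
    intro y hy
    rcases hp with hp | hp
    · exact (hy.2 _ hp).1 h1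
    · have h2 := (hy.2 _ hp).not.1 (sbtw_asymm h1)
      exact (sbtw_or (p := (b, a)) hne.symm (hy.1 _ hp).1 (hy.1 _ hp).2).resolve_left h2
  same_side q hq := by
    have hH := H.isChordSystem
    by_cases hqp : q = (a, b) ∨ q = (b, a)
    · right
      intro F hF G hG
      obtain ⟨x, hx⟩ := F.nonempty
      obtain ⟨y, hy⟩ := G.nonempty
      rw [F.side_iff hx hq, G.side_iff hy hq]
      have h1 : sbtw a x b := hF hx
      have h2 : sbtw a y b := hG hy
      rcases hqp with rfl | rfl
      · exact ⟨fun _ => h2, fun _ => h1⟩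
      · exact ⟨fun h => absurd h (sbtw_asymm h1), fun h => absurd h (sbtw_asymm h2)⟩
    · have hdis : ¬ Linked (a, b) q ∧ a ≠ q.1 ∧ a ≠ q.2 ∧ b ≠ q.1 ∧ b ≠ q.2 := by
        rcases hp with hp | hp
        · have hne' : (a, b) ≠ q := fun e => hqp (Or.inl e.symm)
          exact ⟨hH.unlinked _ hp _ hq hne', hH.disjoint _ hp _ hq hne'⟩
        · have hne' : (b, a) ≠ q := fun e => hqp (Or.inr e.symm)
          have h1 := hH.disjoint _ hp _ hq hne'
          exact ⟨fun h => hH.unlinked _ hp _ hq hne' (linked_swap.2 h), h1.2.2.1, h1.2.2.2,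
            h1.1, h1.2.1⟩
      obtain ⟨h0, h1, h2, h3, h4⟩ := hdis
      by_cases hs : sbtw a q.1 b
      · left
        obtain ⟨c, hc⟩ := exists_arcParam hs
        obtain ⟨d, hd⟩ := exists_arcParam ((unlinked_side h0 hne h1 h2 h3 h4).1 hs)
        exact ⟨(c, d), by simp [hc, hd]⟩
      · right
        intro F hF G hG
        obtain ⟨x, hx⟩ := F.nonempty
        obtain ⟨y, hy⟩ := G.nonempty
        rw [F.side_iff hx hq, G.side_iff hy hq]
        exact (side_iff h0 h1 h2 h3 hs (hF hx)).trans (side_iff h0 h1 h2 h3 hs (hG hy)).symm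

theorem continuous_const_isotopy {S : Type*} [TopologicalSpace S] : Continuous (fun p : unitInterval × S =>
    (fun _ => Homeomorph.refl S : unitInterval → S ≃ₜ S) p.1 p.2) := continuous_snd

theorem Cut.genOn_arc [T2Space S] {R : Type*} [CommRing R] {α : GenericLoop S} (H : Cut α)
    {a b : Circ} (hne : a ≠ b) (hab : α.toFun a = α.toFun b)
    (hp : (a, b) ∈ H.chords ∨ (b, a) ∈ H.chords) {s : Set (Face H.chords)}
    (hs : s = {F | F.1 ⊆ Set.cIoo a b}) :
    H.tree.genOn R s = (H.arc a b hne hab).tree.gen R := by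
  subst hs
  exact Cut.genOn_tree (isSubsplitting_arc H hne hab hp) (fun _ => Homeomorph.refl S)
    continuous_const_isotopy rfl fun _ => rfl

theorem Cut.cobracket_tree [T2Space S] {R : Type*} [CommRing R] {α : GenericLoop S} (H : Cut α)
    [Fintype H.chords] : H.tree.cobracket R = ∑ p : H.chords,
      ((H.arc p.1.1 p.1.2 (H.subset p.2).1 (H.subset p.2).2.1).tree.gen R ⊗ₜ[R]
        (H.arc p.1.2 p.1.1 (H.subset p.2).1.symm (H.subset p.2).2.1.symm).tree.gen R -
      (H.arc p.1.2 p.1.1 (H.subset p.2).1.symm (H.subset p.2).2.1.symm).tree.gen R ⊗ₜ[R]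
        (H.arc p.1.1 p.1.2 (H.subset p.2).1 (H.subset p.2).2.1).tree.gen R) := by
  refine (cobracket_dualTree H.isChordSystem _).trans (Finset.sum_congr rfl fun p _ => ?_)
  have e1 := Cut.genOn_arc (R := R) H (H.subset p.2).1 (H.subset p.2).2.1 (Or.inl p.2)
    (s := {F : Face H.chords | F.Side p.1}) rfl
  have e2 := Cut.genOn_arc (R := R) H (H.subset p.2).1.symm (H.subset p.2).2.1.symm (Or.inr p.2)
    (s := {F : Face H.chords | ¬ F.Side p.1}) (by
      ext F
      constructor
      · intro h x hx
        exact (F.not_side_iff H.isChordSystem hx p.2).1 h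
      · intro h
        obtain ⟨x, hx⟩ := F.nonempty
        exact (F.not_side_iff H.isChordSystem hx p.2).2 (h hx))
  exact congrArg₂ (fun x y => x ⊗ₜ[R] y - y ⊗ₜ[R] x) e1 e2

/-- Without triple points a shared end point forces the same pair of preimages, and the sign
condition excludes the pair in reverse order. -/
theorem GenericLoop.crossings_disjoint (α : GenericLoop S) {p q : Circ × Circ}
    (hp : p ∈ α.crossings) (hq : q ∈ α.crossings) (hpq : p ≠ q) :
    p.1 ≠ q.1 ∧ p.1 ≠ q.2 ∧ p.2 ≠ q.1 ∧ p.2 ≠ q.2 := by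
  obtain ⟨a, b⟩ := p
  obtain ⟨c, d⟩ := q
  obtain ⟨h1, h2, h3⟩ := hp
  obtain ⟨k1, k2, k3⟩ := hq
  dsimp only at *
  have anti : ∀ v w : EuclideanSpace ℝ (Fin 2), 0 < det₂ v w → ¬ 0 < det₂ w v := by
    intro v w h h'
    simp only [det₂] at h h'
    linarith
  have key : ∀ x y z : Circ, α.toFun x = α.toFun y → α.toFun x = α.toFun z → x ≠ y → x ≠ z →
      y = z := fun x y z e1 e2 n1 n2 =>
    ((α.double_points y x z e1.symm e2).resolve_left n1.symm).resolve_left n2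
  refine ⟨?_, ?_, ?_, ?_⟩
  · rintro rfl
    exact hpq (by rw [key a b d h2 k2 h1 k1])
  · rintro rfl
    obtain rfl := key a b c h2 k2.symm h1 k1.symm
    exact anti _ _ h3 k3
  · rintro rfl
    obtain rfl := key b a d h2.symm k2 h1.symm k1
    exact anti _ _ h3 k3
  · rintro rfl
    exact hpq (by rw [key b a c h2.symm k2.symm h1.symm k1.symm])

theorem arcParam_ne_arcParam {a b : Circ} (hne : a ≠ b) (x y : Circ) :
    arcParam a b x ≠ arcParam b a y := by
  intro e
  have h1 := arcParam_mem hne x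
  have h2 := arcParam_mem hne.symm y
  rw [← e] at h2
  rcases h1 with h1 | h1 <;> rcases h2 with h2 | h2
  · exact hne (h1.symm.trans h2)
  · rw [h1] at h2; exact sbtw_irrefl_right h2
  · rw [h2] at h1; exact sbtw_irrefl_right h1
  · exact sbtw_asymm h1 h2

theorem not_linked_of_sbtw {a b c d e f : Circ} (hc : sbtw a c b) (hd : sbtw a d b)
    (he : sbtw b e a) (hf : sbtw b f a) : ¬ Linked (c, d) (e, f) := by
  unfold Linked
  simp only [sbtw_iff_cpos a, cpos_self] at *
  have := cpos_nonneg a b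
  have := cpos_nonneg a c
  have := cpos_nonneg a d
  have := cpos_nonneg a e
  have := cpos_nonneg a f
  grind

theorem GenericLoop.mem_crossings_cases {α : GenericLoop S} {p : Circ × Circ}
    (hp : p ∈ α.crossings) {q : Circ × Circ} (hq : q ∈ α.crossings) (hqp : q ≠ p)
    (hl : ¬ Linked p q) : (∃ q' : Circ × Circ, q = (arcParam p.1 p.2 q'.1, arcParam p.1 p.2 q'.2)) ∨
      ∃ q' : Circ × Circ, q = (arcParam p.2 p.1 q'.1, arcParam p.2 p.1 q'.2) := by
  have h := α.crossings_disjoint hp hq hqp.symm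
  have h1 := unlinked_side (a := p.1) (b := p.2) (c := q.1) (d := q.2) hl hp.1 h.1 h.2.1 h.2.2.1
    h.2.2.2
  have key : ∀ {a b : Circ}, sbtw a q.1 b → sbtw a q.2 b →
      ∃ q' : Circ × Circ, q = (arcParam a b q'.1, arcParam a b q'.2) := by
    intro a b h h'
    obtain ⟨c, hc⟩ := exists_arcParam h
    obtain ⟨d, hd⟩ := exists_arcParam h'
    exact ⟨(c, d), by simp [hc, hd]⟩
  by_cases hs : sbtw p.1 q.1 p.2
  · exact Or.inl (key hs (h1.1 hs))
  · exact Or.inr (key ((sbtw_or hp.1 h.1.symm h.2.2.1.symm).resolve_left hs)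
      ((sbtw_or hp.1 h.2.1.symm h.2.2.2.symm).resolve_left (h1.not.1 hs)))

/-- The range of `arcParam a b` contains `a`, but a crossing through `a` is `p`, whose other end `b`
is not in the range. Crossings of the arc therefore avoid its base point. -/
theorem sbtw_of_mem_arc {α : GenericLoop S} {p : Circ × Circ} (hp : p ∈ α.crossings)
    {a b : Circ} (hab : p = (a, b) ∨ p = (b, a)) {q : Circ × Circ}
    (hq : (arcParam a b q.1, arcParam a b q.2) ∈ α.crossings) :
    sbtw a (arcParam a b q.1) b ∧ sbtw a (arcParam a b q.2) b := by
  have hne : a ≠ b := by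
    rcases hab with rfl | rfl
    · exact hp.1
    · exact hp.1.symm
  have hqp : p ≠ (arcParam a b q.1, arcParam a b q.2) := by
    intro e
    have h1 := @arcParam_ne a b q.1 hne
    have h2 := @arcParam_ne a b q.2 hne
    rcases hab with rfl | rfl <;> rw [Prod.mk.injEq] at e
    · exact h2 e.2.symm
    · exact h1 e.1.symm
  have h := α.crossings_disjoint hp hq hqp
  refine ⟨(arcParam_mem hne _).resolve_left fun e => ?_,
    (arcParam_mem hne _).resolve_left fun e => ?_⟩
  · rcases hab with rfl | rfl
    · exact h.1 e.symm
    · exact h.2.2.1 e.symm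
  · rcases hab with rfl | rfl
    · exact h.2.1 e.symm
    · exact h.2.2.2 e.symm

/-- The cut of a loop composed of a crossing and of cuts of the two loops it splits off. -/
noncomputable def Cut.join {α : GenericLoop S} {p : Circ × Circ} (hp : p ∈ α.crossings)
    (K : Cut (α.arc p.1 p.2 hp.1 hp.2.1))
    (K' : Cut (α.arc p.2 p.1 hp.1.symm hp.2.1.symm)) : Cut α where
  chords := {p} ∪ ((fun q : Circ × Circ => (arcParam p.1 p.2 q.1, arcParam p.1 p.2 q.2)) '' K.chords ∪
    (fun q : Circ × Circ => (arcParam p.2 p.1 q.1, arcParam p.2 p.1 q.2)) '' K'.chords)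
  subset := by
    rintro _ (rfl | ⟨q, hq, rfl⟩ | ⟨q, hq, rfl⟩)
    · exact hp
    · exact (α.mem_crossings_arc _ _ q).1 (K.subset hq)
    · exact (α.mem_crossings_arc _ _ q).1 (K'.subset hq)
  unlinked := by
    have s1 : ∀ q ∈ K.chords, _ := fun q hq => sbtw_of_mem_arc hp (Or.inl rfl)
      ((α.mem_crossings_arc _ _ q).1 (K.subset hq))
    have s2 : ∀ q ∈ K'.chords, _ := fun q hq => sbtw_of_mem_arc hp (Or.inr rfl)
      ((α.mem_crossings_arc _ _ q).1 (K'.subset hq))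
    have l0 : ∀ {a b c d : Circ}, sbtw a c b → sbtw a d b → ¬ Linked (a, b) (c, d) := by
      rintro a b c d h1 h2 (h | h)
      · exact sbtw_asymm h2 h.2
      · exact sbtw_asymm h1 h.2
    have l0' : ∀ {a b c d : Circ}, sbtw a c b → sbtw a d b → ¬ Linked (c, d) (a, b) := by
      intro a b c d h1 h2 h
      unfold Linked at h
      simp only [sbtw_iff_cpos a, cpos_self] at *
      have := cpos_nonneg a b
      have := cpos_nonneg a c
      have := cpos_nonneg a d
      grind
    -- A chord with both ends in one open arc is unlinked from `p`; two chords in the same arc are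
    -- unlinked by the given cut, and two in different arcs because `p` separates them.
    rintro _ (rfl | ⟨q, hq, rfl⟩ | ⟨q, hq, rfl⟩) _ (rfl | ⟨r, hr, rfl⟩ | ⟨r, hr, rfl⟩) hqr
    · exact absurd rfl hqr
    · exact l0 (s1 r hr).1 (s1 r hr).2
    · exact fun h => l0 (s2 r hr).1 (s2 r hr).2 (linked_swap.1 h)
    · exact l0' (s1 q hq).1 (s1 q hq).2
    · exact fun h => K.unlinked q hq r hr (fun e => hqr (by rw [e]))
        ((linked_iff_of_cycMono (cycMono_arcParam hp.1)).1 h)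
    · exact not_linked_of_sbtw (s1 q hq).1 (s1 q hq).2 (s2 r hr).1 (s2 r hr).2
    · intro h
      refine l0' (s2 q hq).1 (s2 q hq).2 ?_
      unfold Linked at *
      tauto
    · exact not_linked_of_sbtw (s2 q hq).1 (s2 q hq).2 (s1 r hr).1 (s1 r hr).2
    · exact fun h => K'.unlinked q hq r hr (fun e => hqr (by rw [e]))
        ((linked_iff_of_cycMono (cycMono_arcParam hp.1.symm)).1 h)

/-- The cuts containing a crossing correspond to the pairs of cuts of the two loops it splits
off. -/
theorem Cut.arc_bijective {α : GenericLoop S} {p : Circ × Circ} (hp : p ∈ α.crossings) :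
    Function.Bijective
    (fun H : {H : Cut α // p ∈ H.chords} => (H.1.arc p.1 p.2 hp.1 hp.2.1,
      H.1.arc p.2 p.1 hp.1.symm hp.2.1.symm)) := by
  constructor
  · have key : ∀ H K : {H : Cut α // p ∈ H.chords},
        H.1.arc p.1 p.2 hp.1 hp.2.1 = K.1.arc p.1 p.2 hp.1 hp.2.1 →
        H.1.arc p.2 p.1 hp.1.symm hp.2.1.symm = K.1.arc p.2 p.1 hp.1.symm hp.2.1.symm →
        H.1.chords ⊆ K.1.chords := by
      intro H K h1 h2 q hq
      by_cases hqp : q = p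
      · rw [hqp]; exact K.2
      rcases GenericLoop.mem_crossings_cases hp (H.1.subset hq) hqp
        (H.1.unlinked p H.2 q hq (Ne.symm hqp)) with ⟨q', rfl⟩ | ⟨q', rfl⟩
      · have : q' ∈ (H.1.arc p.1 p.2 hp.1 hp.2.1).chords := hq
        rw [h1] at this
        exact this
      · have : q' ∈ (H.1.arc p.2 p.1 hp.1.symm hp.2.1.symm).chords := hq
        rw [h2] at this
        exact this
    intro H K h
    rw [Prod.mk.injEq] at h
    exact Subtype.ext (Cut.ext (Subset.antisymm (key H K h.1 h.2) (key K H h.1.symm h.2.symm)))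
  · rintro ⟨K, K'⟩
    refine ⟨⟨Cut.join hp K K', Or.inl rfl⟩, Prod.ext (Cut.ext ?_) (Cut.ext ?_)⟩
    · apply Subset.antisymm
      · rintro q (h | ⟨r, hr, h⟩ | ⟨r, hr, h⟩)
        · exact absurd (congrArg Prod.snd h) (arcParam_ne hp.1)
        · rw [Prod.mk.injEq] at h
          have : r = q := Prod.ext (arcParam_injective hp.1 h.1) (arcParam_injective hp.1 h.2)
          rwa [← this]
        · rw [Prod.mk.injEq] at h
          exact absurd h.1 (arcParam_ne_arcParam hp.1.symm _ _)
      · intro q hq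
        exact Or.inr (Or.inl ⟨q, hq, rfl⟩)
    · apply Subset.antisymm
      · rintro q (h | ⟨r, hr, h⟩ | ⟨r, hr, h⟩)
        · exact absurd (congrArg Prod.fst h) (arcParam_ne hp.1.symm)
        · rw [Prod.mk.injEq] at h
          exact absurd h.1 (arcParam_ne_arcParam hp.1 _ _)
        · rw [Prod.mk.injEq] at h
          have : r = q := Prod.ext (arcParam_injective hp.1.symm h.1)
            (arcParam_injective hp.1.symm h.2)
          rwa [← this]
      · intro q hq
        exact Or.inr (Or.inr ⟨q, hq, rfl⟩)

end Cuts

/-! ### Transfer of Lie cobrackets along split injections -/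

section AbstractTransfer

variable {R A B : Type*} [CommRing R] [AddCommGroup A] [Module R A] [AddCommGroup B] [Module R B]

/-- A Lie cobracket restricts along a homomorphism with a left inverse. -/
theorem IsLieCobracket.of_leftInverse {ν : A →ₗ[R] A ⊗[R] A} {ν' : B →ₗ[R] B ⊗[R] B}
    {f : A →ₗ[R] B} {π : B →ₗ[R] A} (hν' : IsLieCobracket ν') (hf : IsLieCoalgebraHom ν ν' f)
    (hπ : π ∘ₗ f = LinearMap.id) : IsLieCobracket ν := by
  -- The left inverse passes to tensor powers; over a general ring, injectivity of `f` alone would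
  -- not suffice here.
  have inj2 : Function.Injective (TensorProduct.map f f) := by
    refine Function.LeftInverse.injective (g := TensorProduct.map π π) fun x => ?_
    rw [← LinearMap.comp_apply, ← TensorProduct.map_comp, hπ, TensorProduct.map_id,
      LinearMap.id_apply]
  have inj3 : Function.Injective (TensorProduct.map f (TensorProduct.map f f)) := by
    refine Function.LeftInverse.injective (g := TensorProduct.map π (TensorProduct.map π π))
      fun x => ?_
    rw [← LinearMap.comp_apply, ← TensorProduct.map_comp, ← TensorProduct.map_comp, hπ,
      TensorProduct.map_id, TensorProduct.map_id, LinearMap.id_apply]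
  have hf' : ∀ a, TensorProduct.map f f (ν a) = ν' (f a) := fun a => (LinearMap.congr_fun hf a).symm
  have hcomm : ∀ x, TensorProduct.map f f (TensorProduct.comm R A A x) =
      TensorProduct.comm R B B (TensorProduct.map f f x) := by
    have : TensorProduct.map f f ∘ₗ (TensorProduct.comm R A A).toLinearMap =
        (TensorProduct.comm R B B).toLinearMap ∘ₗ TensorProduct.map f f :=
      TensorProduct.ext' fun x y => by simp
    exact fun x => LinearMap.congr_fun this x
  have hshift : ∀ x, TensorProduct.map f (TensorProduct.map f f) (cyclicShift R A x) =
      cyclicShift R B (TensorProduct.map f (TensorProduct.map f f) x) := by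
    have : TensorProduct.map f (TensorProduct.map f f) ∘ₗ cyclicShift R A =
        cyclicShift R B ∘ₗ TensorProduct.map f (TensorProduct.map f f) :=
      TensorProduct.ext (LinearMap.ext fun x => TensorProduct.ext (LinearMap.ext fun y =>
        LinearMap.ext fun z => by simp [cyclicShift_tmul]))
    exact fun x => LinearMap.congr_fun this x
  have hmap : ∀ x, TensorProduct.map f (TensorProduct.map f f)
      (TensorProduct.map LinearMap.id ν x) =
        TensorProduct.map LinearMap.id ν' (TensorProduct.map f f x) := by
    have : TensorProduct.map f (TensorProduct.map f f) ∘ₗ TensorProduct.map LinearMap.id ν =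
        TensorProduct.map LinearMap.id ν' ∘ₗ TensorProduct.map f f :=
      TensorProduct.ext' fun x y => by simp [hf']
    exact fun x => LinearMap.congr_fun this x
  refine ⟨LinearMap.ext fun a => inj2 ?_, LinearMap.ext fun a => inj3 ?_⟩
  · have := LinearMap.congr_fun hν'.skew (f a)
    simp only [LinearMap.comp_apply, LinearEquiv.coe_coe, LinearMap.neg_apply, map_neg] at this ⊢
    rw [hcomm, hf', this]
  · have := LinearMap.congr_fun hν'.jacobi (f a)
    simp only [LinearMap.comp_apply, LinearMap.add_apply, LinearMap.id_apply,
      LinearMap.zero_apply, map_add, map_zero] at this ⊢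
    simp only [hshift, hmap, hf']
    exact this

theorem sum_tmul_sub_tmul {ι κ : Type*} [Fintype ι] [Fintype κ] (f : ι → A) (g : κ → A) :
    ∑ x : ι × κ, (f x.1 ⊗ₜ[R] g x.2 - g x.2 ⊗ₜ[R] f x.1) =
      (∑ i, f i) ⊗ₜ[R] (∑ j, g j) - (∑ j, g j) ⊗ₜ[R] ∑ i, f i := by
  rw [Finset.sum_sub_distrib, Fintype.sum_prod_type, Fintype.sum_prod_type_right]
  simp only [TensorProduct.sum_tmul, TensorProduct.tmul_sum]
  congr 1
  · exact Finset.sum_comm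
  · exact Finset.sum_comm

theorem map_sum_tmul_sub_tmul {ι : Type*} [Fintype ι] (h : A →ₗ[R] B) (f g : ι → A) :
    TensorProduct.map h h (∑ i, (f i ⊗ₜ[R] g i - g i ⊗ₜ[R] f i)) =
      ∑ i, (h (f i) ⊗ₜ[R] h (g i) - h (g i) ⊗ₜ[R] h (f i)) := by
  simp

end AbstractTransfer

/-! ### The maps on the loop module and the homomorphism identity -/

section LoopMaps

variable (R : Type*) [CommRing R]
  {S : Type*} [TopologicalSpace S] [ChartedSpace (EuclideanHalfSpace 2) S]

theorem loopModule_hom_ext {M : Type*} [AddCommMonoid M] [Module R M]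
    {f g : LoopModule R S →ₗ[R] M} (h : ∀ α : GenericLoop S, f (α.gen R) = g (α.gen R)) :
    f = g := by
  refine Finsupp.lhom_ext' fun q => LinearMap.ext_ring ?_
  obtain ⟨α, rfl⟩ := Quotient.exists_rep q
  exact h α

theorem GenericLoop.gen_eq_of_isotopic {α β : GenericLoop S} (h : Isotopic α β) :
    α.gen R = β.gen R := by
  rw [gen, gen, cls, cls, Quotient.sound (s := isotopySetoid S) h]

/-- Both parametrizations cover the open arc from `f a` to `f b`, and beyond it only the base point
`f a`. -/
theorem GenericLoop.isotopic_arc [T2Space S] {α β : GenericLoop S} (f : Circ ≃ₜ Circ)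
    (hf : CycMono f) (h : unitInterval → S ≃ₜ S)
    (hc : Continuous (fun p : unitInterval × S => h p.1 p.2)) (h0 : h 0 = Homeomorph.refl S)
    (hβ : ∀ x, β.toFun x = h 1 (α.toFun (f x))) {a b : Circ} (hne : a ≠ b)
    (hab : β.toFun a = β.toFun b) (hne' : f a ≠ f b) (hab' : α.toFun (f a) = α.toFun (f b)) :
    Isotopic (α.arc (f a) (f b) hne' hab') (β.arc a b hne hab) := by
  refine isotopic_of_cycMono (α := α.toFun) (A := Set.cIoo (f a) (f b)) (cycMono_arcParam hne')
    (hf.comp (cycMono_arcParam hne)) (fun x hx => exists_arcParam hx) (fun x hx => ?_)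
    ((finite_singleton (f a)).subset ?_) ((finite_singleton (f a)).subset ?_) h hc h0
    (fun _ => rfl) fun _ => hβ _
  · obtain ⟨y, rfl⟩ := f.surjective x
    obtain ⟨t, rfl⟩ := exists_arcParam (hf.sbtw_iff.1 hx)
    exact ⟨t, rfl⟩
  · rintro _ ⟨⟨x, rfl⟩, hx⟩
    exact (arcParam_mem hne' x).resolve_right hx
  · rintro _ ⟨⟨x, rfl⟩, hx⟩
    exact ((arcParam_mem hne x).imp (congrArg f) (hf _ _ _)).resolve_right hx

variable [T2Space S] [IsManifold (𝓡∂ 2) ∞ S] [OrientedAtlas S]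

/-- The parameter change matches the crossings together with the order of their preimages, so the
tensor factors correspond without a change of sign. -/
theorem GenericLoop.cobracket_eq_of_isotopic {α β : GenericLoop S} (hαβ : Isotopic α β) :
    α.cobracket R = β.cobracket R := by
  obtain ⟨f, hf, h, hc, h0, hβ⟩ := hαβ
  have hcr := mem_crossings_of_isotopy f hf h hc h0 hβ
  let e : β.crossings ≃ α.crossings :=
    { toFun p := ⟨(f p.1.1, f p.1.2), (hcr p.1).1 p.2⟩
      invFun q := ⟨(f.symm q.1.1, f.symm q.1.2), (hcr _).2 (by simp)⟩
      left_inv p := by simp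
      right_inv q := by simp }
  refine (Fintype.sum_equiv e _ _ fun p => ?_).symm
  have key : ∀ {a b : Circ} (hne : a ≠ b) (hab : β.toFun a = β.toFun b) (hne' : f a ≠ f b)
      (hab' : α.toFun (f a) = α.toFun (f b)),
      (β.arc a b hne hab).gen R = (α.arc (f a) (f b) hne' hab').gen R :=
    fun hne hab hne' hab' =>
      (gen_eq_of_isotopic R (isotopic_arc f hf h hc h0 hβ hne hab hne' hab')).symm
  have e1 := key p.2.1 p.2.2.1 ((hcr p.1).1 p.2).1 ((hcr p.1).1 p.2).2.1
  have e2 := key p.2.1.symm p.2.2.1.symm ((hcr p.1).1 p.2).1.symm ((hcr p.1).1 p.2).2.1.symm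
  exact congrArg₂ (fun x y => x ⊗ₜ[R] y - y ⊗ₜ[R] x) e1 e2

theorem GenericLoop.sum_tree_eq_of_isotopic {α β : GenericLoop S} (hαβ : Isotopic α β) :
    ∑ H : Cut α, H.tree.gen R = ∑ H : Cut β, H.tree.gen R := by
  obtain ⟨f, hf, h, hc, h0, hβ⟩ := hαβ
  have hcr := mem_crossings_of_isotopy f hf h hc h0 hβ
  have hcr' : ∀ q : Circ × Circ, q ∈ α.crossings ↔ (f.symm q.1, f.symm q.2) ∈ β.crossings :=
    fun q => by rw [hcr]; simp
  let e : Cut α ≃ Cut β :=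
    { toFun H := H.pull f hf hcr
      invFun H := H.pull f.symm (sbtw_symm_of_sbtw hf) hcr'
      left_inv H := Cut.ext (by ext q; simp [Cut.pull])
      right_inv H := Cut.ext (by ext q; simp [Cut.pull]) }
  refine Fintype.sum_equiv e _ _ fun H => ?_
  rw [PlaneTree.gen_eq_genOn_univ]
  exact Cut.genOn_tree (isSubsplitting_pull H hf f.surjective hcr) h hc h0 hβ

variable (S)

/-- The cobracket on the module of loops. -/
noncomputable def loopCobracket : LoopModule R S →ₗ[R] LoopModule R S ⊗[R] LoopModule R S :=
  Finsupp.linearCombination R (Quotient.lift (s := isotopySetoid S) (fun α => α.cobracket R)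
    fun _ _ h => GenericLoop.cobracket_eq_of_isotopic R h)

/-- The map from loops to trees that sums over all cuts. -/
noncomputable def loopToTree : LoopModule R S →ₗ[R] TreeModule R (LoopClass S) :=
  Finsupp.linearCombination R (Quotient.lift (s := isotopySetoid S)
    (fun α => ∑ H : Cut α, H.tree.gen R) fun _ _ h => GenericLoop.sum_tree_eq_of_isotopic R h)

variable {S}

theorem loopCobracket_gen (α : GenericLoop S) : loopCobracket R S (α.gen R) = α.cobracket R :=
  (Finsupp.linearCombination_single R _ _).trans (one_smul R _)

theorem loopToTree_gen (α : GenericLoop S) :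
    loopToTree R S (α.gen R) = ∑ H : Cut α, H.tree.gen R :=
  (Finsupp.linearCombination_single R _ _).trans (one_smul R _)

theorem sum_mem_comm {ι κ M : Type*} [Fintype ι] [AddCommMonoid M] (c : ι → Set κ) (s : Set κ)
    [Fintype s] (hcs : ∀ i, c i ⊆ s) [∀ i, Fintype (c i)] [∀ p : s, Fintype {i // p.1 ∈ c i}]
    (G : ∀ i p, p ∈ c i → M) : ∑ i, ∑ p : c i, G i p p.2 =
      ∑ p : s, ∑ i : {i // p.1 ∈ c i}, G i.1 p.1 i.2 := by
  rw [← Fintype.sum_sigma', ← Fintype.sum_sigma']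
  exact Fintype.sum_equiv
    { toFun x := ⟨⟨x.2.1, hcs _ x.2.2⟩, x.1, x.2.2⟩
      invFun x := ⟨x.2.1, x.1.1, x.2.2⟩
      left_inv _ := rfl
      right_inv _ := rfl } _ _ fun _ => rfl

/-- Both sides are sums over pairs of a cut and a chord in it. Summing over the chord last, the cuts
containing `p` are by `Cut.arc_bijective` pairs of cuts of the two arcs, and the inner sum becomes a
difference of products of sums. -/
theorem isLieCoalgebraHom_loopToTree :
    IsLieCoalgebraHom (loopCobracket R S) (PlaneTree.treeCobracket (LoopClass S) R)
      (loopToTree R S) := by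
  classical
  refine loopModule_hom_ext R fun α => ?_
  have hfin : ∀ H : Cut α, Fintype H.chords := fun H => H.isChordSystem.finite.fintype
  have hl : PlaneTree.treeCobracket (LoopClass S) R (loopToTree R S (α.gen R)) =
      ∑ H : Cut α, H.tree.cobracket R := by
    rw [loopToTree_gen, map_sum]
    exact Finset.sum_congr rfl fun H _ => PlaneTree.treeCobracket_gen R _
  have hr : TensorProduct.map (loopToTree R S) (loopToTree R S)
      (loopCobracket R S (α.gen R)) = ∑ p : α.crossings,
      ((∑ K : Cut (α.arc p.1.1 p.1.2 p.2.1 p.2.2.1), K.tree.gen R) ⊗ₜ[R]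
        (∑ K : Cut (α.arc p.1.2 p.1.1 p.2.1.symm p.2.2.1.symm), K.tree.gen R) -
      (∑ K : Cut (α.arc p.1.2 p.1.1 p.2.1.symm p.2.2.1.symm), K.tree.gen R) ⊗ₜ[R]
        (∑ K : Cut (α.arc p.1.1 p.1.2 p.2.1 p.2.2.1), K.tree.gen R)) := by
    rw [loopCobracket_gen]
    refine (map_sum_tmul_sub_tmul (loopToTree R S) _ _).trans (Finset.sum_congr rfl fun p _ => ?_)
    rw [loopToTree_gen, loopToTree_gen]
  refine hl.trans (Eq.trans ?_ hr.symm)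
  refine (Finset.sum_congr rfl fun H _ => H.cobracket_tree).trans ?_
  refine (sum_mem_comm (fun H : Cut α => H.chords) α.crossings (fun H => H.subset)
    fun H p hp => ((H.arc p.1 p.2 (H.subset hp).1 (H.subset hp).2.1).tree.gen R ⊗ₜ[R]
        (H.arc p.2 p.1 (H.subset hp).1.symm (H.subset hp).2.1.symm).tree.gen R -
      (H.arc p.2 p.1 (H.subset hp).1.symm (H.subset hp).2.1.symm).tree.gen R ⊗ₜ[R]
        (H.arc p.1 p.2 (H.subset hp).1 (H.subset hp).2.1).tree.gen R)).trans ?_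
  refine Finset.sum_congr rfl fun p _ => ?_
  refine Eq.trans ?_ (sum_tmul_sub_tmul (R := R)
    (fun K : Cut (α.arc p.1.1 p.1.2 p.2.1 p.2.2.1) => K.tree.gen R)
    fun K : Cut (α.arc p.1.2 p.1.1 p.2.1.symm p.2.2.1.symm) => K.tree.gen R)
  exact Fintype.sum_bijective _ (Cut.arc_bijective p.2) _ _ fun H => rfl

end LoopMaps

/-! ### Recovering a loop from the sum of its trees -/

section LeftInverse

variable (R : Type*) [CommRing R] {L : Type*}

open Classical in
/-- The label of a tree with a single vertex, as an element of the free module on the labels. -/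
noncomputable def PlaneTree.soleLabel (T : PlaneTree L) : L →₀ R :=
  if Subsingleton T.V then ∑ v, Finsupp.single (T.label v) 1 else 0

theorem PlaneTree.soleLabel_eq_of_homeomorphic {T T' : PlaneTree L} (h : Homeomorphic T T') :
    T.soleLabel R = T'.soleLabel R := by
  obtain ⟨φ, -, h2, -⟩ := h
  rw [soleLabel, soleLabel, φ.subsingleton_congr]
  congr 1
  exact Fintype.sum_equiv φ _ _ fun v => by rw [h2]

variable (L) in
/-- The linear map that takes a tree with a single vertex to its label and every other tree
to `0`. -/
noncomputable def treeToLabel : TreeModule R L →ₗ[R] L →₀ R :=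
  Finsupp.linearCombination R (Quotient.lift (s := PlaneTree.setoid L) (fun T => T.soleLabel R)
    fun _ _ h => PlaneTree.soleLabel_eq_of_homeomorphic R h)

theorem treeToLabel_gen (T : PlaneTree L) : treeToLabel R L (T.gen R) = T.soleLabel R := by
  rw [treeToLabel, PlaneTree.gen, Finsupp.linearCombination_single, one_smul]
  rfl

/-- A chord has a face on each of its sides. -/
theorem not_subsingleton_face {H : Set (Circ × Circ)} (hH : IsChordSystem H) (hne : H.Nonempty) :
    ¬ Subsingleton (Face H) := by
  obtain ⟨p, hp⟩ := hne
  intro hs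
  obtain ⟨V, hV, -⟩ := Face.exists_next_face hH hp True
  obtain ⟨W, hW, -⟩ := Face.exists_next_face hH hp False
  rw [Subsingleton.elim W V] at hW
  tauto

variable {S : Type*} [TopologicalSpace S] [ChartedSpace (EuclideanHalfSpace 2) S]

theorem faceOf_empty (x : Circ) : faceOf ∅ x = univ :=
  eq_univ_of_forall fun _ => ⟨fun _ h => h.elim, fun _ h => h.elim⟩

variable [T2Space S]

/-- Without chords the whole circle is the only face. The chosen face loop need not be `α` itself,
but it runs along `α` through a cyclically monotone surjection and is therefore isotopic to it. -/
theorem Cut.soleLabel_tree_of_empty {α : GenericLoop S} (H : Cut α) (hH : H.chords = ∅) :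
    H.tree.soleLabel R = α.gen R := by
  have huniv : ∀ V : Face H.chords, V.1 = univ := fun V => by
    obtain ⟨x, -, hx⟩ := V.2
    rw [hx, hH, faceOf_empty]
  let V₀ : Face H.chords := ⟨_, 0, fun p hp => by simp [hH] at hp, rfl⟩
  have hs : Subsingleton H.tree.V :=
    ⟨fun V W => Subtype.ext ((huniv V).trans (huniv W).symm)⟩
  have hsum := Fintype.sum_subsingleton
    (fun v => Finsupp.single (H.tree.label v) (1 : R)) (show H.tree.V from V₀)
  rw [PlaneTree.soleLabel, if_pos hs, hsum]
  refine GenericLoop.gen_eq_of_isotopic R (α := H.faceLoop V₀) ?_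
  obtain ⟨g, hg, hg1, -, hg3⟩ := Classical.choose_spec (H.exists_runsAlong V₀)
  rw [huniv V₀] at hg1
  exact isotopic_of_cycMono (A := univ) (α := α.toFun) (g₂ := id) hg (fun _ _ _ h => h) hg1
    (by simp) (by simp) (by simp) (fun _ => Homeomorph.refl S) continuous_const_isotopy rfl hg3
    fun _ => rfl

variable [IsManifold (𝓡∂ 2) ∞ S] [OrientedAtlas S]

theorem treeToLabel_comp_loopToTree :
    treeToLabel R (LoopClass S) ∘ₗ loopToTree R S = LinearMap.id := by
  refine loopModule_hom_ext R fun α => ?_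
  let H₀ : Cut α := ⟨∅, empty_subset _, fun _ h => h.elim⟩
  rw [LinearMap.comp_apply, loopToTree_gen, map_sum, LinearMap.id_apply]
  refine (Finset.sum_eq_single H₀ (fun H _ hH => ?_) (by simp)).trans
    ((treeToLabel_gen R _).trans (H₀.soleLabel_tree_of_empty R rfl))
  refine (treeToLabel_gen R _).trans (if_neg (not_subsingleton_face H.isChordSystem ?_))
  exact nonempty_iff_ne_empty.2 fun h => hH (Cut.ext h)

end LeftInverse

end LoopTree

theorem mainTheorem3 {R : Type*} [CommRing R] {S : Type*} [TopologicalSpace S] [T2Space S]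
    [ChartedSpace (EuclideanHalfSpace 2) S] [IsManifold (𝓡∂ 2) ∞ S] [OrientedAtlas S] :
    ∃ (ν₀ : LoopModule R S →ₗ[R] LoopModule R S ⊗[R] LoopModule R S)
      (νT : TreeModule R (LoopClass S) →ₗ[R]
        TreeModule R (LoopClass S) ⊗[R] TreeModule R (LoopClass S))
      (η₀ : LoopModule R S →ₗ[R] TreeModule R (LoopClass S)),
      (∀ α : GenericLoop S, ν₀ (α.gen R) = α.cobracket R) ∧
      (∀ T : PlaneTree (LoopClass S), νT (T.gen R) = T.cobracket R) ∧
      (∀ α : GenericLoop S, η₀ (α.gen R) = ∑ H : Cut α, H.tree.gen R) ∧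
      IsLieCobracket ν₀ ∧ IsLieCobracket νT ∧
      IsLieCoalgebraHom ν₀ νT η₀ :=
  ⟨loopCobracket R S, PlaneTree.treeCobracket (LoopClass S) R, loopToTree R S,
    loopCobracket_gen R, PlaneTree.treeCobracket_gen R, loopToTree_gen R,
    (PlaneTree.isLieCobracket_treeCobracket R).of_leftInverse (isLieCoalgebraHom_loopToTree R)
      (treeToLabel_comp_loopToTree R),
    PlaneTree.isLieCobracket_treeCobracket R, isLieCoalgebraHom_loopToTree R⟩
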